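/- **Notation.** Let $M$ be a partial order. Elements $a,b\in M$ are *incompatible*, $a\parallel b$, if they have no common upper bound. For $B\subseteq M$ put $B_{\ge\eta}=\{\nu\in B:\eta\le\nu\}$, let $\max(B)$ be the set of maximal elements of $B$, and let $\mathrm{suc}_B(\eta)$ be the set of immediate successors of $\eta$ in $B$. A *front* of $B$ is a set $Y\subseteq B$ of pairwise incomparable elements that meets every maximal chain of $B$; $B[\le Y]=\{\nu\in B:(\exists\eta\in Y)\,\nu\le\eta\}$. $\mathrm{CWT}(M)$ is the set of all countable $B\subseteq M$ with a least element $\mathrm{rt}(B)$ such that $B$ is a tree, all chains in $B$ are finite, every $\mathrm{suc}_B(\nu)$ $(\nu\in B)$ is empty or infinite, any two incomparable elements of $B$ are incompatible in $M$, and for every $\nu\in B\setminus\max(B)$ and every finite $F\subseteq\{\rho\in M:\rho\not\le\nu\}$ there are infinitely many $\sigma\in\mathrm{suc}_B(\nu)$ incompatible with all members of $F$. For $B\in\mathrm{CWT}(M)$: $\mathrm{sb}(B)$ is the set of $B'\in\mathrm{CWT}(M)$, $B'\subseteq B$, with the same root, such that for all $\nu\in B'$, $\mathrm{suc}_{B'}(\nu)\subseteq\mathrm{suc}_B(\nu)$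 with finite difference; $\mathrm{psb}(B)$ is the set of $B'\in\mathrm{CWT}(M)$, $B'\subseteq B$, with the same root, such that $\mathrm{suc}_{B'}(\nu)$ is an infinite subset of $\mathrm{suc}_B(\nu)$ for all $\nu\in B'\setminus\max(B)$. An *almost front* of $B$ is a set $Y\subseteq M$ of pairwise incomparable elements such that $Y\cap B'$ is a front of $B'$ for some $B'\in\mathrm{sb}(B)$. For $B_1,B_2\in\mathrm{CWT}(M)$ let $B_1\le^*_MB_2$ mean: $\mathrm{rt}(B_1)=\mathrm{rt}(B_2)$ and there is $B_2'\in\mathrm{sb}(B_2)$ with $B_2'\cap B_1\in\mathrm{psb}(B_1)$ such that every almost front of $B_2'\cap B_1$ is an almost front of $B_2$. $\mathbf K$ is the class of systems $\mathbf x$ consisting of a partial order $M=M_{\mathbf x}$ with a least element $\mathrm{rt}$, families $\mathscr A_\eta\subseteq\mathrm{CWT}(M)$ $(\eta\in M)$ with $\{\eta\}\in\mathscr A_\eta$, with $\mathrm{rt}(B)=\eta$ for $B\in\mathscr A_\eta$, and with $B_{\ge\nu}\in\mathscr A_\nu$ whenever $\nu\in B\in\mathscr A_\eta$, and a directed partial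 order $\le_{\mathbf x}$ on $\mathscr B_{\mathbf x}=\mathscr A_{\mathrm{rt}}\setminus\{\{\mathrm{rt}\}\}$ such that $B_1\le_{\mathbf x}B_2$ implies $B_1\le^*_MB_2$. Put $\mathscr A_{\mathbf x}=\bigcup\{\mathscr A_\eta:\eta\ne\mathrm{rt}\}$. For $Y\subseteq M$ let $D_Y$ be the family of those $Z\subseteq Y$ for which there are $B\in\mathscr B_{\mathbf x}$ having $Y$ as an almost front and $B'\in\mathrm{sb}(B)$ with $B'\cap Y\subseteq Z$. A set $\mathscr I\subseteq\mathscr A_{\mathbf x}$ is *$\mathbf x$-dense* if for every $B_1\in\mathscr B_{\mathbf x}$ there is $B_2\in\mathscr B_{\mathbf x}$ with $B_1\le_{\mathbf x}B_2$ such that for every finite $A\subseteq M\setminus\{\mathrm{rt}\}$ there is $\nu\in\mathrm{suc}_{B_2}(\mathrm{rt})$ with $(B_2)_{\ge\nu}\in\mathscr I$ and $\rho\parallel\nu$ for all $\rho\in A$. It is *$\mathbf x$-open* if $B_1\in\mathscr I$, $B'\in\mathscr A_{\mathbf x}$ and $B_1\le^*_MB'$ imply $B'\in\mathscr I$. **Theorem.**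 Assume $\diamondsuit_{\aleph_1}$. There is $\mathbf x\in\mathbf K$ such that: (a) $\mathscr A_\eta\ne\{\{\eta\}\}$ for every $\eta\in M$, and $\mathscr B_{\mathbf x}$ is $\aleph_1$-directed under $\le_{\mathbf x}$ (every countable subset has an upper bound); (b) if $B\in\mathscr B_{\mathbf x}$ and $Y$ is a front of $B$, then $D_Y$ is an ultrafilter on $Y$, and it is nonprincipal iff $Y\ne\{\mathrm{rt}\}$; (c) for every $B_1\in\mathscr B_{\mathbf x}$ there is $B_2\in\mathscr B_{\mathbf x}$ with $B_1\le_{\mathbf x}B_2$ and $B_1\cap\mathrm{suc}_{B_2}(\mathrm{rt})=\emptyset$ such that for every $\sigma\in\mathrm{suc}_{B_2}(\mathrm{rt})$ there are infinitely many $\rho\in\mathrm{suc}_{B_1}(\mathrm{rt})$ with $\sigma\le\rho$; (d) if $B\in\mathscr A_\eta$ and $Y$ is a front of $B$, then $B[\le Y]\in\mathscr A_\eta$; (e) if $B\in\mathscr B_{\mathbf x}$ and $Y$ is a front of $B$, then $D_Y$ is a $Q$-point: $Y$ is countable and every finite-to-one function on $Y$ is one-to-one on a member of $D_Y$; (f)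 $\mathbf x$ is - *fat*: if $B\in\mathscr B_{\mathbf x}$ and $B'\in\mathrm{sb}(B)$, there is $B''\in\mathrm{sb}(B')\cap\mathscr B_{\mathbf x}$ with $B\le_{\mathbf x}B''$; - *big*: if $B\in\mathscr B_{\mathbf x}$ and $c:\max(B)\to\{0,1\}$, there is $B'\in\mathrm{psb}(B)\cap\mathscr B_{\mathbf x}$ with $B\le_{\mathbf x}B'$ such that $c\restriction\max(B')$ is constant; - *large*: if $B\in\mathscr B_{\mathbf x}$ and $c$ is a function with domain $\max(B)$, there are $B'\in\mathscr B_{\mathbf x}$ with $B\le_{\mathbf x}B'$ and $\max(B')\subseteq\max(B)$ and a front $Y$ of $B'$ such that for all $\eta,\nu\in\max(B')$: $c(\eta)=c(\nu)$ iff some $\rho\in Y$ satisfies $\rho\le\eta$ and $\rho\le\nu$; - *full*: if $\eta\ne\mathrm{rt}$, $B\in\mathscr A_\eta$ and $B'\in\mathrm{psb}(B)$, then $B'\in\mathscr A_\eta$; (g) $\mathbf x$ is *good*: (a) and (c) hold, and if $\mathscr I$ is $\mathbf x$-dense and $\mathbf x$-open and $B_1\in\mathscr B_{\mathbf x}$,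 then there is $B_2\in\mathscr B_{\mathbf x}$ with $B_1\le_{\mathbf x}B_2$ such that $(B_2)_{\ge\eta}\in\mathscr I$ for all but finitely many $\eta\in\mathrm{suc}_{B_2}(\mathrm{rt})$. -/

import Mathlib

open Set
open scoped Ordinal

/-- The diamond principle on `ℵ₁`: there are sets `S α ⊆ α` for `α < ω₁` such that every subset `A`
of `ω₁` satisfies `A ∩ α = S α` for stationarily many `α < ω₁`. -/
def DiamondAlephOne : Prop :=
  ∃ S : (Ordinal.omega.{0} 1).ToType → Set (Ordinal.omega.{0} 1).ToType,
    (∀ α, S α ⊆ Iio α) ∧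
    ∀ A : Set (Ordinal.omega.{0} 1).ToType, IsStationary {α | A ∩ Iio α = S α}

namespace CWT

section Trees

variable {M : Type*} [PartialOrder M]

/-- `a ∥ b`: the elements `a`, `b` have no common upper bound. -/
def Incompat (a b : M) : Prop := ¬ ∃ c, a ≤ c ∧ b ≤ c

/-- `B_{≥ η}`. -/
def above (B : Set M) (η : M) : Set M := {ν ∈ B | η ≤ ν}

/-- `max(B)`. -/
def maxs (B : Set M) : Set M := {η ∈ B | ∀ ν ∈ B, ¬ η < ν}

/-- `suc_B(η)`, the set of immediate successors of `η` in `B`. -/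
def suc (B : Set M) (η : M) : Set M :=
  {ν ∈ B | η < ν ∧ ¬ ∃ ρ ∈ B, η < ρ ∧ ρ < ν}

/-- `B[≤ Y]`. -/
def below (B Y : Set M) : Set M := {ν ∈ B | ∃ η ∈ Y, ν ≤ η}

/-- `C` is a branch (a maximal chain) of `B`. -/
def IsBranch (B C : Set M) : Prop :=
  Maximal (fun D : Set M => D ⊆ B ∧ IsChain (· ≤ ·) D) C

/-- `Y` is a front of `B`: a set of pairwise incomparable elements of `B` that meets every
branch of `B`. -/
def IsFront (B Y : Set M) : Prop :=
  Y ⊆ B ∧ IsAntichain (· ≤ ·) Y ∧ ∀ C, IsBranch B C → (C ∩ Y).Nonempty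

/-- `B ∈ CWT(M)`: `B` is a countable well-founded subtree of `M`. -/
structure IsCWT (B : Set M) : Prop where
  countable : B.Countable
  exists_root : ∃ r, IsLeast B r
  /-- the predecessors of a node form a chain (a finite one, by the next clause) -/
  isTree : ∀ ν ∈ B, IsChain (· ≤ ·) {ρ ∈ B | ρ < ν}
  chain_finite : ∀ C ⊆ B, IsChain (· ≤ ·) C → C.Finite
  suc_empty_or_infinite : ∀ ν ∈ B, suc B ν = ∅ ∨ (suc B ν).Infinite
  incompat : ∀ η ∈ B, ∀ ν ∈ B, ¬ η ≤ ν → ¬ ν ≤ η → Incompat η ν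
  positive : ∀ ν ∈ B \ maxs B, ∀ F : Set M, F.Finite → (∀ ρ ∈ F, ¬ ρ ≤ ν) →
    {σ ∈ suc B ν | ∀ ρ ∈ F, Incompat ρ σ}.Infinite

/-- `rt(B₁) = rt(B₂)`. -/
def SameRoot (B₁ B₂ : Set M) : Prop := ∃ r, IsLeast B₁ r ∧ IsLeast B₂ r

/-- `B' ∈ sb(B)`: `B'` is an exhaustive subtree of `B`. -/
structure IsSb (B B' : Set M) : Prop where
  isCWT : IsCWT B'
  subset : B' ⊆ B
  sameRoot : SameRoot B' B
  suc_subset : ∀ ν ∈ B', suc B' ν ⊆ suc B ν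
  finite_diff : ∀ ν ∈ B', (suc B ν \ suc B' ν).Finite

/-- `B' ∈ psb(B)`: `B'` is a positive subtree of `B`. -/
structure IsPsb (B B' : Set M) : Prop where
  isCWT : IsCWT B'
  subset : B' ⊆ B
  sameRoot : SameRoot B' B
  suc_subset : ∀ ν ∈ B' \ maxs B, suc B' ν ⊆ suc B ν
  suc_infinite : ∀ ν ∈ B' \ maxs B, (suc B' ν).Infinite

/-- `Y` is an almost front of `B`. -/
def IsAlmFront (B Y : Set M) : Prop :=
  IsAntichain (· ≤ ·) Y ∧ ∃ B', IsSb B B' ∧ IsFront B' (Y ∩ B')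

/-- `B₁ ≤*_M B₂`. -/
def LeStar (B₁ B₂ : Set M) : Prop :=
  IsCWT B₁ ∧ IsCWT B₂ ∧ SameRoot B₁ B₂ ∧
    ∃ B₂', IsSb B₂ B₂' ∧ IsPsb B₁ (B₂' ∩ B₁) ∧
      ∀ Y, IsAlmFront (B₂' ∩ B₁) Y → IsAlmFront B₂ Y

end Trees

/-- The systems of the class `K` on the partial order `M`, whose smallest element is the root `⊥`.
The relation `le` is a directed partial order on the set `𝓑` of the nontrivial trees with
root `⊥`. -/
structure System (M : Type*) [PartialOrder M] [OrderBot M] where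
  /-- `fam η` is the family `𝓐_η` -/
  fam : M → Set (Set M)
  isCWT : ∀ η, ∀ B ∈ fam η, IsCWT B
  isLeast : ∀ η, ∀ B ∈ fam η, IsLeast B η
  singleton_mem : ∀ η, {η} ∈ fam η
  above_mem : ∀ η, ∀ B ∈ fam η, ∀ ν ∈ B, above B ν ∈ fam ν
  /-- the order `≤_x` -/
  le : Set M → Set M → Prop
  le_dom : ∀ B₁ B₂, le B₁ B₂ → B₁ ∈ fam ⊥ \ {{⊥}} ∧ B₂ ∈ fam ⊥ \ {{⊥}}
  le_refl : ∀ B ∈ fam ⊥ \ {{⊥}}, le B B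
  le_trans : ∀ B₁ B₂ B₃, le B₁ B₂ → le B₂ B₃ → le B₁ B₃
  le_antisymm : ∀ B₁ B₂, le B₁ B₂ → le B₂ B₁ → B₁ = B₂
  le_directed : DirectedOn le (fam ⊥ \ {{⊥}})
  le_leStar : ∀ B₁ B₂, le B₁ B₂ → LeStar B₁ B₂

/-- The ultrafilter `U` on the countable set `α` is a Q-point: every finite-to-one function on `α`
is one-to-one on a member of `U`. -/
def IsQPoint {α : Type*} (U : Ultrafilter α) : Prop :=
  Countable α ∧ ∀ (β : Type) (f : α → β), (∀ b, (f ⁻¹' {b}).Finite) → ∃ A ∈ U, InjOn f A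

namespace System

variable {M : Type*} [PartialOrder M] [OrderBot M] (x : System M)

/-- `𝓑_x`. -/
def roots : Set (Set M) := x.fam ⊥ \ {{⊥}}

/-- `𝓐_x`, the union of the families `𝓐_η` over `η ≠ rt`. -/
def trees : Set (Set M) := {B | ∃ η, η ≠ ⊥ ∧ B ∈ x.fam η}

/-- `D_Y`, a family of subsets of `Y`. -/
def filt (Y : Set M) : Set (Set M) :=
  {Z | Z ⊆ Y ∧ ∃ B ∈ x.roots, ∃ B', IsSb B B' ∧ IsAlmFront B Y ∧ B' ∩ Y ⊆ Z}

/-- `D_Y` is an ultrafilter on `Y`, namely `U`. -/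
def FiltIs (Y : Set M) (U : Ultrafilter Y) : Prop :=
  ∀ Z : Set Y, Z ∈ U ↔ Subtype.val '' Z ∈ x.filt Y

/-- Every family is nontrivial, and `𝓑_x` is `ℵ₁`-directed. -/
def ClauseA : Prop :=
  (∀ η, x.fam η ≠ {{η}}) ∧
  ∀ S : Set (Set M), S ⊆ x.roots → S.Countable → ∃ B ∈ x.roots, ∀ B₁ ∈ S, x.le B₁ B

/-- `D_Y` is an ultrafilter for every front `Y` of a tree in `𝓑_x`, nonprincipal iff
`Y ≠ {rt}`. -/
def ClauseB : Prop :=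
  ∀ B ∈ x.roots, ∀ Y, IsFront B Y →
    ∃ U : Ultrafilter Y, x.FiltIs Y U ∧ ((∀ y : Y, U ≠ pure y) ↔ Y ≠ {⊥})

def ClauseC : Prop :=
  ∀ B₁ ∈ x.roots, ∃ B₂ ∈ x.roots, x.le B₁ B₂ ∧ B₁ ∩ suc B₂ ⊥ = ∅ ∧
    ∀ σ ∈ suc B₂ ⊥, {ρ ∈ suc B₁ ⊥ | σ ≤ ρ}.Infinite

def ClauseD : Prop :=
  ∀ η, ∀ B ∈ x.fam η, ∀ Y, IsFront B Y → below B Y ∈ x.fam η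

/-- `D_Y` is a Q-point for every front `Y` of a tree in `𝓑_x`. -/
def ClauseE : Prop :=
  ∀ B ∈ x.roots, ∀ Y, IsFront B Y → ∃ U : Ultrafilter Y, x.FiltIs Y U ∧ IsQPoint U

def Fat : Prop :=
  ∀ B ∈ x.roots, ∀ B', IsSb B B' → ∃ B'', IsSb B' B'' ∧ B'' ∈ x.roots ∧ x.le B B''

def Big : Prop :=
  ∀ B ∈ x.roots, ∀ c : maxs B → Bool, ∃ B' ∈ x.roots, IsPsb B B' ∧ x.le B B' ∧
    ∃ i, ∀ η : maxs B, η.1 ∈ maxs B' → c η = i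

/-- Every function on `max(B)` is canonical on `max(B')` for some `B' ≥ B` with
`max(B') ⊆ max(B)`. -/
def Large : Prop :=
  ∀ B ∈ x.roots, ∀ (β : Type) (c : maxs B → β),
    ∃ B' ∈ x.roots, x.le B B' ∧ maxs B' ⊆ maxs B ∧ ∃ Y, IsFront B' Y ∧
      ∀ η ν : maxs B, η.1 ∈ maxs B' → ν.1 ∈ maxs B' →
        (c η = c ν ↔ ∃ ρ ∈ Y, ρ ≤ η.1 ∧ ρ ≤ ν.1)

def Full : Prop :=
  ∀ η, η ≠ ⊥ → ∀ B ∈ x.fam η, ∀ B', IsPsb B B' → B' ∈ x.fam η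

/-- `x` is nice. -/
structure IsNice : Prop where
  clauseA : x.ClauseA
  clauseB : x.ClauseB
  clauseC : x.ClauseC
  clauseD : x.ClauseD
  clauseE : x.ClauseE
  fat : x.Fat
  big : x.Big
  large : x.Large
  full : x.Full

/-- `I` is `x`-dense. -/
def IsDense (I : Set (Set M)) : Prop :=
  I ⊆ x.trees ∧
  ∀ B₁ ∈ x.roots, ∃ B₂ ∈ x.roots, x.le B₁ B₂ ∧
    ∀ A : Set M, A.Finite → ⊥ ∉ A →
      ∃ ν ∈ suc B₂ ⊥, above B₂ ν ∈ I ∧ ∀ ρ ∈ A, Incompat ρ ν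

/-- `I` is `x`-open: a subset of `𝓐_x` that is closed upwards in `𝓐_x` under `≤*`. -/
def IsOpenFam (I : Set (Set M)) : Prop :=
  I ⊆ x.trees ∧ ∀ B₁ ∈ I, ∀ B' ∈ x.trees, LeStar B₁ B' → B' ∈ I

/-- `x` is reasonable: `x ∈ K_r`. -/
def IsReasonable : Prop := x.ClauseA ∧ x.ClauseC

/-- `x` is good: `x ∈ K_g`. -/
def IsGood : Prop :=
  x.IsReasonable ∧
  ∀ I : Set (Set M), x.IsDense I → x.IsOpenFam I → ∀ B₁ ∈ x.roots,
    ∃ B₂ ∈ x.roots, x.le B₁ B₂ ∧ {η ∈ suc B₂ ⊥ | above B₂ η ∉ I}.Finite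

end System

end CWT

/-! The order `M` is built inside the nonempty sets of finite sequences under reverse inclusion,
where incompatible means disjoint. A recursion of length ω₁ starts with the cones of finite
sequences; stage δ adds countably many nodes and trees `C δ ≤* D δ` with root `⊥`, where `D γ ≤* C
δ` for γ < δ. The nontrivial trees that are `≤*` some `D δ` make up `𝓑_x`; for η ≠ `⊥` the family
contains all trees with root η. The `D δ` are thus cofinal, and clauses about extending a tree
become properties of late stages. Throughout, `≤*` is handled through the relation `Le'`, which
implies it and is transitive.

A stage combines three constructions. `exists_bound` diagonalizes over the countable chain built so
far; the root successors of the resulting `C` converge, in that every older node except `⊥` is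
compatible with only finitely many of them. `exists_insert` splits these root successors into
infinitely many infinite blocks and puts the union of each block below it as a new node, which
yields clause (c). `exists_canonical` passes to a positive subtree on which a given function on a
front is canonical: two nodes get the same value iff they lie above the same node of a second front.

Old trees must remain trees when nodes are added. At a node other than `⊥`, convergence reduces
incompatibility with a new node to incompatibility with finitely many old ones. At `⊥`, positivity
is handed down from the later trees of the chain (`Ext.pos`). Together these give `tree_extend`.

Diamond supplies the guesses. A function on an almost front is guessed at some late stage and
becomes canonical there, which gives largeness. A canonical two-valued function is constant, so the
`D_Y` are ultrafilters and the system is big; a canonical finite-to-one function is injective, so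
they are Q-points. For a dense open family, diamond guesses extensions `W γ` of the `D γ` together
with the root successors whose cones are in the family; the bound `C δ` draws its root successors
from these, so the system is good. -/

namespace CWT

/-! ### Trees with relative positivity, exhaustive subtrees, extensions -/

section TreeTheory

variable {M : Type*} [PartialOrder M] {𝓜 B B' B₁ B₂ B₃ Y X : Set M} {a b m ν r : M}

/-- `A`, a set of nodes above `ν`, is not covered by finitely many elements of `𝓜` that are not
below `ν`. -/
def Pos (𝓜 : Set M) (ν : M) (A : Set M) : Prop :=
  ∀ F ⊆ 𝓜, F.Finite → (∀ ρ ∈ F, ¬ ρ ≤ ν) → {σ ∈ A | ∀ ρ ∈ F, Incompat ρ σ}.Infinite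

/-- `IsCWT`, with positivity tested by the elements of `𝓜` only. -/
structure WTree (𝓜 B : Set M) : Prop where
  countable : B.Countable
  exists_root : ∃ r, IsLeast B r
  incompat : ∀ η ∈ B, ∀ ν ∈ B, ¬ η ≤ ν → ¬ ν ≤ η → Incompat η ν
  chain_finite : ∀ C ⊆ B, IsChain (· ≤ ·) C → C.Finite
  pos : ∀ ν ∈ B, ν ∉ maxs B → Pos 𝓜 ν (suc B ν)

/-- The subtree `B'` of `B` is lower closed with cofinitely many successors at each node. -/
structure Sb (B B' : Set M) : Prop where
  subset : B' ⊆ B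
  lower : ∀ a ∈ B, ∀ b ∈ B', a ≤ b → a ∈ B'
  nonempty : B'.Nonempty
  fin : ∀ ν ∈ B', (suc B ν \ B').Finite

/-- `B₂` contains a lower part of `B₁`, and every maximal node of `B₂` is above a maximal node
of `B₁` that lies in `B₂`. -/
structure Ext (B₁ B₂ : Set M) : Prop where
  lower : ∀ a ∈ B₁, ∀ b ∈ B₁, b ∈ B₂ → a ≤ b → a ∈ B₂
  cover : ∀ m ∈ maxs B₂, ∃ y ∈ maxs B₁, y ∈ B₂ ∧ y ≤ m

/-- A structural form of `≤*`. -/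
def Le' (B₁ B₂ : Set M) : Prop := ∃ B₂', Sb B₂ B₂' ∧ Ext B₁ B₂'

/-- Every maximal node of `B` is above an element of `B ∩ X`. -/
def Covers (B X : Set M) : Prop := ∀ m ∈ maxs B, ∃ y ∈ X, y ∈ B ∧ y ≤ m

/-- A structural form of `IsAlmFront`. -/
def Alm (B Y : Set M) : Prop := IsAntichain (· ≤ ·) Y ∧ ∃ B', Sb B B' ∧ Covers B' Y

theorem not_incompat_of_le {a b c : M} (h : a ≤ c) (h' : b ≤ c) : ¬ Incompat a b :=
  fun H => H ⟨c, h, h'⟩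

theorem Incompat.symm (h : Incompat a b) : Incompat b a := fun ⟨c, h1, h2⟩ => h ⟨c, h2, h1⟩

theorem Incompat.mono {a' b' : M} (h : Incompat a b) (ha : a ≤ a') (hb : b ≤ b') :
    Incompat a' b' := fun ⟨c, h1, h2⟩ => h ⟨c, ha.trans h1, hb.trans h2⟩

theorem suc_subset : suc B a ⊆ B := fun _ h => h.1

theorem Pos.mono {A A' : Set M} (h : Pos 𝓜 ν A) (hA : A ⊆ A') : Pos 𝓜 ν A' :=
  fun F h1 h2 h3 => (h F h1 h2 h3).mono fun _ hx => ⟨hA hx.1, hx.2⟩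

theorem Pos.of_subset {𝓜' A : Set M} (h : Pos 𝓜 ν A) (hM : 𝓜' ⊆ 𝓜) : Pos 𝓜' ν A :=
  fun F h1 h2 h3 => h F (h1.trans hM) h2 h3

theorem Pos.infinite {A : Set M} (h : Pos 𝓜 ν A) : A.Infinite := by
  have := h ∅ (empty_subset _) finite_empty (by simp)
  simpa using this

theorem Pos.of_diff_finite {A A' : Set M} (h : Pos 𝓜 ν A) (hA : (A \ A').Finite) :
    Pos 𝓜 ν (A ∩ A') := fun F h1 h2 h3 => by
  refine ((h F h1 h2 h3).sdiff hA).mono ?_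
  rintro x ⟨⟨h4, h5⟩, h6⟩
  exact ⟨⟨h4, by by_contra h7; exact h6 ⟨h4, h7⟩⟩, h5⟩

theorem eq_of_mem_suc {x : M} (ht : b ∈ suc B a) (hx : x ∈ B) (hax : a < x) (hxb : x ≤ b) :
    x = b := by
  by_contra hne
  exact ht.2.2 ⟨x, hx, hax, lt_of_le_of_ne hxb hne⟩

namespace WTree

variable (hB : WTree 𝓜 B)
include hB

theorem comparable {a b c : M} (ha : a ∈ B) (hb : b ∈ B) (hac : a ≤ c) (hbc : b ≤ c) :
    a ≤ b ∨ b ≤ a := by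
  by_contra! h
  exact not_incompat_of_le hac hbc (hB.incompat a ha b hb h.1 h.2)

theorem isChain_below (c : M) : IsChain (· ≤ ·) {a ∈ B | a ≤ c} :=
  fun _ ha _ hb _ => hB.comparable ha.1 hb.1 ha.2 hb.2

theorem finite_below (c : M) : {a ∈ B | a ≤ c}.Finite :=
  hB.chain_finite _ (sep_subset _ _) (hB.isChain_below c)

theorem exists_maxs (hb : b ∈ B) : ∃ m ∈ maxs B, b ≤ m := by
  obtain ⟨m, h1, h2⟩ := zorn_le_nonempty₀ B (fun C hC hch y hy => by
    obtain ⟨m, hm⟩ := (hB.chain_finite C hC hch).exists_maximal ⟨y, hy⟩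
    refine ⟨m, hC hm.1, fun z hz => ?_⟩
    rcases hch.total hz hm.1 with h | h
    · exact h
    · exact hm.2 hz h) b hb
  exact ⟨m, ⟨h2.1, fun x hx hlt => hlt.not_ge (h2.2 hx hlt.le)⟩, h1⟩

theorem exists_suc (ha : a ∈ B) (hb : b ∈ B) (hab : a < b) : ∃ τ ∈ suc B a, τ ≤ b := by
  have hf : {c ∈ B | a < c ∧ c ≤ b}.Finite :=
    (hB.finite_below b).subset fun c hc => ⟨hc.1, hc.2.2⟩
  obtain ⟨τ, hτ⟩ := hf.exists_minimal ⟨b, hb, hab, le_rfl⟩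
  refine ⟨τ, ⟨hτ.1.1, hτ.1.2.1, ?_⟩, hτ.1.2.2⟩
  rintro ⟨ρ, h1, h2, h3⟩
  exact h3.not_ge (hτ.2 ⟨h1, h2, h3.le.trans hτ.1.2.2⟩ h3.le)

theorem exists_greatest {L : Set M} (hL : L ⊆ B) (ha : a ∈ L) (hab : a ≤ b) :
    ∃ c ∈ L, c ≤ b ∧ a ≤ c ∧ ∀ d ∈ L, d ≤ b → d ≤ c := by
  have hf : {c ∈ L | c ≤ b}.Finite :=
    (hB.finite_below b).subset fun c hc => ⟨hL hc.1, hc.2⟩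
  obtain ⟨c, hc⟩ := hf.exists_maximal ⟨a, ha, hab⟩
  have key : ∀ d ∈ L, d ≤ b → d ≤ c := fun d hd hdb => by
    rcases hB.comparable (hL hd) (hL hc.1.1) hdb hc.1.2 with h | h
    · exact h
    · exact hc.2 ⟨hd, hdb⟩ h
  exact ⟨c, hc.1.1, hc.1.2, key a ha hab, key⟩

/-- An infinite ascending sequence would be an infinite chain. This is the induction principle, from
the maximal nodes towards the root, behind canonization. -/
theorem wellFounded : B.WellFoundedOn (· > ·) := by
  rw [Set.wellFoundedOn_iff_no_descending_seq]
  intro f hf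
  have hmono : StrictMono f := fun i j hij => f.map_rel_iff.2 hij
  have hch : IsChain (· ≤ ·) (range f) := by
    rintro _ ⟨i, rfl⟩ _ ⟨j, rfl⟩ _
    rcases le_total i j with h | h
    · exact Or.inl (hmono.monotone h)
    · exact Or.inr (hmono.monotone h)
  exact (infinite_range_of_injective f.injective)
    (hB.chain_finite _ (by rintro _ ⟨i, rfl⟩; exact hf i) hch)

theorem le_or_eq_of_mem_suc {x : M} (ha : a ∈ B) (ht : b ∈ suc B a) (hx : x ∈ B) (hxb : x ≤ b) :
    x ≤ a ∨ x = b := by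
  rcases hB.comparable hx ha hxb ht.2.1.le with h | h
  · exact Or.inl h
  · rcases h.eq_or_lt with h | h
    · exact Or.inl h.ge
    · exact Or.inr (eq_of_mem_suc ht hx h hxb)

theorem suc_incompat {c : M} (hb : b ∈ suc B a) (hc : c ∈ suc B a) (hne : b ≠ c) :
    Incompat b c := by
  apply hB.incompat b hb.1 c hc.1
  · exact fun h => hne (eq_of_mem_suc hc hb.1 hb.2.1 h)
  · exact fun h => hne (eq_of_mem_suc hb hc.1 hc.2.1 h).symm

theorem not_mem_maxs_iff (ha : a ∈ B) : a ∉ maxs B ↔ (suc B a).Nonempty := by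
  constructor
  · intro h
    have : ∃ b ∈ B, a < b := by
      by_contra! h'
      exact h ⟨ha, h'⟩
    obtain ⟨b, hb, hab⟩ := this
    obtain ⟨τ, hτ, -⟩ := hB.exists_suc ha hb hab
    exact ⟨τ, hτ⟩
  · rintro ⟨τ, hτ⟩ h
    exact h.2 τ hτ.1 hτ.2.1

theorem mono {𝓜' : Set M} (hM : 𝓜' ⊆ 𝓜) : WTree 𝓜' B :=
  { hB with pos := fun ν h1 h2 => (hB.pos ν h1 h2).of_subset hM }

end WTree

/-- The other clauses are redundant: incompatibility of incomparable nodes makes predecessors a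
chain, and positivity makes nonempty successor sets infinite. The version relative to `𝓜` is what a
countable stage can control. -/
theorem isCWT_iff : IsCWT B ↔ WTree univ B := by
  constructor
  · intro h
    exact ⟨h.countable, h.exists_root, h.incompat, h.chain_finite,
      fun ν h1 h2 F _ h3 h4 => h.positive ν ⟨h1, h2⟩ F h3 h4⟩
  · intro h
    refine ⟨h.countable, h.exists_root, fun ν _ => ?_, h.chain_finite, fun ν hν => ?_,
      h.incompat, fun ν h1 F h3 h4 => h.pos ν h1.1 h1.2 F (subset_univ _) h3 h4⟩
    · exact fun x hx y hy => h.isChain_below ν ⟨hx.1, hx.2.le⟩ ⟨hy.1, hy.2.le⟩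
    · by_cases hm : ν ∈ maxs B
      · exact Or.inl (by
          by_contra hne
          exact (h.not_mem_maxs_iff hν).2 (nonempty_iff_ne_empty.2 hne) hm)
      · exact Or.inr (h.pos ν hν hm).infinite

theorem wTree_singleton (𝓜 : Set M) (r : M) : WTree 𝓜 {r} where
  countable := countable_singleton _
  exists_root := ⟨r, isLeast_singleton⟩
  incompat := by rintro _ rfl _ rfl h; exact absurd le_rfl h
  chain_finite := fun C hC _ => (finite_singleton r).subset hC
  pos := by
    intro ν hν h
    refine absurd (show ν ∈ maxs {r} from ⟨hν, fun x hx => ?_⟩) h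
    rw [mem_singleton_iff.1 hν, mem_singleton_iff.1 hx]
    exact lt_irrefl r

/-- A convex subset `B'` of `B` with a least element and positive successor sets. -/
structure PSub (𝓜 B B' : Set M) : Prop where
  subset : B' ⊆ B
  root : ∃ r, IsLeast B' r
  convex : ∀ a ∈ B, ∀ r ∈ B', ∀ b ∈ B', r ≤ a → a ≤ b → a ∈ B'
  pos : ∀ b ∈ B', b ∉ maxs B → Pos 𝓜 b (suc B b ∩ B')

namespace PSub

variable (h : PSub 𝓜 B B')
include h

theorem suc_eq (hb : b ∈ B') : suc B' b = suc B b ∩ B' := by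
  ext τ
  constructor
  · rintro ⟨h1, h2, h3⟩
    exact ⟨⟨h.subset h1, h2, fun ⟨ρ, h4, h5, h6⟩ =>
      h3 ⟨ρ, h.convex ρ h4 b hb τ h1 h5.le h6.le, h5, h6⟩⟩, h1⟩
  · rintro ⟨⟨_, h2, h3⟩, h1⟩
    exact ⟨h1, h2, fun ⟨ρ, h4, h5⟩ => h3 ⟨ρ, h.subset h4, h5⟩⟩

theorem maxs_eq : maxs B' = maxs B ∩ B' := by
  ext b
  constructor
  · rintro ⟨h1, h2⟩
    refine ⟨?_, h1⟩
    by_contra h3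
    obtain ⟨τ, hτ⟩ := (h.pos b h1 h3).infinite.nonempty
    exact h2 τ hτ.2 hτ.1.2.1
  · rintro ⟨⟨_, h2⟩, h1⟩
    exact ⟨h1, fun ν hν => h2 ν (h.subset hν)⟩

theorem wTree (hB : WTree 𝓜 B) : WTree 𝓜 B' where
  countable := hB.countable.mono h.subset
  exists_root := h.root
  incompat := fun η hη ν hν => hB.incompat η (h.subset hη) ν (h.subset hν)
  chain_finite := fun C hC => hB.chain_finite C (hC.trans h.subset)
  pos := fun ν hν hm => by
    rw [h.suc_eq hν]
    apply h.pos ν hν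
    intro h'
    exact hm (by rw [h.maxs_eq]; exact ⟨h', hν⟩)

end PSub

namespace Sb

theorem root_mem (h : Sb B B') (hr : IsLeast B r) : r ∈ B' := by
  obtain ⟨b, hb⟩ := h.nonempty
  exact h.lower r hr.1 b hb (hr.2 (h.subset hb))

theorem isLeast (h : Sb B B') (hr : IsLeast B r) : IsLeast B' r :=
  ⟨h.root_mem hr, fun _ hx => hr.2 (h.subset hx)⟩

theorem pSub (h : Sb B B') (hB : WTree 𝓜 B) : PSub 𝓜 B B' where
  subset := h.subset
  root := by
    obtain ⟨r, hr⟩ := hB.exists_root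
    exact ⟨r, h.isLeast hr⟩
  convex := fun a ha _ _ b hb _ hab => h.lower a ha b hb hab
  pos := fun b hb hm => (hB.pos b (h.subset hb) hm).of_diff_finite (h.fin b hb)

theorem wTree (h : Sb B B') (hB : WTree 𝓜 B) : WTree 𝓜 B' := (h.pSub hB).wTree hB

theorem refl (hB : B.Nonempty) : Sb B B :=
  ⟨Subset.rfl, fun _ ha _ _ _ => ha, hB, fun _ _ =>
    by rw [sdiff_eq_empty.2 suc_subset]; exact finite_empty⟩

theorem suc_eq (h : Sb B B') (hb : b ∈ B') : suc B' b = suc B b ∩ B' := by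
  ext τ
  constructor
  · rintro ⟨h1, h2, h3⟩
    exact ⟨⟨h.subset h1, h2, fun ⟨ρ, h4, h5, h6⟩ =>
      h3 ⟨ρ, h.lower ρ h4 τ h1 h6.le, h5, h6⟩⟩, h1⟩
  · rintro ⟨⟨_, h2, h3⟩, h1⟩
    exact ⟨h1, h2, fun ⟨ρ, h4, h5⟩ => h3 ⟨ρ, h.subset h4, h5⟩⟩

theorem trans (h : Sb B₁ B₂) (h' : Sb B₂ B₃) : Sb B₁ B₃ where
  subset := h'.subset.trans h.subset
  lower := fun a ha b hb hab => h'.lower a (h.lower a ha b (h'.subset hb) hab) b hb hab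
  nonempty := h'.nonempty
  fin := fun ν hν => by
    refine ((h.fin ν (h'.subset hν)).union (h'.fin ν hν)).subset fun τ hτ => ?_
    by_cases h2 : τ ∈ B₂
    · exact Or.inr ⟨by rw [h.suc_eq (h'.subset hν)]; exact ⟨hτ.1, h2⟩, hτ.2⟩
    · exact Or.inl ⟨hτ.1, h2⟩

theorem inter (hr : ∃ r, IsLeast B r) (h : Sb B B₁) (h' : Sb B B₂) : Sb B (B₁ ∩ B₂) where
  subset := fun _ hx => h.subset hx.1
  lower := fun a ha b hb hab => ⟨h.lower a ha b hb.1 hab, h'.lower a ha b hb.2 hab⟩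
  nonempty := by
    obtain ⟨r, hr⟩ := hr
    exact ⟨r, h.root_mem hr, h'.root_mem hr⟩
  fin := fun ν hν => by
    refine ((h.fin ν hν.1).union (h'.fin ν hν.2)).subset fun τ hτ => ?_
    by_cases h2 : τ ∈ B₁
    · exact Or.inr ⟨hτ.1, fun h3 => hτ.2 ⟨h2, h3⟩⟩
    · exact Or.inl ⟨hτ.1, h2⟩

theorem isSb (h : Sb B B') (hB : IsCWT B) : IsSb B B' where
  isCWT := isCWT_iff.2 (h.wTree (isCWT_iff.1 hB))
  subset := h.subset
  sameRoot := by
    obtain ⟨r, hr⟩ := hB.exists_root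
    exact ⟨r, h.isLeast hr, hr⟩
  suc_subset := fun ν hν => by rw [h.suc_eq hν]; exact inter_subset_left
  finite_diff := fun ν hν => by
    rw [h.suc_eq hν, sdiff_self_inter]; exact h.fin ν hν

end Sb

/-- Lower closure is hidden in the condition on successors: if the last node of `B'` below `b` is
not `b`, the next node of `B'` towards `b'` is an immediate successor in `B` as well, and so equals
`b`. -/
theorem IsSb.sb (h : IsSb B B') (hB : IsCWT B) : Sb B B' := by
  have hB := isCWT_iff.1 hB
  have hB' := isCWT_iff.1 h.isCWT
  obtain ⟨r, hr', hr⟩ := h.sameRoot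
  refine ⟨h.subset, fun b hb b' hb' hbb => ?_, ⟨r, hr'.1⟩, fun ν hν => ?_⟩
  · obtain ⟨a, ha, hab, -, hmax⟩ := hB.exists_greatest h.subset hr'.1 (hr.2 hb)
    rcases hab.eq_or_lt with rfl | hlt
    · exact ha
    obtain ⟨τ, hτ, hτb⟩ := hB'.exists_suc ha hb' (hlt.trans_le hbb)
    rcases hB.le_or_eq_of_mem_suc (h.subset ha) (h.suc_subset a ha hτ) hb
      (by
        rcases hB.comparable (h.subset hτ.1) hb hτb hbb with h1 | h1
        · exact absurd (hmax τ hτ.1 h1) hτ.2.1.not_ge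
        · exact h1) with h1 | h1
    · exact absurd h1 hlt.not_ge
    · rw [h1]; exact hτ.1
  · refine (h.finite_diff ν hν).subset fun τ hτ => ⟨hτ.1, fun h1 => hτ.2 h1.1⟩

namespace Ext

theorem refl (hB : B.Nonempty) : Ext B B :=
  ⟨fun _ ha _ _ _ _ => ha, fun m hm => ⟨m, hm, hm.1, le_rfl⟩⟩

/-- The cover clause is what makes this work: lower closure passes through a maximal node of `B₁`
that sits below a maximal node of `B₂` present in `B₃`. -/
theorem trans (hB₁ : WTree 𝓜 B₁) (h : Ext B₁ B₂) (h' : Ext B₂ B₃)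
    (hB₃ : WTree 𝓜 B₃) : Ext B₁ B₃ where
  lower := fun a ha b hb hb3 hab => by
    obtain ⟨m, hm, hbm⟩ := hB₃.exists_maxs hb3
    obtain ⟨y, hy, hy3, hym⟩ := h'.cover m hm
    obtain ⟨y', hy', hy2, hyy⟩ := h.cover y hy
    have hby : b ≤ y' := by
      rcases hB₁.comparable hb hy'.1 hbm (hyy.trans hym) with h1 | h1
      · exact h1
      · rcases h1.eq_or_lt with h1 | h1
        · exact h1.ge
        · exact absurd h1 (hy'.2 b hb)
    have ha2 := h.lower a ha y' hy'.1 hy2 (hab.trans hby)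
    exact h'.lower a ha2 y hy.1 hy3 ((hab.trans hby).trans hyy)
  cover := fun m hm => by
    obtain ⟨y, hy, hy3, hym⟩ := h'.cover m hm
    obtain ⟨y', hy', hy2, hyy⟩ := h.cover y hy
    exact ⟨y', hy', h'.lower y' hy2 y hy.1 hy3 hyy, hyy.trans hym⟩

theorem of_sb (hB₂ : WTree 𝓜 B₂) (h : Ext B₁ B₂) (h' : Sb B₂ B₃) : Ext B₁ B₃ where
  lower := fun a ha b hb hb3 hab => h'.lower a (h.lower a ha b hb (h'.subset hb3) hab) b hb3 hab
  cover := fun m hm => by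
    rw [(h'.pSub hB₂).maxs_eq] at hm
    obtain ⟨y, hy, hy3, hym⟩ := h.cover m hm.1
    exact ⟨y, hy, h'.lower y hy3 m hm.2 hym, hym⟩

/-- An exhaustive subtree of `B₁` is induced by one of `B₂`. -/
theorem exists_sb (hB₁ : WTree 𝓜 B₁) (hB₂ : WTree 𝓜 B₂) (hr : IsLeast B₁ r) (hr' : IsLeast B₂ r)
    (h : Ext B₁ B₂) (h' : Sb B₁ B') : ∃ B₂', Sb B₂ B₂' ∧ B₂' ∩ B₁ ⊆ B' ∧ Ext B' B₂' := by
  -- The largest lower closed part of `B₂` that meets `B₁` inside `B'`.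
  let C : Set M := {b ∈ B₂ | ∀ a ∈ B₁, a ∈ B₂ → a ≤ b → a ∈ B'}
  have hC : Sb B₂ C := by
    refine ⟨sep_subset _ _, fun a ha b hb hab => ⟨ha, fun x h1 h2 h3 => hb.2 x h1 h2 (h3.trans hab)⟩,
      ⟨r, hr'.1, fun a ha _ hab => ?_⟩, fun ρ hρ => ?_⟩
    · rw [le_antisymm hab (hr.2 ha)]; exact h'.root_mem hr
    -- A successor `τ` of `ρ ∈ C` is lost only because of a node of `B₁` outside `B'`, which cannot
    -- be below `ρ` and so is `τ` itself. Then `τ` is an immediate successor in `B₁`, outside `B'`,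
    -- of one of the finitely many nodes of `B'` below `ρ`.
    · have hf : (⋃ ν ∈ {ν ∈ B' | ν ≤ ρ}, suc B₁ ν \ B').Finite := by
        refine Set.Finite.biUnion ((hB₁.finite_below ρ).subset fun x hx => ⟨h'.subset hx.1, hx.2⟩) ?_
        exact fun ν hν => h'.fin ν hν.1
      refine hf.subset fun τ hτ => ?_
      have : ∃ a ∈ B₁, a ∈ B₂ ∧ a ≤ τ ∧ a ∉ B' := by
        by_contra! h2
        exact hτ.2 ⟨hτ.1.1, h2⟩
      obtain ⟨a, ha1, ha2, haτ, ha'⟩ := this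
      have key : ∀ x ∈ B₁, x ∈ B₂ → x ≤ τ → x ∉ B' → x = τ := fun x h1 h2 h3 h4 => by
        rcases hB₂.le_or_eq_of_mem_suc hρ.1 hτ.1 h2 h3 with h5 | h5
        · exact absurd (hρ.2 x h1 h2 h5) h4
        · exact h5
      obtain rfl := key a ha1 ha2 haτ ha'
      obtain ⟨ν, hν, hντ, -, hmax⟩ := hB₁.exists_greatest h'.subset (h'.root_mem hr) (hr.2 ha1)
      have hlt : ν < a := lt_of_le_of_ne hντ (fun h5 => ha' (h5 ▸ hν))
      obtain ⟨σ, hσ, hσa⟩ := hB₁.exists_suc (h'.subset hν) ha1 hlt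
      have hσ' : σ ∉ B' := fun h5 => hσ.2.1.not_ge (hmax σ h5 hσa)
      obtain rfl := key σ hσ.1 (h.lower σ hσ.1 a ha1 ha2 hσa) hσa hσ'
      have hνρ : ν ≤ ρ := by
        rcases hB₂.le_or_eq_of_mem_suc hρ.1 hτ.1
          (h.lower ν (h'.subset hν) σ ha1 ha2 hντ) hντ with h5 | h5
        · exact h5
        · exact absurd h5 hlt.ne
      exact mem_biUnion (show ν ∈ {ν ∈ B' | ν ≤ ρ} from ⟨hν, hνρ⟩) ⟨hσ, ha'⟩
  have hCB : C ∩ B₁ ⊆ B' := fun x hx => hx.1.2 x hx.2 hx.1.1 le_rfl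
  have hE := h.of_sb hB₂ hC
  refine ⟨C, hC, hCB, ⟨fun a ha b hb hbC hab => ?_, fun m hm => ?_⟩⟩
  · exact hE.lower a (h'.subset ha) b (h'.subset hb) hbC hab
  · obtain ⟨y, hy, hyC, hym⟩ := hE.cover m hm
    exact ⟨y, ⟨hCB ⟨hyC, hy.1⟩, fun ν hν => hy.2 ν (h'.subset hν)⟩, hyC, hym⟩

/-- Immediate successors in an extension of `B₁` lie below immediate successors in `B₁`. -/
theorem exists_suc_le (hB₁ : WTree 𝓜 B₁) (h : Ext B₁ B₂) (hB₂ : WTree 𝓜 B₂) (h1 : ν ∈ B₁)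
    (hm : ν ∉ maxs B₁) {τ : M} (hτ : τ ∈ suc B₂ ν) : ∃ τ' ∈ suc B₁ ν, τ' ∈ B₂ ∧ τ ≤ τ' := by
  obtain ⟨m, hmm, hτm⟩ := hB₂.exists_maxs hτ.1
  obtain ⟨y, hy, hy2, hym⟩ := h.cover m hmm
  have hlt : ν < y := by
    have hne : ν ≠ y := fun h3 => hm (h3 ▸ hy)
    rcases hB₁.comparable h1 hy.1 (hτ.2.1.le.trans hτm) hym with h3 | h3
    · exact lt_of_le_of_ne h3 hne
    · exact absurd (lt_of_le_of_ne h3 hne.symm) (hy.2 ν h1)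
  obtain ⟨τ', hτ', hτy⟩ := hB₁.exists_suc h1 hy.1 hlt
  have hmem := h.lower τ' hτ'.1 y hy.1 hy2 hτy
  refine ⟨τ', hτ', hmem, ?_⟩
  rcases hB₂.comparable hτ.1 hmem hτm (hτy.trans hym) with h3 | h3
  · exact h3
  · exact (eq_of_mem_suc hτ hmem hτ'.2.1 h3).ge

/-- Distinct successors in `B₂` are incompatible, so the successors in `B₁` above them are distinct.
Positivity and clause (c) both travel from `B₂` back to `B₁` in this way. -/
theorem infinite_suc (hB₁ : WTree 𝓜 B₁) (h : Ext B₁ B₂) (hB₂ : WTree 𝓜 B₂) (h1 : ν ∈ B₁)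
    (hm : ν ∉ maxs B₁) {A : Set M} (hA : A ⊆ suc B₂ ν) (hinf : A.Infinite) :
    {τ' ∈ suc B₁ ν | τ' ∈ B₂ ∧ ∃ τ ∈ A, τ ≤ τ'}.Infinite := by
  have hsuc := fun τ (hτ : τ ∈ suc B₂ ν) => h.exists_suc_le hB₁ hB₂ h1 hm hτ
  choose! f hf hf2 hle using hsuc
  have hinj : InjOn f A := by
    intro s hs t ht hst
    by_contra hne
    exact not_incompat_of_le (hle s (hA hs)) (hst ▸ hle t (hA ht))
      (hB₂.suc_incompat (hA hs) (hA ht) hne)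
  refine (hinf.image hinj).mono ?_
  rintro _ ⟨s, hs, rfl⟩
  exact ⟨hf s (hA hs), hf2 s (hA hs), s, hs, hle s (hA hs)⟩

/-- Positivity in `B₁` is inherited from an extension of `B₁`. -/
theorem pos (hB₁ : WTree 𝓜 B₁) (h : Ext B₁ B₂) (hB₂ : WTree 𝓜 B₂) {𝓜' : Set M}
    (hpos : ν ∉ maxs B₂ → Pos 𝓜' ν (suc B₂ ν)) (h1 : ν ∈ B₁)
    (hm : ν ∉ maxs B₁) : Pos 𝓜' ν (suc B₁ ν ∩ B₂) := by
  have hm2 : ν ∉ maxs B₂ := fun h3 => by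
    obtain ⟨y, hy, _, hym⟩ := h.cover ν h3
    rcases hym.eq_or_lt with rfl | hlt
    · exact hm hy
    · exact hy.2 ν h1 hlt
  intro F hF hfin hFν
  refine (h.infinite_suc hB₁ hB₂ h1 hm (sep_subset _ _) (hpos hm2 F hF hfin hFν)).mono ?_
  rintro τ' ⟨h2, h3, τ, hτ, hle⟩
  exact ⟨⟨h2, h3⟩, fun ρ hρ => (hτ.2 ρ hρ).mono le_rfl hle⟩

theorem pSub (hB₁ : WTree 𝓜 B₁) (h : Ext B₁ B₂) (hB₂ : WTree 𝓜 B₂)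
    (hr : IsLeast B₁ r) (hr' : IsLeast B₂ r) : PSub 𝓜 B₁ (B₂ ∩ B₁) where
  subset := inter_subset_right
  root := ⟨r, ⟨hr'.1, hr.1⟩, fun _ hx => hr.2 hx.2⟩
  convex := fun a ha _ _ b hb _ hab => ⟨h.lower a ha b hb.2 hb.1 hab, ha⟩
  pos := fun b hb hm => (h.pos hB₁ hB₂ (hB₂.pos b hb.1) hb.2 hm).mono
    fun _ hx => ⟨hx.1, hx.2, hx.1.1⟩

theorem inter (hB₁ : WTree 𝓜 B₁) (h : Ext B₁ B₂) (hB₂ : WTree 𝓜 B₂)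
    (hr : IsLeast B₁ r) (hr' : IsLeast B₂ r) : Ext (B₂ ∩ B₁) B₂ where
  lower := fun _ ha _ _ _ _ => ha.1
  cover := fun m hm => by
    obtain ⟨y, hy, hy2, hym⟩ := h.cover m hm
    exact ⟨y, by rw [(h.pSub hB₁ hB₂ hr hr').maxs_eq]; exact ⟨hy, hy2, hy.1⟩, hy2, hym⟩

end Ext

end TreeTheory

end CWT

namespace CWT

/-! ### Fronts, almost fronts and `≤*` in structural form -/

section LeTheory

variable {M : Type*} [PartialOrder M] {𝓜 B B' B₁ B₂ B₃ Y X : Set M} {a b m ν r : M}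

theorem Covers.comparable (hB : WTree 𝓜 B) (hX : Covers B X) (hb : b ∈ B) :
    ∃ y ∈ X, y ∈ B ∧ ((b ≤ y ∨ y ≤ b) ∧ ∃ m ∈ maxs B, b ≤ m ∧ y ≤ m) := by
  obtain ⟨m, hm, hbm⟩ := hB.exists_maxs hb
  obtain ⟨y, hy, hyB, hym⟩ := hX m hm
  exact ⟨y, hy, hyB, hB.comparable hb hyB hbm hym, m, hm, hbm, hym⟩

theorem covers_maxs (B : Set M) : Covers B (maxs B) := fun m hm => ⟨m, hm, hm.1, le_rfl⟩

theorem Covers.sb (hB : WTree 𝓜 B) (hX : Covers B X) (h : Sb B B') : Covers B' X := by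
  intro m hm
  have hm' := (h.pSub hB).maxs_eq ▸ hm
  obtain ⟨y, hy, hyB, hym⟩ := hX m hm'.1
  exact ⟨y, hy, h.lower y hyB m hm.1 hym, hym⟩

/-- All chains being finite, the branches are exactly the sets of nodes below a maximal node. -/
theorem isFront_iff (hB : WTree 𝓜 B) :
    IsFront B Y ↔ Y ⊆ B ∧ IsAntichain (· ≤ ·) Y ∧ Covers B Y := by
  constructor
  · rintro ⟨h1, h2, h3⟩
    refine ⟨h1, h2, fun m hm => ?_⟩
    have hbr : IsBranch B {a ∈ B | a ≤ m} := by
      refine ⟨⟨sep_subset _ _, hB.isChain_below m⟩, ?_⟩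
      intro D hD hle x hx
      refine ⟨hD.1 hx, ?_⟩
      have hmD : m ∈ D := hle ⟨hm.1, le_rfl⟩
      rcases hD.2.total hx hmD with h | h
      · exact h
      · rcases h.eq_or_lt with h | h
        · exact h.ge
        · exact absurd h (hm.2 x (hD.1 hx))
    obtain ⟨y, hy, hyY⟩ := h3 _ hbr
    exact ⟨y, hyY, hy.1, hy.2⟩
  · rintro ⟨h1, h2, h3⟩
    refine ⟨h1, h2, fun C hC => ?_⟩
    have hne : C.Nonempty := by
      rw [nonempty_iff_ne_empty]
      rintro rfl
      obtain ⟨r, hr⟩ := hB.exists_root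
      have := hC.2 (y := {r}) ⟨by simpa using hr.1, IsChain.singleton⟩ (empty_subset _)
      exact this rfl
    obtain ⟨c, hc⟩ := (hB.chain_finite C hC.1.1 hC.1.2).exists_maximal hne
    have hle : ∀ x ∈ C, x ≤ c := fun x hx => by
      rcases hC.1.2.total hx hc.1 with h | h
      · exact h
      · exact hc.2 hx h
    obtain ⟨m, hm, hcm⟩ := hB.exists_maxs (hC.1.1 hc.1)
    have hins : ∀ x ∈ B, x ≤ m → x ∈ C := fun x hx hxm => by
      have := hC.2 (y := {a ∈ B | a ≤ m}) ⟨sep_subset _ _, hB.isChain_below m⟩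
        (fun z hz => ⟨hC.1.1 hz, (hle z hz).trans hcm⟩)
      exact this ⟨hx, hxm⟩
    obtain ⟨y, hy, hyB, hym⟩ := h3 m hm
    exact ⟨y, hins y hyB hym, hy⟩

theorem isAlmFront_iff (hB : IsCWT B) : IsAlmFront B Y ↔ Alm B Y := by
  have hB' := isCWT_iff.1 hB
  constructor
  · rintro ⟨h1, B', h2, h3⟩
    refine ⟨h1, B', h2.sb hB, ?_⟩
    obtain ⟨-, -, h4⟩ := (isFront_iff (isCWT_iff.1 h2.isCWT)).1 h3
    intro m hm
    obtain ⟨y, hy, hyB, hym⟩ := h4 m hm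
    exact ⟨y, hy.1, hyB, hym⟩
  · rintro ⟨h1, B', h2, h3⟩
    refine ⟨h1, B', h2.isSb hB, ?_⟩
    rw [isFront_iff (h2.wTree hB')]
    refine ⟨inter_subset_right, h1.subset inter_subset_left, fun m hm => ?_⟩
    obtain ⟨y, hy, hyB, hym⟩ := h3 m hm
    exact ⟨y, ⟨hy, hyB⟩, hyB, hym⟩

theorem IsFront.alm (hB : WTree 𝓜 B) (h : IsFront B Y) : Alm B Y := by
  obtain ⟨h1, h2, h3⟩ := (isFront_iff hB).1 h
  exact ⟨h2, B, Sb.refl (hB.exists_root.imp fun _ h => h.1), h3⟩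

/-- A covering subset of an exhaustive subtree of `B₁` covers an exhaustive subtree of any
extension of `B₁`. -/
theorem Ext.exists_covers (hB₁ : WTree 𝓜 B₁) (hB₂ : WTree 𝓜 B₂) (hr : IsLeast B₁ r)
    (hr' : IsLeast B₂ r) (h : Ext B₁ B₂) (h' : Sb B₁ B') (hX : Covers B' X) :
    ∃ B₂', Sb B₂ B₂' ∧ Covers B₂' (X ∩ B') ∧ B₂' ∩ B₁ ⊆ B' ∧ Ext B₁ B₂' := by
  obtain ⟨C, hC, hCB, hE⟩ := h.exists_sb hB₁ hB₂ hr hr' h'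
  refine ⟨C, hC, fun m hm => ?_, hCB, h.of_sb hB₂ hC⟩
  obtain ⟨y, hy, hyC, hym⟩ := hE.cover m hm
  obtain ⟨x, hx, hxB, hxy⟩ := hX y hy
  exact ⟨x, ⟨hx, hxB⟩, hE.lower x hxB y hy.1 hyC hxy, hxy.trans hym⟩

namespace Le'

theorem refl (hB : B.Nonempty) : Le' B B := ⟨B, Sb.refl hB, Ext.refl hB⟩

theorem of_ext (hB : B₂.Nonempty) (h : Ext B₁ B₂) : Le' B₁ B₂ := ⟨B₂, Sb.refl hB, h⟩

theorem trans (hB₁ : WTree 𝓜 B₁) (hB₂ : WTree 𝓜 B₂) (hB₃ : WTree 𝓜 B₃) (hr₂ : IsLeast B₂ r)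
    (hr₃ : IsLeast B₃ r) (h : Le' B₁ B₂) (h' : Le' B₂ B₃) : Le' B₁ B₃ := by
  obtain ⟨B₂', hs, he⟩ := h
  obtain ⟨B₃', hs', he'⟩ := h'
  obtain ⟨C, hC, -, hE⟩ := he'.exists_sb hB₂ (hs'.wTree hB₃) hr₂ (hs'.isLeast hr₃) hs
  exact ⟨C, hs'.trans hC, he.trans hB₁ hE (hC.wTree (hs'.wTree hB₃))⟩

theorem exists_covers (hB₁ : WTree 𝓜 B₁) (hB₂ : WTree 𝓜 B₂) (hr : IsLeast B₁ r)
    (hr' : IsLeast B₂ r) (h : Le' B₁ B₂) (h' : Sb B₁ B') (hX : Covers B' X) :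
    ∃ B₂', Sb B₂ B₂' ∧ Covers B₂' (X ∩ B') ∧ B₂' ∩ B₁ ⊆ B' ∧ Ext B₁ B₂' := by
  obtain ⟨C, hs, he⟩ := h
  obtain ⟨D, hD, h1, h2⟩ := he.exists_covers hB₁ (hs.wTree hB₂) hr (hs.isLeast hr') h' hX
  exact ⟨D, hs.trans hD, h1, h2⟩

theorem alm (hB₁ : WTree 𝓜 B₁) (hB₂ : WTree 𝓜 B₂) (hr : IsLeast B₁ r)
    (hr' : IsLeast B₂ r) (h : Le' B₁ B₂) (hY : Alm B₁ Y) : Alm B₂ Y := by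
  obtain ⟨h1, B', h2, h3⟩ := hY
  obtain ⟨C, hC, hc, -⟩ := h.exists_covers hB₁ hB₂ hr hr' h2 h3
  refine ⟨h1, C, hC, fun m hm => ?_⟩
  obtain ⟨y, hy, hyB, hym⟩ := hc m hm
  exact ⟨y, hy.1, hyB, hym⟩

/-- The witness `C` also extends its own trace `C ∩ B₁`, so almost fronts of the trace pass to `B₂`.
The converse is not needed, since the order of the system is defined through `Le'`. -/
theorem leStar (hB₁ : IsCWT B₁) (hB₂ : IsCWT B₂) (hr : IsLeast B₁ r) (hr' : IsLeast B₂ r)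
    (h : Le' B₁ B₂) : LeStar B₁ B₂ := by
  have hB₁' := isCWT_iff.1 hB₁
  have hB₂' := isCWT_iff.1 hB₂
  obtain ⟨C, hs, he⟩ := h
  have hC := hs.wTree hB₂'
  have hCr := hs.isLeast hr'
  have hP := he.pSub hB₁' hC hr hCr
  have hD := isCWT_iff.2 (hP.wTree hB₁')
  have hDr : IsLeast (C ∩ B₁) r := ⟨⟨hCr.1, hr.1⟩, fun x hx => hr.2 hx.2⟩
  refine ⟨hB₁, hB₂, ⟨r, hr, hr'⟩, C, hs.isSb hB₂, ?_, fun Y hY => ?_⟩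
  · refine ⟨hD, inter_subset_right, ⟨r, hDr, hr⟩, fun ν hν => ?_, fun ν hν => ?_⟩
    · rw [hP.suc_eq hν.1]; exact inter_subset_left
    · rw [hP.suc_eq hν.1]; exact (hP.pos ν hν.1 hν.2).infinite
  · rw [isAlmFront_iff hD] at hY
    rw [isAlmFront_iff hB₂]
    refine alm (isCWT_iff.1 hD) hB₂' hDr hr' ⟨C, hs, he.inter hB₁' hC hr hCr⟩ hY

/-- In an extension of `B₁`, some immediate successor of the root in `B₁` survives. -/
theorem suc_inter_nonempty (hB₁ : WTree 𝓜 B₁) (hB₂ : WTree 𝓜 B₂) (hr : IsLeast B₁ r)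
    (hne : B₁ ≠ {r}) (h : Le' B₁ B₂) : (suc B₁ r ∩ B₂).Nonempty := by
  obtain ⟨C, hs, he⟩ := h
  have hC := hs.wTree hB₂
  obtain ⟨c, hc⟩ := hs.nonempty
  obtain ⟨m, hm, -⟩ := hC.exists_maxs hc
  obtain ⟨y, hy, hyC, -⟩ := he.cover m hm
  have hlt : r < y := by
    refine lt_of_le_of_ne (hr.2 hy.1) ?_
    rintro rfl
    refine hne (Subset.antisymm (fun x hx => ?_) (by simpa using hr.1))
    rcases (hr.2 hx).eq_or_lt with h1 | h1
    · exact h1.symm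
    · exact absurd h1 (hy.2 x hx)
  obtain ⟨τ, hτ, hτy⟩ := hB₁.exists_suc hr.1 hy.1 hlt
  exact ⟨τ, hτ, hs.subset (he.lower τ hτ.1 y hy.1 hyC hτy)⟩

end Le'

/-! ### Cones and truncations -/

theorem IsLeast.not_mem_maxs (hr : IsLeast B r) (hne : B ≠ {r}) : r ∉ maxs B := by
  intro hm
  refine hne (Subset.antisymm (fun x hx => ?_) (by simpa using hr.1))
  rcases (hr.2 hx).eq_or_lt with h1 | h1
  · exact h1.symm
  · exact absurd h1 (hm.2 x hx)

theorem isLeast_above (hν : ν ∈ B) : IsLeast (above B ν) ν := ⟨⟨hν, le_rfl⟩, fun _ hx => hx.2⟩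

theorem above_eq_self (hr : IsLeast B r) : above B r = B :=
  Subset.antisymm (sep_subset _ _) fun _ hx => ⟨hx, hr.2 hx⟩

theorem suc_subset_above (hν : ν ≤ b) : suc B b ⊆ above B ν :=
  fun _ hx => ⟨hx.1, hν.trans hx.2.1.le⟩

theorem pSub_above (hB : WTree 𝓜 B) (hν : ν ∈ B) : PSub 𝓜 B (above B ν) where
  subset := sep_subset _ _
  root := ⟨ν, isLeast_above hν⟩
  convex := fun _ ha _ hx _ _ h _ => ⟨ha, hx.2.trans h⟩
  pos := fun b hb hm => (hB.pos b hb.1 hm).mono fun _ hx => ⟨hx, suc_subset_above hb.2 hx⟩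

theorem wTree_above (hB : WTree 𝓜 B) (hν : ν ∈ B) : WTree 𝓜 (above B ν) :=
  (pSub_above hB hν).wTree hB

theorem below_subset : below B Y ⊆ B := sep_subset _ _

theorem Sb.above (h : Sb B B') (hν : ν ∈ B') : Sb (above B ν) (above B' ν) where
  subset := fun _ hx => ⟨h.subset hx.1, hx.2⟩
  lower := fun a ha b hb hab => ⟨h.lower a ha.1 b hb.1 hab, ha.2⟩
  nonempty := ⟨ν, hν, le_rfl⟩
  fin := fun ρ hρ => (h.fin ρ hρ.1).subset fun τ hτ => by
    refine ⟨⟨hτ.1.1.1, hτ.1.2.1, fun ⟨x, h1, h2, h3⟩ => hτ.1.2.2 ⟨x, ⟨h1, hρ.2.trans h2.le⟩, h2, h3⟩⟩,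
      fun h1 => hτ.2 ⟨h1, hτ.1.1.2⟩⟩

theorem suc_below (hb : b ∈ below B Y) : suc (below B Y) b = suc B b ∩ below B Y := by
  ext τ
  constructor
  · rintro ⟨h1, h2, h3⟩
    refine ⟨⟨h1.1, h2, fun ⟨ρ, h4, h5, h6⟩ => h3 ⟨ρ, ⟨h4, ?_⟩, h5, h6⟩⟩, h1⟩
    obtain ⟨η, hη, h7⟩ := h1.2
    exact ⟨η, hη, h6.le.trans h7⟩
  · rintro ⟨⟨_, h2, h3⟩, h1⟩
    exact ⟨h1, h2, fun ⟨ρ, h4, h5⟩ => h3 ⟨ρ, h4.1, h5⟩⟩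

/-- Maximal nodes of a truncation. -/
theorem maxs_below (hY : IsAntichain (· ≤ ·) Y) (hYB : Y ⊆ B) : maxs (below B Y) = Y := by
  ext m
  constructor
  · rintro ⟨⟨h1, η, hη, hle⟩, h2⟩
    rcases hle.eq_or_lt with rfl | hlt
    · exact hη
    · exact absurd hlt (h2 η ⟨hYB hη, η, hη, le_rfl⟩)
  · intro hm
    refine ⟨⟨hYB hm, m, hm, le_rfl⟩, ?_⟩
    rintro ν ⟨_, η, hη, hle⟩ hlt
    exact hY hm hη (hlt.trans_le hle).ne (hlt.trans_le hle).le

theorem ext_below (hB : WTree 𝓜 B) (hYB : Y ⊆ B) (hY : IsAntichain (· ≤ ·) Y)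
    (hc : Covers B Y) : Ext (below B Y) B where
  lower := fun _ ha _ _ _ _ => ha.1
  cover := fun m hm => by
    obtain ⟨y, hy, hyB, hym⟩ := hc m hm
    exact ⟨y, (maxs_below hY hYB).symm ▸ hy, hyB, hym⟩

theorem wTree_below (hB : WTree 𝓜 B) (hYB : Y ⊆ B) (hY : IsAntichain (· ≤ ·) Y)
    (hc : Covers B Y) : WTree 𝓜 (below B Y) where
  countable := hB.countable.mono below_subset
  exists_root := by
    obtain ⟨r, hr⟩ := hB.exists_root
    obtain ⟨y, hy, hyB, -⟩ := hc.comparable hB hr.1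
    exact ⟨r, ⟨hr.1, y, hy, hr.2 hyB⟩, fun x hx => hr.2 hx.1⟩
  incompat := fun η hη ν hν => hB.incompat η hη.1 ν hν.1
  chain_finite := fun C hC => hB.chain_finite C (hC.trans below_subset)
  pos := fun ν hν hm => by
    rw [suc_below hν]
    rw [maxs_below hY hYB] at hm
    obtain ⟨η, hη, hle⟩ := hν.2
    have hlt : ν < η := lt_of_le_of_ne hle fun h => hm (h ▸ hη)
    refine (hB.pos ν hν.1 fun h => h.2 η (hYB hη) hlt).mono fun τ hτ => ⟨hτ, hτ.1, ?_⟩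
    obtain ⟨y, hy, hyB, h1 | h1, m, hmm, hτm, hym⟩ := hc.comparable hB hτ.1
    · exact ⟨y, hy, h1⟩
    · rcases hB.le_or_eq_of_mem_suc hν.1 hτ hyB h1 with h2 | h2
      · exact absurd (h2.trans hle) (hY hy hη (h2.trans_lt hlt).ne)
      · exact ⟨y, hy, h2.ge⟩

theorem Sb.below (hr : IsLeast B r) (h : Sb B B') (hc : Covers B' Y) (hB : WTree 𝓜 B) :
    Sb (below B Y) (below B' Y) where
  subset := fun _ hx => ⟨h.subset hx.1, hx.2⟩
  lower := fun a ha b hb hab => ⟨h.lower a ha.1 b hb.1 hab, ha.2⟩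
  nonempty := by
    obtain ⟨y, hy, hyB, -⟩ := hc.comparable (h.wTree hB) (h.root_mem hr)
    exact ⟨y, hyB, y, hy, le_rfl⟩
  fin := fun ρ hρ => (h.fin ρ hρ.1).subset fun τ hτ => by
    rw [suc_below ⟨h.subset hρ.1, hρ.2⟩] at hτ
    exact ⟨hτ.1.1, fun h1 => hτ.2 ⟨h1, hτ.1.2.2⟩⟩

end LeTheory

end CWT

/-! ### Canonical functions on fronts -/

namespace CWT

theorem exists_seq_of_forall_finset {α : Type*} (P : ℕ → α → Prop) (r : α → α → Prop)
    (h : ∀ j, ∀ s : Finset α, ∃ y, P j y ∧ ∀ x ∈ s, r x y) :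
    ∃ f : ℕ → α, ∀ j, P j (f j) ∧ ∀ i < j, r (f i) (f j) := by
  classical
  choose g hg using h
  let F : ℕ → Finset α := fun n => Nat.rec ∅ (fun n s => insert (g n s) s) n
  have hF : ∀ i j, i < j → g i (F i) ∈ F j := by
    intro i j hij
    induction hij with
    | refl => exact Finset.mem_insert_self _ _
    | step _ ih => exact Finset.mem_insert_of_mem ih
  exact ⟨fun n => g n (F n), fun j => ⟨(hg j (F j)).1, fun i hij => (hg j (F j)).2 _ (hF i j hij)⟩⟩

section Canonization

variable {M : Type*} [PartialOrder M] {𝓜 B B' G X Y : Set M} {a b ν r : M}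

theorem PSub.trans (h : PSub 𝓜 B B') (h' : PSub 𝓜 B' G) : PSub 𝓜 B G where
  subset := h'.subset.trans h.subset
  root := h'.root
  convex := fun a ha x hx y hy hxa hay =>
    h'.convex a (h.convex a ha x (h'.subset hx) y (h'.subset hy) hxa hay) x hx y hy hxa hay
  pos := fun b hb hm => by
    have hm' : b ∉ maxs B' := fun h1 => hm (by rw [h.maxs_eq] at h1; exact h1.1)
    refine (h'.pos b hb hm').mono fun τ hτ => ?_
    rw [h.suc_eq (h'.subset hb)] at hτ
    exact ⟨hτ.1.1, hτ.2⟩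

/-- The inductive step of canonization: subtrees found above a positive set of successors are joined
at `ν`, the only node where positivity is not inherited. -/
theorem PSub.glue {A : Set M} {G : M → Set M} (hB : WTree 𝓜 B) (hν : ν ∈ B) (hA : A ⊆ suc B ν)
    (hpos : Pos 𝓜 ν A) (hG : ∀ τ ∈ A, PSub 𝓜 B (G τ) ∧ IsLeast (G τ) τ) :
    PSub 𝓜 B {b | b = ν ∨ ∃ τ ∈ A, b ∈ G τ} ∧ IsLeast {b | b = ν ∨ ∃ τ ∈ A, b ∈ G τ} ν := by
  have hle : IsLeast {b | b = ν ∨ ∃ τ ∈ A, b ∈ G τ} ν := by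
    refine ⟨Or.inl rfl, ?_⟩
    rintro b (rfl | ⟨τ, hτ, hb⟩)
    · exact le_rfl
    · exact (hA hτ).2.1.le.trans ((hG τ hτ).2.2 hb)
  refine ⟨⟨?_, ⟨ν, hle⟩, ?_, ?_⟩, hle⟩
  · rintro b (rfl | ⟨τ, hτ, hb⟩)
    · exact hν
    · exact (hG τ hτ).1.subset hb
  · rintro a ha x hx b hb hxa hab
    rcases (hle.2 hx |>.trans hxa).eq_or_lt with rfl | hlt
    · exact Or.inl rfl
    rcases hb with rfl | ⟨τ, hτ, hb⟩
    · exact absurd hab hlt.not_ge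
    · refine Or.inr ⟨τ, hτ, ?_⟩
      have hτb := (hG τ hτ).2.2 hb
      rcases hB.comparable ha (hA hτ).1 hab hτb with h1 | h1
      · rw [eq_of_mem_suc (hA hτ) ha hlt h1]; exact (hG τ hτ).2.1
      · exact (hG τ hτ).1.convex a ha τ (hG τ hτ).2.1 b hb h1 hab
  · rintro b (rfl | ⟨τ, hτ, hb⟩) hm
    · exact hpos.mono fun τ hτ => ⟨hA hτ, Or.inr ⟨τ, hτ, (hG τ hτ).2.1⟩⟩
    · exact ((hG τ hτ).1.pos b hb hm).mono fun σ hσ => ⟨hσ.1, Or.inr ⟨τ, hτ, hσ.2⟩⟩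

/-- Positive successor sets on which `v` is injective. -/
theorem exists_thin {β : Type*} (h𝓜 : 𝓜.Countable) (hG : WTree 𝓜 G) (v : M → β)
    (hnull : ∀ ρ ∈ G, ∀ s ∈ X, ¬ Pos 𝓜 ρ {τ ∈ suc G ρ | τ ∈ X ∧ v τ = v s}) :
    ∃ A : Set M, (∀ ρ ∈ G, ρ ∉ maxs G → Pos 𝓜 ρ (suc G ρ ∩ A)) ∧ InjOn v (X ∩ A) := by
  classical
  have hcG : Countable G := hG.countable.to_subtype
  have hcM : Countable 𝓜 := h𝓜.to_subtype
  -- A request is a node with a finite set of elements not below it. The counter repeats each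
  -- request infinitely often, so that infinitely many picks answer it.
  let J := {p : G × Finset 𝓜 // p.1.1 ∉ maxs G ∧ ∀ f ∈ p.2, ¬ f.1 ≤ p.1.1} × ℕ
  rcases isEmpty_or_nonempty J with hJ | hJ
  · refine ⟨∅, fun ρ hρ hm => ?_, by simp⟩
    exact (hJ.false ⟨⟨(⟨ρ, hρ⟩, ∅), hm, by simp⟩, 0⟩).elim
  obtain ⟨e, he⟩ := exists_surjective_nat J
  obtain ⟨f, hf⟩ := exists_seq_of_forall_finset
    (fun j y => y ∈ suc G (e j).1.1.1.1 ∧ ∀ ρ ∈ (e j).1.1.2, Incompat ρ.1 y)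
    (fun x y => x ≠ y ∧ (x ∈ X → y ∈ X → v x ≠ v y)) (by
      intro j s
      obtain ⟨⟨⟨⟨ρ, hρ⟩, F⟩, hm, hF⟩, n⟩ := e j
      simp only at hm hF ⊢
      -- The successors sharing the value of an earlier pick `x` are, up to finitely many, covered
      -- by a finite set `K x`. A successor incompatible with `K x` and outside the finite
      -- exceptional set has a new value.
      have hnull' : ∀ x ∈ X, ∃ F ⊆ 𝓜, F.Finite ∧ (∀ f ∈ F, ¬ f ≤ ρ) ∧
          {σ ∈ suc G ρ | (σ ∈ X ∧ v σ = v x) ∧ ∀ f ∈ F, Incompat f σ}.Finite := by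
        intro x hx
        have := hnull ρ hρ x hx
        simp only [Pos, not_forall, not_infinite] at this
        obtain ⟨F, h1, h2, h3, h4⟩ := this
        exact ⟨F, h1, h2, h3, h4.subset fun σ hσ => ⟨⟨hσ.1, hσ.2.1⟩, hσ.2.2⟩⟩
      choose! K hK1 hK2 hK3 hK4 using hnull'
      have hinf := hG.pos ρ hρ hm (Subtype.val '' (F : Set 𝓜) ∪ ⋃ x ∈ {x ∈ (s : Set M) | x ∈ X}, K x)
        (by
          refine union_subset (by rintro _ ⟨f, -, rfl⟩; exact f.2) (iUnion₂_subset fun x hx => ?_)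
          exact hK1 x hx.2)
        ((F.finite_toSet.image _).union
          ((s.finite_toSet.subset (sep_subset _ _)).biUnion fun x hx => hK2 x hx.2))
        (by
          rintro f (⟨f, hf, rfl⟩ | hf)
          · exact hF f hf
          · simp only [mem_iUnion] at hf
            obtain ⟨x, hx, hf⟩ := hf
            exact hK3 x hx.2 f hf)
      have hfin : ((s : Set M) ∪ ⋃ x ∈ {x ∈ (s : Set M) | x ∈ X},
          {σ ∈ suc G ρ | (σ ∈ X ∧ v σ = v x) ∧ ∀ f ∈ K x, Incompat f σ}).Finite :=
        s.finite_toSet.union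
          ((s.finite_toSet.subset (sep_subset _ _)).biUnion fun x hx => hK4 x hx.2)
      obtain ⟨y, ⟨hy1, hy2⟩, hy3⟩ := (hinf.sdiff hfin).nonempty
      refine ⟨y, ⟨hy1, fun ρ hρ => hy2 _ (Or.inl ⟨ρ, hρ, rfl⟩)⟩, fun x hx => ⟨?_, ?_⟩⟩
      · rintro rfl; exact hy3 (Or.inl hx)
      · intro hxX hyX hv
        refine hy3 (Or.inr (mem_biUnion (show x ∈ {x ∈ (s : Set M) | x ∈ X} from ⟨hx, hxX⟩) ?_))
        exact ⟨hy1, ⟨hyX, hv.symm⟩, fun f hf =>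
          hy2 f (Or.inr (mem_biUnion (show x ∈ {x ∈ (s : Set M) | x ∈ X} from ⟨hx, hxX⟩) hf))⟩)
  refine ⟨range f, fun ρ hρ hm F hF hfin hFρ => ?_, ?_⟩
  · have hfin' : (Subtype.val ⁻¹' F : Set 𝓜).Finite := hfin.preimage Subtype.val_injective.injOn
    have hmem : ∀ x ∈ F, ∃ h : x ∈ 𝓜, (⟨x, h⟩ : 𝓜) ∈ hfin'.toFinset := fun x hx =>
      ⟨hF hx, by simpa using hx⟩
    have hv : ∀ g ∈ hfin'.toFinset, ¬ g.1 ≤ ρ := fun g hg => hFρ _ (by simpa using hg)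
    choose k hk using fun n : ℕ =>
      he (⟨⟨(⟨ρ, hρ⟩, hfin'.toFinset), hm, hv⟩, n⟩ : J)
    have hkinj : Function.Injective k := fun n n' h => by
      have h1 := hk n
      rw [h, hk n'] at h1
      exact (congrArg Prod.snd h1).symm
    have hfinj : Function.Injective f := by
      intro i j hij
      rcases lt_trichotomy i j with h | h | h
      · exact absurd hij ((hf j).2 i h).1
      · exact h
      · exact absurd hij.symm ((hf i).2 j h).1
    refine (infinite_range_of_injective (hfinj.comp hkinj)).mono ?_
    rintro _ ⟨n, rfl⟩
    have h1 := (hf (k n)).1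
    rw [hk n] at h1
    refine ⟨⟨h1.1, mem_range_self _⟩, fun x hx => ?_⟩
    obtain ⟨h2, h3⟩ := hmem x hx
    exact h1.2 _ h3
  · rintro _ ⟨hi, i, rfl⟩ _ ⟨hj, j, rfl⟩ hij
    rcases lt_trichotomy i j with h | h | h
    · exact absurd hij (((hf j).2 i h).2 hi hj)
    · rw [h]
    · exact absurd hij.symm (((hf i).2 j h).2 hj hi)

/-- The hereditary restriction of `G` to successors in `A`. -/
theorem exists_pSub_of_pos {A : Set M} (hr : IsLeast G r)
    (hA : ∀ ρ ∈ G, ρ ∉ maxs G → Pos 𝓜 ρ (suc G ρ ∩ A)) (hG : WTree 𝓜 G) :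
    ∃ H, PSub 𝓜 G H ∧ IsLeast H r ∧ (∀ b ∈ H, b ≠ r → b ∈ A) ∧
      ∀ a ∈ G, ∀ b ∈ H, a ≤ b → a ∈ H := by
  have hle : IsLeast {b ∈ G | ∀ a ∈ G, a ≤ b → a ≠ r → a ∈ A} r :=
    ⟨⟨hr.1, fun a ha hle hne => absurd (le_antisymm hle (hr.2 ha)) hne⟩, fun b hb => hr.2 hb.1⟩
  refine ⟨{b ∈ G | ∀ a ∈ G, a ≤ b → a ≠ r → a ∈ A}, ⟨sep_subset _ _, ⟨r, hle⟩, ?_, ?_⟩, hle,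
    fun b hb hne => hb.2 b hb.1 le_rfl hne, ?_⟩
  · exact fun a ha x _ b hb _ hab => ⟨ha, fun c hc hca => hb.2 c hc (hca.trans hab)⟩
  · intro b hb hm
    refine (hA b hb.1 hm).mono fun τ hτ => ⟨hτ.1, hτ.1.1, fun a ha haτ hne => ?_⟩
    rcases hG.le_or_eq_of_mem_suc hb.1 hτ.1 ha haτ with h | h
    · exact hb.2 a ha h hne
    · exact h ▸ hτ.2
  · exact fun a ha b hb hab => ⟨ha, fun c hc hca => hb.2 c hc (hca.trans hab)⟩

/-- Canonization of functions on a front, above a node. -/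
theorem exists_canonical_above {β : Type*} (h𝓜 : 𝓜.Countable) (hB : WTree 𝓜 B)
    (hY : IsAntichain (· ≤ ·) Y) (hYB : Y ⊆ B) (hc : Covers B Y) (v : M → β) :
    ∀ ν ∈ B, (∃ y ∈ Y, ν ≤ y) → ∃ G Z, PSub 𝓜 B G ∧ IsLeast G ν ∧ Z ⊆ G ∧ IsAntichain (· ≤ ·) Z ∧
      Covers G Z ∧ ∀ η ∈ Y ∩ G, ∀ μ ∈ Y ∩ G, (v η = v μ ↔ ∃ ρ ∈ Z, ρ ≤ η ∧ ρ ≤ μ) := by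
  intro ν₀ hν₀
  refine hB.wellFounded.induction hν₀
    (P := fun ν => (∃ y ∈ Y, ν ≤ y) → ∃ G Z, PSub 𝓜 B G ∧ IsLeast G ν ∧ Z ⊆ G ∧
      IsAntichain (· ≤ ·) Z ∧ Covers G Z ∧
      ∀ η ∈ Y ∩ G, ∀ μ ∈ Y ∩ G, (v η = v μ ↔ ∃ ρ ∈ Z, ρ ≤ η ∧ ρ ≤ μ)) ?_
  rintro ν hν ih ⟨y₀, hy₀, hνy⟩
  by_cases hνY : ν ∈ Y
  · refine ⟨above B ν, {ν}, pSub_above hB hν, isLeast_above hν,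
      by simpa using (isLeast_above hν).1, IsAntichain.singleton, ?_, ?_⟩
    · exact fun m hm => ⟨ν, rfl, (isLeast_above hν).1, hm.1.2⟩
    · intro η hη μ hμ
      rw [← hY.eq hνY hη.1 hη.2.2, ← hY.eq hνY hμ.1 hμ.2.2]
      simp
  have hlt : ν < y₀ := lt_of_le_of_ne hνy fun h => hνY (h ▸ hy₀)
  have hYν : ∀ y ∈ Y, ∀ τ ∈ suc B ν, y < τ → False := by
    intro y hy τ hτ hyτ
    rcases hB.le_or_eq_of_mem_suc hν hτ (hYB hy) hyτ.le with h | h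
    · exact hY hy hy₀ (h.trans_lt hlt).ne (h.trans hlt.le)
    · exact hyτ.ne h
  have hνm : ν ∉ maxs B := fun h => h.2 y₀ (hYB hy₀) hlt
  have ih' : ∀ τ ∈ suc B ν, ∃ G Z, PSub 𝓜 B G ∧ IsLeast G τ ∧ Z ⊆ G ∧
      IsAntichain (· ≤ ·) Z ∧ Covers G Z ∧
      ∀ η ∈ Y ∩ G, ∀ μ ∈ Y ∩ G, (v η = v μ ↔ ∃ ρ ∈ Z, ρ ≤ η ∧ ρ ≤ μ) := by
    intro τ hτ
    refine ih τ hτ.1 hτ.2.1 ?_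
    obtain ⟨y, hy, -, h | h, -⟩ := hc.comparable hB hτ.1
    · exact ⟨y, hy, h⟩
    · exact ⟨y, hy, (h.eq_or_lt.resolve_right (hYν y hy τ hτ)).ge⟩
  choose! G Z hGP hGl hZG hZ hZc hcan using ih'
  have huniq : ∀ τ ∈ suc B ν, ∀ τ' ∈ suc B ν, ∀ x, τ ≤ x → τ' ≤ x → τ = τ' := by
    intro τ hτ τ' hτ' x h h'
    by_contra hne
    exact not_incompat_of_le h h' (hB.suc_incompat hτ hτ' hne)
  -- By induction all nodes of `Y ∩ G τ` above a given `z ∈ Z τ` share one value; it is read off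
  -- below at a chosen node `e z`.
  set X : Set M := {z | ∃ τ ∈ suc B ν, z ∈ Z τ} with hX
  have hw : ∀ z ∈ X, ∃ η ∈ Y, z ≤ η ∧ ∃ τ ∈ suc B ν, z ∈ Z τ ∧ η ∈ G τ := by
    rintro z ⟨τ, hτ, hz⟩
    have hT := (hGP τ hτ).wTree hB
    obtain ⟨m, hm, hzm⟩ := hT.exists_maxs (hZG τ hτ hz)
    obtain ⟨y, hy, hyB, hym⟩ := hc m (by rw [(hGP τ hτ).maxs_eq] at hm; exact hm.1)
    have hτm := (hGl τ hτ).2 hm.1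
    have hτy : τ ≤ y := by
      rcases hB.comparable hτ.1 hyB hτm hym with h | h
      · exact h
      · exact (h.eq_or_lt.resolve_right (hYν y hy τ hτ)).ge
    have hyG : y ∈ G τ := (hGP τ hτ).convex y hyB τ (hGl τ hτ).1 m hm.1 hτy hym
    obtain ⟨ρ, hρ, hρy, -⟩ := (hcan τ hτ y ⟨hy, hyG⟩ y ⟨hy, hyG⟩).1 rfl
    refine ⟨y, hy, ?_, τ, hτ, hz, hyG⟩
    rcases hT.comparable (hZG τ hτ hρ) (hZG τ hτ hz) (hρy.trans hym) hzm with h | h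
    · rw [← (hZ τ hτ).eq hρ hz h]; exact hρy
    · rw [(hZ τ hτ).eq hz hρ h]; exact hρy
  choose! e heY hze heG using hw
  have hval : ∀ τ ∈ suc B ν, ∀ z ∈ Z τ, ∀ η ∈ Y ∩ G τ, z ≤ η → v η = v (e z) := by
    intro τ hτ z hz η hη hzη
    have hzX : z ∈ X := ⟨τ, hτ, hz⟩
    obtain ⟨τ', hτ', hz', he⟩ := heG z hzX
    obtain rfl := huniq τ hτ τ' hτ' z ((hGl τ hτ).2 (hZG τ hτ hz)) ((hGl τ' hτ').2 (hZG τ' hτ' hz'))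
    exact (hcan τ hτ η hη (e z) ⟨heY z hzX, he⟩).2 ⟨z, hz, hzη, hze z hzX⟩
  have hXZ : ∀ τ ∈ suc B ν, ∀ x ∈ X, τ ≤ x → x ∈ Z τ := by
    rintro τ hτ x ⟨τ', hτ', hx⟩ hle
    obtain rfl := huniq τ hτ τ' hτ' x hle ((hGl τ' hτ').2 (hZG τ' hτ' hx))
    exact hx
  -- For a successor `τ ∈ X` the function is constant on `Y ∩ G τ`. If a positive set of such `τ`
  -- shares one value, these alone are kept and the function becomes constant. Otherwise the tree is
  -- thinned until distinct nodes of `X` carry distinct values.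
  by_cases hcase : ∃ s ∈ X, Pos 𝓜 ν {τ ∈ suc B ν | τ ∈ X ∧ v (e τ) = v (e s)}
  · obtain ⟨s, hs, hpos⟩ := hcase
    obtain ⟨h1, h2⟩ := PSub.glue (G := G) hB hν (sep_subset _ _) hpos
      fun τ hτ => ⟨hGP τ hτ.1, hGl τ hτ.1⟩
    refine ⟨_, {ν}, h1, h2, by simp, IsAntichain.singleton,
      fun m hm => ⟨ν, rfl, h2.1, h2.2 hm.1⟩, ?_⟩
    have key : ∀ η ∈ Y ∩ {b | b = ν ∨ ∃ τ ∈ {τ ∈ suc B ν | τ ∈ X ∧ v (e τ) = v (e s)}, b ∈ G τ},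
        v η = v (e s) := by
      rintro η ⟨hη, rfl | ⟨τ, ⟨hτ, hτX, hτs⟩, hηG⟩⟩
      · exact absurd hη hνY
      · rw [← hτs]
        exact hval τ hτ τ (hXZ τ hτ τ hτX le_rfl) η ⟨hη, hηG⟩ ((hGl τ hτ).2 hηG)
    intro η hη μ hμ
    rw [key η hη, key μ hμ]
    exact ⟨fun _ => ⟨ν, rfl, h2.2 hη.2, h2.2 hμ.2⟩, fun _ => rfl⟩
  · push Not at hcase
    obtain ⟨h1, h2⟩ := PSub.glue (G := G) hB hν Subset.rfl (hB.pos ν hν hνm)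
      fun τ hτ => ⟨hGP τ hτ, hGl τ hτ⟩
    set H : Set M := {b | b = ν ∨ ∃ τ ∈ suc B ν, b ∈ G τ} with hH
    have hHT := h1.wTree hB
    have hHG : ∀ τ ∈ suc B ν, ∀ x ∈ H, τ ≤ x → x ∈ G τ := by
      rintro τ hτ x (rfl | ⟨τ', hτ', hx⟩) hle
      · exact absurd hτ.2.1 hle.not_gt
      · obtain rfl := huniq τ hτ τ' hτ' x hle ((hGl τ' hτ').2 hx)
        exact hx
    obtain ⟨A, hA, hinj⟩ := exists_thin (X := X) h𝓜 hHT (fun z => v (e z)) (by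
      rintro ρ hρ s hs hpos
      rw [h1.suc_eq hρ] at hpos
      rcases hρ with rfl | ⟨τ, hτ, hρ⟩
      · exact hcase s hs (hpos.mono fun σ hσ => ⟨hσ.1.1, hσ.2⟩)
      -- Inside `G τ` distinct nodes of `Z τ` already carry distinct values, so at most one
      -- successor is in question.
      · refine hpos.infinite (Set.Subsingleton.finite ?_)
        rintro σ ⟨⟨hσ, hσH⟩, hσX, hσv⟩ σ' ⟨⟨hσ', hσH'⟩, hσX', hσv'⟩
        have hτρ := (hGl τ hτ).2 hρ
        have hz := hXZ τ hτ σ hσX (hτρ.trans hσ.2.1.le)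
        have hz' := hXZ τ hτ σ' hσX' (hτρ.trans hσ'.2.1.le)
        have hg : ∀ z ∈ X, z ∈ Z τ → e z ∈ G τ := fun z hzX hz => by
          obtain ⟨τ', hτ', hz', he⟩ := heG z hzX
          obtain rfl := huniq τ hτ τ' hτ' z ((hGl τ hτ).2 (hZG τ hτ hz))
            ((hGl τ' hτ').2 (hZG τ' hτ' hz'))
          exact he
        obtain ⟨x, hx, hx1, hx2⟩ := (hcan τ hτ (e σ) ⟨heY σ hσX, hg σ hσX hz⟩ (e σ')
          ⟨heY σ' hσX', hg σ' hσX' hz'⟩).1 (hσv.trans hσv'.symm)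
        have hT := (hGP τ hτ).wTree hB
        have hu : ∀ z ∈ X, z ∈ Z τ → x ≤ e z → x = z := fun z hzX hz hxz => by
          rcases hT.comparable (hZG τ hτ hx) (hZG τ hτ hz) hxz (hze z hzX) with h | h
          · exact (hZ τ hτ).eq hx hz h
          · exact ((hZ τ hτ).eq hz hx h).symm
        rw [← hu σ hσX hz hx1, ← hu σ' hσX' hz' hx2])
    obtain ⟨G', hG', hG'l, hG'A, hG'low⟩ := exists_pSub_of_pos h2 hA hHT
    have hXH : X ⊆ H := by
      rintro z ⟨τ, hτ, hz⟩
      exact Or.inr ⟨τ, hτ, hZG τ hτ hz⟩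
    have hνX : ν ∉ X := by
      rintro ⟨τ, hτ, hz⟩
      exact ((hGl τ hτ).2 (hZG τ hτ hz)).not_gt hτ.2.1
    have hP := h1.trans hG'
    refine ⟨G', X ∩ G', hP, hG'l, inter_subset_right, ?_, ?_, ?_⟩
    · rintro x ⟨⟨τ, hτ, hx⟩, -⟩ y ⟨hy, -⟩ hne hle
      have hy' := hXZ τ hτ y hy (((hGl τ hτ).2 (hZG τ hτ hx)).trans hle)
      exact hZ τ hτ hx hy' hne hle
    · intro m hm
      rw [hP.maxs_eq] at hm
      rcases hG'.subset hm.2 with rfl | ⟨τ, hτ, hmG⟩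
      · exact absurd hm.1 hνm
      · obtain ⟨z, hz, hzG, hzm⟩ := hZc τ hτ m (by rw [(hGP τ hτ).maxs_eq]; exact ⟨hm.1, hmG⟩)
        have hzX : z ∈ X := ⟨τ, hτ, hz⟩
        have := hG'low z (hXH hzX) m hm.2 hzm
        exact ⟨z, ⟨hzX, this⟩, this, hzm⟩
    · have key : ∀ η ∈ Y ∩ G', ∃ ρ ∈ X ∩ G', ρ ≤ η ∧ v η = v (e ρ) := by
        rintro η ⟨hη, hηG⟩
        rcases hG'.subset hηG with rfl | ⟨τ, hτ, hηG'⟩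
        · exact absurd hη hνY
        · obtain ⟨ρ, hρ, hρη, -⟩ := (hcan τ hτ η ⟨hη, hηG'⟩ η ⟨hη, hηG'⟩).1 rfl
          have hρX : ρ ∈ X := ⟨τ, hτ, hρ⟩
          exact ⟨ρ, ⟨hρX, hG'low ρ (hXH hρX) η hηG hρη⟩, hρη,
            hval τ hτ ρ hρ η ⟨hη, hηG'⟩ hρη⟩
      intro η hη μ hμ
      constructor
      · intro heq
        obtain ⟨ρ, hρ, hρη, hv⟩ := key η hη
        obtain ⟨ρ', hρ', hρμ, hv'⟩ := key μ hμ
        have hA' : ∀ x ∈ X ∩ G', x ∈ X ∩ A := fun x hx =>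
          ⟨hx.1, hG'A x hx.2 fun h => hνX (h ▸ hx.1)⟩
        have : ρ = ρ' := hinj (hA' ρ hρ) (hA' ρ' hρ') (hv.symm.trans (heq.trans hv'))
        exact ⟨ρ, hρ, hρη, this ▸ hρμ⟩
      · rintro ⟨ρ, ⟨⟨τ, hτ, hρ⟩, hρG⟩, hρη, hρμ⟩
        have hτρ := (hGl τ hτ).2 (hZG τ hτ hρ)
        have hηG := hHG τ hτ η (hG'.subset hη.2) (hτρ.trans hρη)
        have hμG := hHG τ hτ μ (hG'.subset hμ.2) (hτρ.trans hρμ)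
        exact (hcan τ hτ η ⟨hη.1, hηG⟩ μ ⟨hμ.1, hμG⟩).2 ⟨ρ, hρ, hρη, hρμ⟩

/-- Every function on a front is canonical on a positive subtree. -/
theorem exists_canonical {β : Type*} (h𝓜 : 𝓜.Countable) (hB : WTree 𝓜 B) (hr : IsLeast B r)
    (hY : IsAntichain (· ≤ ·) Y) (hYB : Y ⊆ B) (hc : Covers B Y) (v : M → β) :
    ∃ G Z, PSub 𝓜 B G ∧ IsLeast G r ∧ Z ⊆ G ∧ IsAntichain (· ≤ ·) Z ∧
      Covers G Z ∧ ∀ η ∈ Y ∩ G, ∀ μ ∈ Y ∩ G, (v η = v μ ↔ ∃ ρ ∈ Z, ρ ≤ η ∧ ρ ≤ μ) := by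
  obtain ⟨y, hy, hyB, -⟩ := hc.comparable hB hr.1
  exact exists_canonical_above h𝓜 hB hY hYB hc v r hr.1 ⟨y, hy, hr.2 hyB⟩

theorem PSub.ext (h : PSub 𝓜 B G) (hr : IsLeast B r) (hr' : r ∈ G) : Ext B G where
  lower := fun a ha b _ hb hab => h.convex a ha r hr' b hb (hr.2 ha) hab
  cover := fun m hm => ⟨m, by rw [h.maxs_eq] at hm; exact hm.1, hm.1, le_rfl⟩

end Canonization

end CWT

namespace CWT

/-! ### Grafting trees on a common root -/

section Graft

variable {M : Type*} [PartialOrder M] {𝓜 : Set M} {r b m : M} {f : ℕ → M} {T : ℕ → Set M} {n : ℕ}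

/-- The tree obtained by putting the root `r` below all the trees `T n`. -/
def graft (r : M) (T : ℕ → Set M) : Set M := {b | b = r ∨ ∃ n, b ∈ T n}

/-- Conditions for `graft r T` to be a tree. -/
structure Graftable (𝓜 : Set M) (r : M) (f : ℕ → M) (T : ℕ → Set M) : Prop where
  tree : ∀ n, WTree 𝓜 (T n)
  least : ∀ n, IsLeast (T n) (f n)
  lt : ∀ n, r < f n
  incompat : ∀ i j, i ≠ j → Incompat (f i) (f j)
  conv : ∀ ρ ∈ 𝓜, ¬ ρ ≤ r → {n | ¬ Incompat ρ (f n)}.Finite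

namespace Graftable

variable (h : Graftable 𝓜 r f T)
include h

theorem isLeast : IsLeast (graft r T) r := by
  refine ⟨Or.inl rfl, ?_⟩
  rintro b (rfl | ⟨n, hb⟩)
  · exact le_rfl
  · exact (h.lt n).le.trans ((h.least n).2 hb)

theorem injective : Function.Injective f := fun i j hij => by
  by_contra hne
  exact not_incompat_of_le le_rfl hij.ge (h.incompat i j hne)

theorem mem_of_le {c : M} (hc : c ∈ graft r T) (hle : f n ≤ c) : c ∈ T n := by
  rcases hc with rfl | ⟨j, hj⟩
  · exact absurd hle (h.lt n).not_ge
  · by_cases hne : n = j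
    · exact hne ▸ hj
    · exact absurd (h.incompat n j hne) (not_incompat_of_le hle ((h.least j).2 hj))

theorem above_eq : above (graft r T) (f n) = T n :=
  Subset.antisymm (fun _ hc => h.mem_of_le hc.1 hc.2)
    fun _ hc => ⟨Or.inr ⟨n, hc⟩, (h.least n).2 hc⟩

theorem suc_root : suc (graft r T) r = range f := by
  ext τ
  constructor
  · rintro ⟨rfl | ⟨n, hn⟩, h2, h3⟩
    · exact absurd h2 (lt_irrefl _)
    · refine ⟨n, ?_⟩
      by_contra hne
      exact h3 ⟨f n, Or.inr ⟨n, (h.least n).1⟩, h.lt n, lt_of_le_of_ne ((h.least n).2 hn) hne⟩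
  · rintro ⟨n, rfl⟩
    refine ⟨Or.inr ⟨n, (h.least n).1⟩, h.lt n, ?_⟩
    rintro ⟨ρ, rfl | ⟨j, hj⟩, h2, h3⟩
    · exact lt_irrefl _ h2
    · have hle := (h.least j).2 hj
      by_cases hne : n = j
      · subst hne; exact h3.not_ge hle
      · exact not_incompat_of_le le_rfl (hle.trans h3.le) (h.incompat n j hne)

theorem suc_eq (hb : b ∈ T n) : suc (graft r T) b = suc (T n) b := by
  have hle := (h.least n).2 hb
  ext τ
  constructor
  · rintro ⟨h1, h2, h3⟩
    exact ⟨h.mem_of_le h1 (hle.trans h2.le), h2, fun ⟨ρ, h4, h5⟩ => h3 ⟨ρ, Or.inr ⟨n, h4⟩, h5⟩⟩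
  · rintro ⟨h1, h2, h3⟩
    exact ⟨Or.inr ⟨n, h1⟩, h2, fun ⟨ρ, h4, h5, h6⟩ =>
      h3 ⟨ρ, h.mem_of_le h4 (hle.trans h5.le), h5, h6⟩⟩

theorem mem_maxs (hb : b ∈ T n) : b ∈ maxs (graft r T) ↔ b ∈ maxs (T n) := by
  constructor
  · exact fun h1 => ⟨hb, fun c hc => h1.2 c (Or.inr ⟨n, hc⟩)⟩
  · exact fun h1 => ⟨Or.inr ⟨n, hb⟩, fun c hc hlt =>
      h1.2 c (h.mem_of_le hc (((h.least n).2 hb).trans hlt.le)) hlt⟩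

theorem root_not_mem_maxs : r ∉ maxs (graft r T) := fun hm =>
  hm.2 (f 0) (Or.inr ⟨0, (h.least 0).1⟩) (h.lt 0)

theorem wTree : WTree 𝓜 (graft r T) where
  countable := by
    have : graft r T = {r} ∪ ⋃ n, T n := by ext; simp [graft]
    rw [this]
    exact (countable_singleton r).union (countable_iUnion fun n => (h.tree n).countable)
  exists_root := ⟨r, h.isLeast⟩
  incompat := by
    rintro η hη ν hν h1 h2
    rcases hη with rfl | ⟨i, hi⟩
    · exact absurd (h.isLeast.2 hν) h1
    rcases hν with rfl | ⟨j, hj⟩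
    · exact absurd (h.isLeast.2 (Or.inr ⟨i, hi⟩)) h2
    by_cases hij : i = j
    · subst hij; exact (h.tree i).incompat η hi ν hj h1 h2
    · exact (h.incompat i j hij).mono ((h.least i).2 hi) ((h.least j).2 hj)
  chain_finite := fun C hC hch => by
    by_cases hne : ∃ c ∈ C, c ≠ r
    · obtain ⟨c, hc, hcr⟩ := hne
      obtain ⟨n, hn⟩ := (hC hc).resolve_left hcr
      have hsub : C ∩ T n ⊆ T n := inter_subset_right
      refine (((h.tree n).chain_finite _ hsub (fun x hx y hy => hch hx.1 hy.1)).union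
        (finite_singleton r)).subset fun x hx => ?_
      rcases hC hx with hxr | ⟨j, hj⟩
      · exact Or.inr hxr
      · refine Or.inl ⟨hx, ?_⟩
        by_cases hjn : j = n
        · exact hjn ▸ hj
        · have hinc := (h.incompat j n hjn).mono ((h.least j).2 hj) ((h.least n).2 hn)
          rcases hch.total hx hc with h1 | h1
          · exact absurd hinc (not_incompat_of_le h1 le_rfl)
          · exact absurd hinc (not_incompat_of_le le_rfl h1)
    · push Not at hne
      exact (finite_singleton r).subset hne
  pos := by
    rintro b (rfl | ⟨n, hn⟩) hm
    · rw [h.suc_root]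
      intro F hF hfin hFr
      have hbad : (⋃ ρ ∈ F, {n | ¬ Incompat ρ (f n)}).Finite :=
        hfin.biUnion fun ρ hρ => h.conv ρ (hF hρ) (hFr ρ hρ)
      refine ((hbad.infinite_compl).image h.injective.injOn).mono ?_
      rintro _ ⟨n, hn, rfl⟩
      refine ⟨mem_range_self n, fun ρ hρ => ?_⟩
      by_contra hinc
      exact hn (mem_biUnion hρ hinc)
    · rw [h.suc_eq hn]
      exact (h.tree n).pos b hn fun h1 => hm ((h.mem_maxs hn).2 h1)

end Graftable

theorem Sb.inter_left {B B₁ B₂ : Set M} (hr : ∃ r, IsLeast B r) (h : Sb B B₁) (h' : Sb B B₂) :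
    Sb B₁ (B₁ ∩ B₂) where
  subset := inter_subset_left
  lower := fun a ha b hb hab => ⟨ha, h'.lower a (h.subset ha) b hb.2 hab⟩
  nonempty := (h.inter hr h').nonempty
  fin := fun ν hν => ((h.inter hr h').fin ν hν).subset fun τ hτ => by
    rw [h.suc_eq hν.1] at hτ
    exact ⟨hτ.1.1, hτ.2⟩

end Graft

/-! ### Upper bounds of countable chains of trees -/

section Bound

variable {M : Type*} [PartialOrder M] [OrderBot M] {𝓜 : Set M}

/-- `Z` is a set of immediate successors of the root in the tree `W` above `B`, not covered by
finitely many elements of `𝓜 \ {⊥}`. -/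
structure IsTask (𝓜 B W Z : Set M) : Prop where
  tree : WTree 𝓜 W
  least : IsLeast W ⊥
  subset : W ⊆ 𝓜
  le : Le' B W
  suc : Z ⊆ suc W ⊥
  pos : ∀ F ⊆ 𝓜, F.Finite → ⊥ ∉ F → ∃ ν ∈ Z, ∀ ρ ∈ F, Incompat ρ ν

/-- Diagonalization: `V n` is an exhaustive subtree of `W n` extending `S 0, …, S n`, and the root
of `C` receives one root successor `f n` of each `V n` with its cone. Dropping the `f n` with `n <
k` leaves an extension of `S k`. Each `f n` avoids the first `n` elements of `𝓜 \ {⊥}` in an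
enumeration, which gives the convergence stated last. -/
theorem exists_bound (h𝓜 : 𝓜.Countable) {S W Z : ℕ → Set M} (hS : ∀ k, WTree 𝓜 (S k))
    (hSl : ∀ k, IsLeast (S k) ⊥) (hSne : ∀ k, S k ≠ {⊥})
    (hSle : ∀ k n, k ≤ n → Le' (S k) (S n)) (hW : ∀ n, IsTask 𝓜 (S n) (W n) (Z n)) :
    ∃ C, WTree 𝓜 C ∧ IsLeast C ⊥ ∧ C ≠ {⊥} ∧ C ⊆ 𝓜 ∧ (∀ k, Le' (S k) C) ∧
      (∀ ν ∈ suc C ⊥, ∃ n, ν ∈ Z n ∧ Sb (above (W n) ν) (above C ν)) ∧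
      ∀ ρ ∈ 𝓜, ρ ≠ ⊥ → {ν ∈ suc C ⊥ | ¬ Incompat ρ ν}.Finite := by
  have hV : ∀ n, ∃ V, Sb (W n) V ∧ ∀ k ≤ n, Ext (S k) V := by
    intro n
    have hle : ∀ k ≤ n, Le' (S k) (W n) := fun k hk =>
      (hSle k n hk).trans (hS k) (hS n) (hW n).tree (hSl n) (hW n).least (hW n).le
    have : ∀ K, ∃ V, Sb (W n) V ∧ ∀ k ≤ n, k < K → Ext (S k) V := by
      intro K
      induction K with
      | zero => exact ⟨W n, Sb.refl ⟨⊥, (hW n).least.1⟩, by simp⟩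
      | succ K ih =>
        obtain ⟨V, hV, hVE⟩ := ih
        by_cases hK : K ≤ n
        · obtain ⟨V', hV', hVE'⟩ := hle K hK
          have hr := (hW n).tree.exists_root
          refine ⟨V ∩ V', hV.inter hr hV', fun k hk hkK => ?_⟩
          rcases (Nat.lt_succ_iff.1 hkK).eq_or_lt with rfl | h
          · rw [inter_comm]
            exact hVE'.of_sb (hV'.wTree (hW n).tree) (hV'.inter_left hr hV)
          · exact (hVE k hk h).of_sb (hV.wTree (hW n).tree) (hV.inter_left hr hV')
        · exact ⟨V, hV, fun k hk hkK => hVE k hk (by omega)⟩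
    obtain ⟨V, hV, h⟩ := this (n + 1)
    exact ⟨V, hV, fun k hk => h k hk (by omega)⟩
  choose V hVs hVE using hV
  have hVT := fun n => (hVs n).wTree (hW n).tree
  have hVl := fun n => (hVs n).isLeast (hW n).least
  have hne : (𝓜 \ {⊥}).Nonempty := by
    obtain ⟨ν, hν, -⟩ := (hW 0).pos ∅ (empty_subset _) finite_empty (by simp)
    exact ⟨ν, (hW 0).subset ((hW 0).suc hν).1, ((hW 0).suc hν).2.1.ne'⟩
  obtain ⟨g, hg⟩ := (h𝓜.mono sdiff_subset).exists_eq_range hne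
  have hg' : ∀ i, g i ∈ 𝓜 \ {⊥} := fun i => hg ▸ mem_range_self i
  obtain ⟨f, hf⟩ := exists_seq_of_forall_finset
    (fun n y => y ∈ Z n ∧ y ∈ V n ∧ ∀ i < n, Incompat (g i) y)
    (fun x y => x ∈ 𝓜 → x ≠ ⊥ → Incompat x y) (by
      intro n s
      -- The finitely many root successors of `W n` missing from `V n` join the test set: `ν` is
      -- compatible with itself, so it cannot be one of them.
      obtain ⟨ν, hν, hinc⟩ := (hW n).pos ((suc (W n) ⊥ \ V n) ∪ (g '' Iio n) ∪
        {x ∈ (s : Set M) | x ∈ 𝓜 ∧ x ≠ ⊥}) (by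
          rintro x ((hx | ⟨i, -, rfl⟩) | hx)
          · exact (hW n).subset hx.1.1
          · exact (hg' i).1
          · exact hx.2.1) ((((hVs n).fin ⊥ (hVl n).1).union ((finite_Iio n).image g)).union
            (s.finite_toSet.subset (sep_subset _ _))) (by
          rintro ((hx | ⟨i, -, hi⟩) | hx)
          · exact hx.1.2.1.ne rfl
          · exact (hg' i).2 hi
          · exact hx.2.2 rfl)
      refine ⟨ν, ⟨hν, ?_, fun i hi => hinc _ (Or.inl (Or.inr ⟨i, hi, rfl⟩))⟩,
        fun x hx h1 h2 => hinc x (Or.inr ⟨hx, h1, h2⟩)⟩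
      by_contra hνV
      exact not_incompat_of_le le_rfl le_rfl
        (hinc ν (Or.inl (Or.inl ⟨(hW n).suc hν, hνV⟩))))
  have hfs : ∀ n, f n ∈ suc (W n) ⊥ := fun n => (hW n).suc (hf n).1.1
  have hfM : ∀ n, f n ∈ 𝓜 := fun n => (hW n).subset (hfs n).1
  have hfb : ∀ n, f n ≠ ⊥ := fun n => (hfs n).2.1.ne'
  have hconv : ∀ ρ ∈ 𝓜, ρ ≠ ⊥ → {n | ¬ Incompat ρ (f n)}.Finite := by
    intro ρ hρ hne
    obtain ⟨i, rfl⟩ : ρ ∈ range g := hg ▸ ⟨hρ, hne⟩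
    refine (finite_Iic i).subset fun n hn => ?_
    by_contra hni
    exact hn ((hf n).1.2.2 i (not_le.1 hni))
  have hG : Graftable 𝓜 ⊥ f (fun n => above (V n) (f n)) := by
    refine ⟨fun n => wTree_above (hVT n) (hf n).1.2.1, fun n => isLeast_above (hf n).1.2.1,
      fun n => bot_lt_iff_ne_bot.2 (hfb n), fun i j hij => ?_,
      fun ρ hρ hle => hconv ρ hρ fun h => hle h.le⟩
    rcases hij.lt_or_gt with h | h
    · exact (hf j).2 i h (hfM i) (hfb i)
    · exact ((hf i).2 j h (hfM j) (hfb j)).symm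
  refine ⟨graft ⊥ fun n => above (V n) (f n), hG.wTree, hG.isLeast, ?_, ?_, ?_, ?_, ?_⟩
  · intro h
    have : f 0 ∈ graft ⊥ fun n => above (V n) (f n) := Or.inr ⟨0, (hG.least 0).1⟩
    rw [h] at this
    exact hfb 0 this
  · rintro b (rfl | ⟨n, hn⟩)
    · exact (hW 0).subset (hW 0).least.1
    · exact (hW n).subset ((hVs n).subset hn.1)
  · intro k
    have hs : Sb (graft ⊥ fun n => above (V n) (f n))
        {b | b = ⊥ ∨ ∃ n ≥ k, b ∈ above (V n) (f n)} := by
      refine ⟨?_, ?_, ⟨⊥, Or.inl rfl⟩, ?_⟩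
      · rintro b (rfl | ⟨n, -, hn⟩)
        · exact Or.inl rfl
        · exact Or.inr ⟨n, hn⟩
      · rintro a (rfl | ⟨j, hj⟩) b hb hab
        · exact Or.inl rfl
        · rcases hb with rfl | ⟨n, hkn, hn⟩
          · exact Or.inl (le_bot_iff.1 hab)
          · have := hG.mem_of_le (n := j) (Or.inr ⟨n, hn⟩) (hj.2.trans hab)
            by_cases hjn : j = n
            · exact Or.inr ⟨j, hjn ▸ hkn, hj⟩
            · exact absurd (hG.incompat j n hjn) (not_incompat_of_le this.2 hn.2)
      · rintro ν (rfl | ⟨n, hkn, hn⟩)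
        · rw [hG.suc_root]
          refine ((finite_Iio k).image f).subset ?_
          rintro _ ⟨⟨n, rfl⟩, hn⟩
          refine ⟨n, ?_, rfl⟩
          by_contra hk
          exact hn (Or.inr ⟨n, not_lt.1 hk, (hG.least n).1⟩)
        · rw [hG.suc_eq hn]
          convert finite_empty
          rw [eq_empty_iff_forall_notMem]
          exact fun τ hτ => hτ.2 (Or.inr ⟨n, hkn, hτ.1.1⟩)
    refine ⟨_, hs, ?_, ?_⟩
    · rintro a ha b hb (rfl | ⟨n, hkn, hn⟩) hab
      · exact Or.inl (le_bot_iff.1 hab)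
      · have haV := (hVE n k hkn).lower a ha b hb hn.1 hab
        rcases (hVT n).comparable haV (hf n).1.2.1 hab hn.2 with h | h
        · rcases (hW n).tree.le_or_eq_of_mem_suc (hW n).least.1 (hfs n)
            ((hVs n).subset haV) h with h' | h'
          · exact Or.inl (le_bot_iff.1 h')
          · exact Or.inr ⟨n, hkn, haV, h'.ge⟩
        · exact Or.inr ⟨n, hkn, haV, h⟩
    · intro m hm
      rw [(hs.pSub hG.wTree).maxs_eq] at hm
      rcases hm.2 with rfl | ⟨n, hkn, hn⟩
      · exact absurd hm.1 hG.root_not_mem_maxs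
      · have hm' := (hG.mem_maxs hn).1 hm.1
        obtain ⟨y, hy, hyV, hym⟩ := (hVE n k hkn).cover m
          ⟨hn.1, fun x hx hlt => hm'.2 x ⟨hx, hn.2.trans hlt.le⟩ hlt⟩
        refine ⟨y, hy, ?_, hym⟩
        rcases (hVT n).comparable hyV (hf n).1.2.1 hym hn.2 with h | h
        · rcases (hW n).tree.le_or_eq_of_mem_suc (hW n).least.1 (hfs n)
            ((hVs n).subset hyV) h with h' | h'
          · rw [le_bot_iff.1 h'] at hy
            exact absurd hy (IsLeast.not_mem_maxs (hSl k) (hSne k))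
          · exact Or.inr ⟨n, hkn, hyV, h'.ge⟩
        · exact Or.inr ⟨n, hkn, hyV, h⟩
  · intro ν hν
    rw [hG.suc_root] at hν
    obtain ⟨n, rfl⟩ := hν
    refine ⟨n, (hf n).1.1, ?_⟩
    rw [hG.above_eq]
    exact (hVs n).above (hf n).1.2.1
  · intro ρ hρ hne
    rw [hG.suc_root]
    refine ((hconv ρ hρ hne).image f).subset ?_
    rintro _ ⟨⟨n, rfl⟩, hn⟩
    exact ⟨n, hn, rfl⟩

/-- A running maximum along an enumeration of the chain. -/
theorem exists_cofinal_seq {𝓢 : Set (Set M)} (hc : 𝓢.Countable) (hne : 𝓢.Nonempty)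
    (htree : ∀ B ∈ 𝓢, WTree 𝓜 B) (hl : ∀ B ∈ 𝓢, IsLeast B ⊥)
    (htot : ∀ B ∈ 𝓢, ∀ B' ∈ 𝓢, Le' B B' ∨ Le' B' B) :
    ∃ S : ℕ → Set M, (∀ n, S n ∈ 𝓢) ∧ (∀ k n, k ≤ n → Le' (S k) (S n)) ∧
      ∀ B ∈ 𝓢, ∃ n, Le' B (S n) := by
  classical
  obtain ⟨b, rfl⟩ := hc.exists_eq_range hne
  have hb : ∀ n, b n ∈ range b := mem_range_self
  let F : ℕ → ℕ := fun n => Nat.rec 0 (fun n i => if Le' (b i) (b (n + 1)) then n + 1 else i) n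
  have hF : ∀ n, F (n + 1) = if Le' (b (F n)) (b (n + 1)) then n + 1 else F n := fun n => rfl
  have hrefl : ∀ n, Le' (b n) (b n) := fun n => Le'.refl ⟨⊥, (hl _ (hb n)).1⟩
  have htrans : ∀ i j k, Le' (b i) (b j) → Le' (b j) (b k) → Le' (b i) (b k) := fun i j k =>
    Le'.trans (htree _ (hb i)) (htree _ (hb j)) (htree _ (hb k)) (hl _ (hb j)) (hl _ (hb k))
  refine ⟨fun n => b (F n), fun n => hb _, ?_, ?_⟩
  · intro k n hkn
    induction hkn with
    | refl => exact hrefl _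
    | step _ ih =>
      refine htrans _ _ _ ih ?_
      rw [hF]
      split_ifs with h
      · exact h
      · exact hrefl _
  · rintro _ ⟨n, rfl⟩
    refine ⟨n, ?_⟩
    cases n with
    | zero => exact hrefl _
    | succ n =>
      simp only [hF]
      split_ifs with h
      · exact hrefl _
      · exact (htot _ (hb _) _ (hb _)).resolve_left h

end Bound

end CWT

/-! ### The ambient order: sets of finite sequences -/

namespace CWT

/-- The nonempty sets of finite sequences, ordered by reverse inclusion. -/
def Node : Type := {a : Set (List ℕ) // a.Nonempty}

namespace Node

instance : PartialOrder Node where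
  le a b := b.1 ⊆ a.1
  le_refl _ := Subset.rfl
  le_trans _ _ _ h h' := h'.trans h
  le_antisymm _ _ h h' := Subtype.ext (h'.antisymm h)

instance : OrderBot Node where
  bot := ⟨univ, univ_nonempty⟩
  bot_le a := subset_univ a.1

theorem bot_val : (⊥ : Node).1 = univ := rfl

theorem incompat_iff {a b : Node} : Incompat a b ↔ Disjoint a.1 b.1 := by
  rw [← not_iff_not, not_disjoint_iff_nonempty_inter]
  simp only [Incompat, not_not]
  exact ⟨fun ⟨c, h1, h2⟩ => c.2.mono (subset_inter h1 h2),
    fun h => ⟨⟨_, h⟩, inter_subset_left, inter_subset_right⟩⟩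

/-- The union of a sequence of nodes. -/
def union (f : ℕ → Node) : Node := ⟨⋃ i, (f i).1, (f 0).2.mono (subset_iUnion (fun i => (f i).1) 0)⟩

theorem union_le (f : ℕ → Node) (i : ℕ) : union f ≤ f i := subset_iUnion (fun i => (f i).1) i

theorem union_incompat {f : ℕ → Node} {a : Node} : Incompat (union f) a ↔ ∀ i, Incompat (f i) a := by
  rw [incompat_iff]
  simp only [union, disjoint_iUnion_left, incompat_iff]

/-- The set of all end extensions of `s`. -/
def cone (s : List ℕ) : Node := ⟨{t | s <+: t}, s, List.prefix_rfl⟩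

/-- `a` is closed under end extension. -/
def Up (a : Node) : Prop := ∀ s ∈ a.1, a ≤ cone s

theorem cone_nil : cone [] = ⊥ := by
  apply Subtype.ext
  ext t
  simp [cone, bot_val]

theorem up_cone (s : List ℕ) : Up (cone s) := fun _ h _ h' => List.IsPrefix.trans h h'

theorem Up.union {f : ℕ → Node} (h : ∀ i, Up (f i)) : Up (union f) := by
  intro s hs
  obtain ⟨i, hi⟩ := mem_iUnion.1 hs
  exact (union_le f i).trans (h i s hi)

theorem cone_le_cone {s t : List ℕ} : cone s ≤ cone t ↔ s <+: t :=
  ⟨fun h => h List.prefix_rfl, fun h _ h' => h.trans h'⟩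

theorem cone_incompat {s t : List ℕ} (h : ¬ s <+: t) (h' : ¬ t <+: s) :
    Incompat (cone s) (cone t) := by
  rw [incompat_iff, Set.disjoint_left]
  intro u h1 h2
  rcases le_total s.length t.length with h3 | h3
  · exact h (List.prefix_of_prefix_length_le h1 h2 h3)
  · exact h' (List.prefix_of_prefix_length_le h2 h1 h3)

/-- If `t` is not a prefix of `s` and `cone t` is compatible with `cone (s ++ [n])`, then `t`
extends `s ++ [n]`, which determines `n`. -/
theorem graftable_cone (s : List ℕ) :
    Graftable (range cone) (cone s) (fun n => cone (s ++ [n])) (fun n => {cone (s ++ [n])}) := by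
  have hne : ∀ i j : ℕ, i ≠ j → ¬ s ++ [i] <+: s ++ [j] := by
    intro i j hij h
    rw [List.prefix_append_right_inj] at h
    simp at h
    exact hij h
  have hinc : ∀ i j : ℕ, i ≠ j → Incompat (cone (s ++ [i])) (cone (s ++ [j])) :=
    fun i j hij => cone_incompat (hne i j hij) (hne j i hij.symm)
  refine ⟨fun n => wTree_singleton _ _, fun n => isLeast_singleton, fun n => ?_, hinc, ?_⟩
  · refine lt_of_le_not_ge (cone_le_cone.2 (List.prefix_append _ _)) fun h => ?_
    have := (cone_le_cone.1 h).length_le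
    simp at this
  · rintro _ ⟨t, rfl⟩ hts
    refine Set.Subsingleton.finite ?_
    intro i hi j hj
    by_contra hij
    have key : ∀ k, ¬ Incompat (cone t) (cone (s ++ [k])) → s ++ [k] <+: t := by
      intro k hk
      by_contra h
      refine hk (cone_incompat (fun h' => ?_) h)
      rcases List.prefix_concat_iff.1 h' with h1 | h1
      · exact h (h1 ▸ List.prefix_rfl)
      · exact hts (cone_le_cone.2 h1)
    exact not_incompat_of_le (cone_le_cone.2 (key i hi)) (cone_le_cone.2 (key j hj)) (hinc i j hij)

end Node

open Node

/-! ### New nodes between the root and its successors -/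

section Insert

variable {𝓜 : Set Node}

/-- New nodes are inserted between the root of `C` and its immediate successors. -/
theorem exists_insert (hbot : ⊥ ∈ 𝓜) (hup : ∀ a ∈ 𝓜, Up a) {C : Set Node}
    (hC : WTree 𝓜 C) (hCl : IsLeast C ⊥) (hCne : C ≠ {⊥}) (hCM : C ⊆ 𝓜)
    (hconv : ∀ ρ ∈ 𝓜, ρ ≠ ⊥ → {ν ∈ suc C ⊥ | ¬ Incompat ρ ν}.Finite) :
    ∃ (N : ℕ → Node) (D : Set Node), (∀ k, Up (N k)) ∧ (∀ k, N k ∉ 𝓜) ∧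
      (∀ ν ∈ 𝓜, ν ≠ ⊥ → ∀ A, (∀ a ∈ A, ν ≤ a) → Pos 𝓜 ν A → Pos (𝓜 ∪ range N) ν A) ∧
      WTree (𝓜 ∪ range N) D ∧ IsLeast D ⊥ ∧ D ≠ {⊥} ∧ D ⊆ 𝓜 ∪ range N ∧ suc D ⊥ = range N ∧
      Le' C D ∧ (∀ k, {ρ ∈ suc C ⊥ | N k ≤ ρ}.Infinite) ∧
      ∀ k, ∃ T ⊆ 𝓜 ∪ range N, WTree (𝓜 ∪ range N) T ∧ IsLeast T (N k) ∧ T ≠ {N k} := by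
  have hinf : (suc C ⊥).Infinite := (hC.pos ⊥ hCl.1 (IsLeast.not_mem_maxs hCl hCne)).infinite
  have hcount : (suc C ⊥).Countable := hC.countable.mono suc_subset
  have : Countable (suc C ⊥) := hcount.to_subtype
  have : Infinite (suc C ⊥) := hinf.to_subtype
  obtain ⟨e⟩ : Nonempty (ℕ ≃ suc C ⊥) := by
    obtain ⟨_⟩ := nonempty_denumerable (suc C ⊥)
    exact ⟨(Denumerable.eqv _).symm⟩
  -- The root successors of `C`, split into infinitely many infinite blocks `f k`.
  let f : ℕ → ℕ → Node := fun k i => (e (Nat.pair k i)).1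
  have hfs : ∀ k i, f k i ∈ suc C ⊥ := fun k i => (e (Nat.pair k i)).2
  have hfsurj : ∀ ν ∈ suc C ⊥, ∃ k i, f k i = ν := fun ν hν => by
    obtain ⟨n, hn⟩ := e.surjective ⟨ν, hν⟩
    refine ⟨n.unpair.1, n.unpair.2, ?_⟩
    simp only [f, Nat.pair_unpair, hn]
  have hfinj : ∀ k i k' i', f k i = f k' i' → k = k' ∧ i = i' := fun k i k' i' h => by
    have := e.injective (Subtype.ext h)
    exact Nat.pair_eq_pair.1 this
  have hfinc : ∀ k i k' i', ¬ (k = k' ∧ i = i') → Incompat (f k i) (f k' i') :=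
    fun k i k' i' h => hC.suc_incompat (hfs k i) (hfs k' i') fun h' => h (hfinj _ _ _ _ h')
  have hfM : ∀ k i, f k i ∈ 𝓜 := fun k i => hCM (hfs k i).1
  have hfb : ∀ k i, f k i ≠ ⊥ := fun k i => (hfs k i).2.1.ne'
  let N : ℕ → Node := fun k => Node.union (f k)
  have hNle : ∀ k i, N k ≤ f k i := fun k i => union_le (f k) i
  have hfin1 : ∀ ρ ∈ 𝓜, ρ ≠ ⊥ → ∀ k, {i | ¬ Incompat ρ (f k i)}.Finite := fun ρ hρ hne k => by
    refine Finite.of_finite_image ((hconv ρ hρ hne).subset ?_) (f := f k)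
      fun i _ j _ hij => (hfinj _ _ _ _ hij).2
    rintro _ ⟨i, hi, rfl⟩
    exact ⟨hfs k i, hi⟩
  have hfin2 : ∀ ρ ∈ 𝓜, ρ ≠ ⊥ → {k | ¬ Incompat ρ (N k)}.Finite := fun ρ hρ hne => by
    have hex : ∀ k, ¬ Incompat ρ (N k) → ∃ i, ¬ Incompat ρ (f k i) := fun k hk => by
      by_contra! h
      exact hk (union_incompat.2 fun i => (h i).symm).symm
    choose! i hi using hex
    refine Finite.of_finite_image ((hconv ρ hρ hne).subset ?_) (f := fun k => f k (i k))
      fun k _ j _ hij => (hfinj _ _ _ _ hij).1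
    rintro _ ⟨k, hk, rfl⟩
    exact ⟨hfs _ _, hi k hk⟩
  -- An old node other than `⊥` is compatible with only finitely many root successors of `C`,
  -- whereas `N k` is compatible with its whole block.
  have hNnew : ∀ k, N k ∉ 𝓜 := fun k hk => by
    by_cases hb : N k = ⊥
    · have h1 : Incompat (f (k + 1) 0) (N k) :=
        (union_incompat.2 fun i => hfinc _ _ _ _ (by omega)).symm
      rw [hb] at h1
      exact not_incompat_of_le le_rfl bot_le h1
    · refine (hfin1 _ hk hb k).not_infinite ?_
      convert infinite_univ (α := ℕ)
      exact eq_univ_of_forall fun i => not_incompat_of_le (hNle k i) le_rfl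
  have hNb : ∀ k, N k ≠ ⊥ := fun k h => hNnew k (h ▸ hbot)
  have hNinc : ∀ i j, i ≠ j → Incompat (N i) (N j) := fun i j hij =>
    union_incompat.2 fun a => (union_incompat.2 fun b => hfinc _ _ _ _ fun h => hij h.1.symm).symm
  have hpres : ∀ ν ∈ 𝓜, ν ≠ ⊥ → ∀ A, (∀ a ∈ A, ν ≤ a) → Pos 𝓜 ν A →
      Pos (𝓜 ∪ range N) ν A := by
    intro ν hν hne A hA hpos F hF hfin hFν
    -- The root successors of `C` inside `ρ` that are compatible with `ν`, finite in number by
    -- convergence. The others are incompatible with everything above `ν`, so avoiding `ρ` above `ν`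
    -- amounts to avoiding the old nodes in `K ρ`.
    let K : Node → Set Node := fun ρ => {x | ∃ k i, N k = ρ ∧ f k i = x ∧ ¬ Incompat ν x}
    have hK : ∀ ρ, (K ρ).Finite := fun ρ => (hconv ν hν hne).subset (by
      rintro _ ⟨k, i, -, rfl, h⟩
      exact ⟨hfs k i, h⟩)
    refine (hpos ((F ∩ 𝓜) ∪ ⋃ ρ ∈ F, K ρ) ?_ ?_ ?_).mono ?_
    · refine union_subset inter_subset_right (iUnion₂_subset ?_)
      rintro ρ _ _ ⟨k, i, -, rfl, -⟩
      exact hfM k i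
    · exact (hfin.subset inter_subset_left).union (hfin.biUnion fun ρ _ => hK ρ)
    · rintro x (hx | hx)
      · exact hFν x hx.1
      · simp only [mem_iUnion] at hx
        obtain ⟨ρ, hρ, k, i, rfl, rfl, -⟩ := hx
        exact fun h => hFν _ hρ ((hNle k i).trans h)
    · rintro a ⟨ha, hinc⟩
      refine ⟨ha, fun ρ hρ => ?_⟩
      rcases hF hρ with h | ⟨k, rfl⟩
      · exact hinc ρ (Or.inl ⟨hρ, h⟩)
      · refine union_incompat.2 fun i => ?_
        by_cases hi : Incompat ν (f k i)
        · exact hi.symm.mono le_rfl (hA a ha)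
        · exact hinc _ (Or.inr (mem_biUnion hρ ⟨k, i, rfl, rfl, hi⟩))
  have hT1 : ∀ k, Graftable (𝓜 ∪ range N) (N k) (f k) (fun i => above C (f k i)) := by
    intro k
    refine ⟨fun i => ?_, fun i => isLeast_above (hfs k i).1, fun i => ?_,
      fun i j hij => hfinc _ _ _ _ fun h => hij h.2, ?_⟩
    · have hW := wTree_above hC (hfs k i).1
      refine { hW with pos := fun ν hν hm => ?_ }
      exact hpres ν (hCM hν.1) (((hfs k i).2.1.trans_le hν.2).ne') _
        (fun a ha => ha.2.1.le) (hW.pos ν hν hm)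
    · refine lt_of_le_of_ne (hNle k i) fun h => ?_
      exact hNnew k (h ▸ hfM k i)
    · rintro ρ (hρ | ⟨j, rfl⟩) hle
      · exact hfin1 ρ hρ (fun h => hle (h ▸ bot_le)) k
      · convert finite_empty
        rw [eq_empty_iff_forall_notMem]
        refine fun i hi => hi ?_
        exact (hNinc j k fun h => hle (h ▸ le_rfl)).mono le_rfl (hNle k i)
  have hT2 : Graftable (𝓜 ∪ range N) ⊥ N
      (fun k => graft (N k) fun i => above C (f k i)) := by
    refine ⟨fun k => (hT1 k).wTree, fun k => (hT1 k).isLeast,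
      fun k => bot_lt_iff_ne_bot.2 (hNb k), hNinc, ?_⟩
    rintro ρ (hρ | ⟨j, rfl⟩) hle
    · exact hfin2 ρ hρ fun h => hle h.le
    · refine (finite_singleton j).subset fun k hk => ?_
      by_contra hne
      exact hk (hNinc j k fun h => hne h.symm)
  have hTM : ∀ k, (graft (N k) fun i => above C (f k i)) ⊆ 𝓜 ∪ range N := by
    rintro k b (rfl | ⟨i, hi⟩)
    · exact Or.inr ⟨k, rfl⟩
    · exact Or.inl (hCM hi.1)
  have hCD : C ⊆ graft ⊥ fun k => graft (N k) fun i => above C (f k i) := by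
    intro b hb
    by_cases hb0 : b = ⊥
    · exact Or.inl hb0
    · obtain ⟨τ, hτ, hτb⟩ := hC.exists_suc hCl.1 hb (bot_lt_iff_ne_bot.2 hb0)
      obtain ⟨k, i, rfl⟩ := hfsurj τ hτ
      exact Or.inr ⟨k, Or.inr ⟨i, hb, hτb⟩⟩
  refine ⟨N, graft ⊥ fun k => graft (N k) fun i => above C (f k i),
    fun k => Up.union fun i => hup _ (hfM k i), hNnew, hpres, hT2.wTree, hT2.isLeast, ?_, ?_,
    hT2.suc_root, Le'.of_ext ⟨⊥, hT2.isLeast.1⟩ ⟨fun a ha _ _ _ _ => hCD ha, fun m hm => ?_⟩,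
    fun k => ?_, fun k => ⟨_, hTM k, (hT1 k).wTree, (hT1 k).isLeast, fun h => ?_⟩⟩
  · intro h
    have : N 0 ∈ graft ⊥ fun k => graft (N k) fun i => above C (f k i) :=
      Or.inr ⟨0, (hT2.least 0).1⟩
    rw [h] at this
    exact hNb 0 this
  · rintro b (rfl | ⟨k, hk⟩)
    · exact Or.inl hbot
    · exact hTM k hk
  · rcases hm.1 with rfl | ⟨k, hk⟩
    · exact absurd hm hT2.root_not_mem_maxs
    · have hm' := (hT2.mem_maxs hk).1 hm
      rcases hk with rfl | ⟨i, hi⟩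
      · exact absurd hm' (hT1 k).root_not_mem_maxs
      · exact ⟨m, ⟨hi.1, fun x hx => hm.2 x (hCD hx)⟩, hm.1, le_rfl⟩
  · refine (infinite_range_of_injective (f := f k) fun i j hij => (hfinj _ _ _ _ hij).2).mono ?_
    rintro _ ⟨i, rfl⟩
    exact ⟨hfs k i, hNle k i⟩
  · have : f k 0 ∈ graft (N k) fun i => above C (f k i) := Or.inr ⟨0, ((hT1 k).least 0).1⟩
    rw [h] at this
    exact hNnew k (mem_singleton_iff.1 this ▸ hfM k 0)

end Insert

end CWT

/-! ### One stage of the construction -/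

namespace CWT

open Node

/-- The nodes `N k` and the trees `C`, `D` are a valid continuation of the nodes `𝓜` and the
trees `𝓢`: `C` bounds `𝓢` and uses the tasks, the nodes `N k` are placed below the immediate
successors of the root in `C`, and `D` canonizes `v` on `Y`. -/
structure IsStage (𝓜 : Set Node) (𝓢 : Set (Set Node)) (v : Node → Set Node) (Y : Set Node)
    (tasks : Set (Set Node × Set Node)) (N : ℕ → Node) (C D : Set Node) : Prop where
  up : ∀ k, Up (N k)
  new : ∀ k, N k ∉ 𝓜
  pres : ∀ ν ∈ 𝓜, ν ≠ ⊥ → ∀ A, (∀ a ∈ A, ν ≤ a) → Pos 𝓜 ν A → Pos (𝓜 ∪ range N) ν A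
  treeC : WTree 𝓜 C
  leastC : IsLeast C ⊥
  neC : C ≠ {⊥}
  subC : C ⊆ 𝓜
  treeD : WTree (𝓜 ∪ range N) D
  leastD : IsLeast D ⊥
  neD : D ≠ {⊥}
  subD : D ⊆ 𝓜 ∪ range N
  sucD : suc D ⊥ ⊆ range N
  bound : ∀ B ∈ 𝓢, Le' B C
  le : Le' C D
  inf : ∀ k, {ρ ∈ suc C ⊥ | N k ≤ ρ}.Infinite
  node : ∀ k, ∃ T ⊆ 𝓜 ∪ range N, WTree (𝓜 ∪ range N) T ∧ IsLeast T (N k) ∧ T ≠ {N k}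
  canon : (∃ B ∈ 𝓢, Alm B Y) → Covers D Y ∧ ∃ Z ⊆ D, IsAntichain (· ≤ ·) Z ∧ Covers D Z ∧
    ∀ η ∈ Y ∩ D, ∀ μ ∈ Y ∩ D, (v η = v μ ↔ ∃ ρ ∈ Z, ρ ≤ η ∧ ρ ≤ μ)
  dense : (∀ B ∈ 𝓢, ∃ p ∈ tasks, IsTask 𝓜 B p.1 p.2) →
    ∀ ν ∈ suc C ⊥, ∃ p ∈ tasks, ν ∈ p.2 ∧ Sb (above p.1 ν) (above C ν)

theorem PSub.ne_singleton {M : Type*} [PartialOrder M] {𝓜 B G : Set M} {r : M}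
    (h : PSub 𝓜 B G) (hr : IsLeast B r) (hr' : r ∈ G) (hne : B ≠ {r}) : G ≠ {r} := by
  intro hG
  obtain ⟨τ, hτ⟩ := (h.pos r hr' (IsLeast.not_mem_maxs hr hne)).infinite.nonempty
  rw [hG] at hτ
  exact hτ.1.2.1.ne hτ.2.symm

theorem exists_stage {𝓜 : Set Node} {𝓢 : Set (Set Node)} (h𝓜 : 𝓜.Countable) (hbot : ⊥ ∈ 𝓜)
    (hup : ∀ a ∈ 𝓜, Up a) (hc : 𝓢.Countable) (hne : 𝓢.Nonempty) (htree : ∀ B ∈ 𝓢, WTree 𝓜 B)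
    (hl : ∀ B ∈ 𝓢, IsLeast B ⊥) (hn : ∀ B ∈ 𝓢, B ≠ {⊥}) (hsub : ∀ B ∈ 𝓢, B ⊆ 𝓜)
    (htot : ∀ B ∈ 𝓢, ∀ B' ∈ 𝓢, Le' B B' ∨ Le' B' B) (v : Node → Set Node) (Y : Set Node)
    (tasks : Set (Set Node × Set Node)) : ∃ N C D, IsStage 𝓜 𝓢 v Y tasks N C D := by
  obtain ⟨S, hS, hSle, hScof⟩ := exists_cofinal_seq hc hne htree hl htot
  -- The default task, used when the guess is useless: the tree itself with all its root successors.
  have htask : ∀ B ∈ 𝓢, IsTask 𝓜 B B (suc B ⊥) := fun B hB =>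
    ⟨htree B hB, hl B hB, hsub B hB, Le'.refl ⟨⊥, (hl B hB).1⟩, Subset.rfl, fun F h1 h2 h3 => by
      obtain ⟨σ, h4, h5⟩ := ((htree B hB).pos ⊥ (hl B hB).1
        (IsLeast.not_mem_maxs (hl B hB) (hn B hB)) F h1 h2
        fun ρ hρ h => h3 (le_bot_iff.1 h ▸ hρ)).nonempty
      exact ⟨σ, h4, h5⟩⟩
  have hp : ∃ p : ℕ → Set Node × Set Node, (∀ n, IsTask 𝓜 (S n) (p n).1 (p n).2) ∧
      ((∀ B ∈ 𝓢, ∃ p ∈ tasks, IsTask 𝓜 B p.1 p.2) → ∀ n, p n ∈ tasks) := by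
    by_cases h : ∀ B ∈ 𝓢, ∃ p ∈ tasks, IsTask 𝓜 B p.1 p.2
    · choose! q hq hq' using h
      exact ⟨fun n => q (S n), fun n => hq' _ (hS n), fun _ n => hq _ (hS n)⟩
    · exact ⟨fun n => (S n, suc (S n) ⊥), fun n => htask _ (hS n), fun h' => absurd h' h⟩
  obtain ⟨p, hp1, hp2⟩ := hp
  obtain ⟨C, hC, hCl, hCne, hCM, hCle, hCs, hconv⟩ := exists_bound h𝓜 (fun k => htree _ (hS k))
    (fun k => hl _ (hS k)) (fun k => hn _ (hS k)) hSle hp1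
  obtain ⟨N, D, hNup, hNnew, hpres, hD, hDl, hDne, hDM, hDsuc, hCD, hinf, hnode⟩ :=
    exists_insert hbot hup hC hCl hCne hCM hconv
  have hbound : ∀ B ∈ 𝓢, Le' B C := fun B hB => by
    obtain ⟨n, h⟩ := hScof B hB
    exact h.trans (htree B hB) (htree _ (hS n)) hC (hl _ (hS n)) hCl (hCle n)
  have hdense : (∀ B ∈ 𝓢, ∃ p ∈ tasks, IsTask 𝓜 B p.1 p.2) →
      ∀ ν ∈ suc C ⊥, ∃ p ∈ tasks, ν ∈ p.2 ∧ Sb (above p.1 ν) (above C ν) := fun h ν hν => by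
    obtain ⟨n, h1⟩ := hCs ν hν
    exact ⟨p n, hp2 h n, h1⟩
  -- A guessed almost front of an earlier tree is still one of the new tree, so canonization applies
  -- on an exhaustive subtree that it covers.
  by_cases hY : ∃ B ∈ 𝓢, Alm B Y
  · obtain ⟨B, hB, hBY⟩ := hY
    have hD' := hD.mono (subset_union_left (s := 𝓜))
    have hDY := hCD.alm hC hD' hCl hDl ((hbound B hB).alm (htree B hB) hC (hl B hB) hCl hBY)
    obtain ⟨hYa, D', hs, hcov⟩ := hDY
    have hsT := hs.wTree hD
    have hsl := hs.isLeast hDl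
    obtain ⟨G, Z, hG, hGl, hZG, hZ, hZc, hcan⟩ := exists_canonical
      (h𝓜.union (countable_range N)) hsT hsl (hYa.subset (inter_subset_left (t := D')))
      inter_subset_right (fun m hm => by
        obtain ⟨y, hy, hyD, hym⟩ := hcov m hm
        exact ⟨y, ⟨hy, hyD⟩, hyD, hym⟩) v
    have hDG := (hs.pSub hD).trans hG
    refine ⟨N, C, G, hNup, hNnew, hpres, hC, hCl, hCne, hCM, hDG.wTree hD, hGl,
      hDG.ne_singleton hDl hGl.1 hDne, hDG.subset.trans hDM, ?_, hbound, ?_, hinf, hnode,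
      fun _ => ⟨fun m hm => ?_, Z, hZG, hZ, hZc, fun η hη μ hμ =>
        hcan η ⟨⟨hη.1, hG.subset hη.2⟩, hη.2⟩ μ ⟨⟨hμ.1, hG.subset hμ.2⟩, hμ.2⟩⟩, hdense⟩
    · rw [hDG.suc_eq hGl.1, hDsuc]; exact inter_subset_left
    · exact hCD.trans hC hD' ((hDG.wTree hD).mono subset_union_left) hDl hGl
        (Le'.of_ext ⟨⊥, hGl.1⟩ (hDG.ext hDl hGl.1))
    · rw [hG.maxs_eq] at hm
      obtain ⟨y, hy, hyD, hym⟩ := hcov m hm.1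
      exact ⟨y, hy, hG.convex y hyD ⊥ hGl.1 m hm.2 bot_le hym, hym⟩
  · exact ⟨N, C, D, hNup, hNnew, hpres, hC, hCl, hCne, hCM, hD, hDl, hDne, hDM, hDsuc.le, hbound,
      hCD, hinf, hnode, fun h => absurd h hY, hdense⟩

/-- The value at `δ` is chosen by `epsilon` from the earlier values, padded with an arbitrary one;
`hcongr` makes the padding harmless. -/
theorem exists_of_forall_lt {Ω α : Type*} [LinearOrder Ω] [WellFoundedLT Ω] [Nonempty α]
    (R : Ω → (Ω → α) → α → Prop)
    (hcongr : ∀ δ d d' x, (∀ γ < δ, d γ = d' γ) → R δ d x → R δ d' x)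
    (hex : ∀ δ d, (∀ γ < δ, R γ d (d γ)) → ∃ x, R δ d x) : ∃ d, ∀ δ, R δ d (d δ) := by
  classical
  let ext : (δ : Ω) → ((γ : Ω) → γ < δ → α) → Ω → α := fun δ prev γ =>
    if h : γ < δ then prev γ h else Classical.arbitrary α
  let d : Ω → α := wellFounded_lt.fix fun δ prev => Classical.epsilon (R δ (ext δ prev))
  have hd : ∀ δ, d δ = Classical.epsilon (R δ (ext δ fun γ _ => d γ)) := fun δ =>
    wellFounded_lt.fix_eq _ δ
  have he : ∀ δ, ∀ γ < δ, d γ = ext δ (fun γ _ => d γ) γ := fun δ γ h => by simp [ext, h]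
  refine ⟨d, fun δ => ?_⟩
  induction δ using WellFoundedLT.induction with
  | ind δ ih =>
    obtain ⟨x, hx⟩ := hex δ d ih
    have := Classical.epsilon_spec (p := R δ (ext δ fun γ _ => d γ)) ⟨x, hcongr δ _ _ x (he δ) hx⟩
    rw [← hd] at this
    exact hcongr δ _ _ _ (fun γ h => (he δ γ h).symm) this

/-! ### The recursion along the guesses, and survival of trees -/

section Recursion

variable {Ω : Type} [LinearOrder Ω]

/-- The data of a stage: the new nodes and two trees. -/
abbrev Data : Type := (ℕ → Node) × Set Node × Set Node

/-- The nodes present after the stages in `I`. -/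
def nodes (d : Ω → Data) (I : Set Ω) : Set Node := range cone ∪ {x | ∃ γ ∈ I, ∃ k, (d γ).1 k = x}

/-- The tree of height one on the root. -/
def baseTree : Set Node := graft ⊥ fun n => {cone ([] ++ [n])}

/-- The trees present before stage `δ`. -/
def prevTrees (d : Ω → Data) (δ : Ω) : Set (Set Node) :=
  {B | B = baseTree ∨ ∃ γ < δ, (d γ).2.2 = B}

/-- The index set for names of nodes. -/
abbrev Name (Ω : Type) : Type := Ω × (ℕ ⊕ List ℕ)

/-- The node with a given name. -/
def node (d : Ω → Data) (p : Name Ω) : Node := p.2.elim (d p.1).1 cone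

/-- The function on nodes guessed at stage `δ`. -/
def guessFun (S : Set (Name Ω × Name Ω)) (d : Ω → Data) (δ : Ω) (x : Node) : Set Node :=
  {y | ∃ p q : Name Ω, p.1 < δ ∧ q.1 < δ ∧ node d p = x ∧ node d q = y ∧ (p, q) ∈ S}

/-- A set of nodes guessed at stage `δ`. -/
def guessSet (S : Set (Name Ω × Name Ω)) (d : Ω → Data) (δ γ : Ω) (i : ℕ) : Set Node :=
  {y | ∃ q : Name Ω, q.1 < δ ∧ node d q = y ∧ ((γ, Sum.inl i), q) ∈ S}

/-- The condition on the data of stage `δ`. -/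
def StageAt (S : Ω → Set (Name Ω × Name Ω)) (δ : Ω) (d : Ω → Data) (x : Data) : Prop :=
  IsStage (nodes d (Iio δ)) (prevTrees d δ) (guessFun (S δ) d δ) {y | y ∈ guessFun (S δ) d δ y}
    {p | ∃ γ < δ, p = (guessSet (S δ) d δ γ 0, guessSet (S δ) d δ γ 1)} x.1 x.2.1 x.2.2

variable {S : Ω → Set (Name Ω × Name Ω)} {d : Ω → Data} {I : Set Ω} {γ δ ε : Ω}

theorem node_congr {d' : Ω → Data} (h : ∀ γ < δ, d γ = d' γ) {p : Name Ω} (hp : p.1 < δ) :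
    node d p = node d' p := by
  simp only [node, h p.1 hp]

theorem stageAt_congr {d' : Ω → Data} {x : Data} (h : ∀ γ < δ, d γ = d' γ)
    (hx : StageAt S δ d x) : StageAt S δ d' x := by
  have h1 : nodes d (Iio δ) = nodes d' (Iio δ) := by
    unfold nodes
    congr 1
    ext x
    constructor <;> rintro ⟨γ, hγ, k, hk⟩ <;> refine ⟨γ, hγ, k, ?_⟩
    · rw [← h γ hγ, hk]
    · rw [h γ hγ, hk]
  have h2 : prevTrees d δ = prevTrees d' δ := by
    ext B
    refine or_congr Iff.rfl ⟨?_, ?_⟩ <;> rintro ⟨γ, hγ, hB⟩ <;> refine ⟨γ, hγ, ?_⟩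
    · rw [← h γ hγ, hB]
    · rw [h γ hγ, hB]
  have h3 : guessFun (S δ) d δ = guessFun (S δ) d' δ := by
    ext x y
    constructor <;> rintro ⟨p, q, hp, hq, h4, h5, h6⟩ <;> refine ⟨p, q, hp, hq, ?_, ?_, h6⟩
    · rw [← node_congr h hp, h4]
    · rw [← node_congr h hq, h5]
    · rw [node_congr h hp, h4]
    · rw [node_congr h hq, h5]
  have h4 : guessSet (S δ) d δ = guessSet (S δ) d' δ := by
    ext γ i y
    constructor <;> rintro ⟨q, hq, h4, h5⟩ <;> refine ⟨q, hq, ?_, h5⟩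
    · rw [← node_congr h hq, h4]
    · rw [node_congr h hq, h4]
  unfold StageAt at hx ⊢
  rwa [← h1, ← h2, ← h3, ← h4]

omit [LinearOrder Ω] in
theorem nodes_mono {I J : Set Ω} (h : I ⊆ J) : nodes d I ⊆ nodes d J :=
  union_subset_union_right _ fun _ ⟨γ, hγ, hx⟩ => ⟨γ, h hγ, hx⟩

theorem nodes_Iic : nodes d (Iio γ) ∪ range (d γ).1 = nodes d (Iic γ) := by
  apply Subset.antisymm
  · refine union_subset (nodes_mono fun _ h => (mem_Iio.1 h).le) ?_
    rintro _ ⟨k, rfl⟩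
    exact Or.inr ⟨γ, le_rfl, k, rfl⟩
  · rintro x (hx | ⟨ε, hε, k, rfl⟩)
    · exact Or.inl (Or.inl hx)
    · rcases (mem_Iic.1 hε).lt_or_eq with h | rfl
      · exact Or.inl (Or.inr ⟨ε, h, k, rfl⟩)
      · exact Or.inr ⟨k, rfl⟩

/-- Positivity is tested by finite sets, and these are complete at some stage; limits therefore need
no argument of their own. -/
theorem subset_nodes_of_finite {F : Set Node} (hF : F.Finite) (h : F ⊆ nodes d I) :
    F ⊆ range cone ∨ ∃ ε ∈ I, F ⊆ nodes d (Iic ε) := by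
  induction F, hF using Set.Finite.induction_on with
  | empty => exact Or.inl (empty_subset _)
  | @insert a F _ _ ih =>
    rw [insert_subset_iff] at h
    rcases ih h.2 with h1 | ⟨ε, hε, h1⟩ <;> rcases h.1 with h2 | ⟨γ, hγ, k, hk⟩
    · exact Or.inl (insert_subset h2 h1)
    · exact Or.inr ⟨γ, hγ, insert_subset (Or.inr ⟨γ, le_rfl, k, hk⟩)
        (h1.trans subset_union_left)⟩
    · exact Or.inr ⟨ε, hε, insert_subset (Or.inl h2) h1⟩
    · rcases le_total γ ε with h3 | h3
      · exact Or.inr ⟨ε, hε, insert_subset (Or.inr ⟨γ, h3, k, hk⟩) h1⟩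
      · exact Or.inr ⟨γ, hγ, insert_subset (Or.inr ⟨γ, le_rfl, k, hk⟩)
          (h1.trans (nodes_mono (Iic_subset_Iic.2 h3)))⟩

section Extend

variable [WellFoundedLT Ω] {𝓝 B A : Set Node} {ν : Node}

/-- Induction on the stage, each step being `pres`. Here `𝓝` stands for the nodes present when the
tree was made, so each stage is either absorbed in `𝓝` or later than it. -/
theorem pos_extend (hlow : IsLowerSet I) (hst : ∀ γ ∈ I, StageAt S γ d (d γ))
    (hcone : range cone ⊆ 𝓝) (h𝓝 : ∀ ε ∈ I, nodes d (Iic ε) ⊆ 𝓝 ∨ 𝓝 ⊆ nodes d (Iio ε))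
    (hν : ν ∈ 𝓝) (hne : ν ≠ ⊥) (hA : ∀ a ∈ A, ν ≤ a) (hpos : Pos 𝓝 ν A) :
    Pos (nodes d I) ν A := by
  have key : ∀ ε ∈ I, Pos (nodes d (Iic ε)) ν A := by
    intro ε
    induction ε using WellFoundedLT.induction with
    | ind ε ih =>
      intro hε
      rcases h𝓝 ε hε with h | h
      · exact hpos.of_subset h
      · have hlt : Pos (nodes d (Iio ε)) ν A := by
          intro F hF hfin hFν
          rcases subset_nodes_of_finite hfin hF with h1 | ⟨γ, hγ, h1⟩
          · exact hpos F (h1.trans hcone) hfin hFν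
          · exact ih γ hγ (hlow (mem_Iio.1 hγ).le hε) F h1 hfin hFν
        have := (hst ε hε).pres ν (h hν) hne A hA hlt
        rwa [nodes_Iic] at this
  intro F hF hfin hFν
  rcases subset_nodes_of_finite hfin hF with h1 | ⟨γ, hγ, h1⟩
  · exact hpos F (h1.trans hcone) hfin hFν
  · exact key γ hγ F h1 hfin hFν

/-- A tree of an early stage is a tree of the later stages. -/
theorem tree_extend (hlow : IsLowerSet I) (hst : ∀ γ ∈ I, StageAt S γ d (d γ))
    (hcone : range cone ⊆ 𝓝) (hB : WTree 𝓝 B) (hB𝓝 : B ⊆ 𝓝)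
    (h𝓝 : ∀ ε ∈ I, nodes d (Iic ε) ⊆ 𝓝 ∨
      𝓝 ⊆ nodes d (Iio ε) ∧ (⊥ ∈ B → Le' B (d ε).2.2)) : WTree (nodes d I) B := by
  refine { hB with pos := fun ν hν hm => ?_ }
  by_cases hne : ν = ⊥
  · subst hne
    intro F hF hfin hFν
    rcases subset_nodes_of_finite hfin hF with h1 | ⟨γ, hγ, h1⟩
    · exact hB.pos ⊥ hν hm F (h1.trans hcone) hfin hFν
    · rcases h𝓝 γ hγ with h2 | ⟨-, h2⟩
      · exact hB.pos ⊥ hν hm F (h1.trans h2) hfin hFν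
      -- At `⊥` the clause `pres` says nothing. But the tree of stage `γ` is positive for all nodes
      -- up to that stage, and `B` inherits this from its extension.
      · obtain ⟨B', hs, he⟩ := h2 hν
        have hD := (hst γ hγ).treeD
        rw [nodes_Iic] at hD
        have hB' := hs.wTree hD
        exact ((he.pos (hB.mono (empty_subset _)) (hB'.mono (empty_subset _))
          (hB'.pos ⊥ (hs.root_mem (hst γ hγ).leastD)) hν hm).mono inter_subset_left) F h1 hfin hFν
  · exact pos_extend hlow hst hcone (fun ε hε => (h𝓝 ε hε).imp_right And.left) (hB𝓝 hν) hne
      (fun a ha => ha.2.1.le) (hB.pos ν hν hm)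

theorem graftable_base : Graftable (range cone) ⊥ (fun n => cone ([] ++ [n]))
    (fun n => {cone ([] ++ [n])}) := cone_nil ▸ graftable_cone []

theorem baseTree_subset : baseTree ⊆ range cone := by
  rintro b (rfl | ⟨n, rfl⟩)
  · exact ⟨[], cone_nil⟩
  · exact ⟨_, rfl⟩

theorem baseTree_ne : baseTree ≠ {⊥} := fun h => by
  have := graftable_base.root_not_mem_maxs
  rw [show graft ⊥ (fun n => {cone ([] ++ [n])}) = {⊥} from h] at this
  exact this ⟨rfl, by rintro _ rfl; exact lt_irrefl _⟩

omit [WellFoundedLT Ω] in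
theorem StageAt.le_base (h : StageAt S δ d (d δ)) : Le' baseTree (d δ).2.2 := by
  have hle := h.bound _ (Or.inl rfl)
  -- Transitivity does not depend on positivity, so the trees, positive for different sets of nodes,
  -- are all compared over the empty set.
  exact hle.trans (graftable_base.wTree.mono (empty_subset _)) (h.treeC.mono (empty_subset _))
    (h.treeD.mono (empty_subset _)) h.leastC h.leastD h.le

omit [WellFoundedLT Ω] in
theorem StageAt.le_of_lt (h : StageAt S δ d (d δ)) (h' : StageAt S γ d (d γ)) (hlt : γ < δ) :
    Le' (d γ).2.2 (d δ).2.2 := by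
  have hle := h.bound _ (Or.inr ⟨γ, hlt, rfl⟩)
  exact hle.trans (h'.treeD.mono (empty_subset _)) (h.treeC.mono (empty_subset _))
    (h.treeD.mono (empty_subset _)) h.leastC h.leastD h.le

theorem tree_base (hlow : IsLowerSet I) (hst : ∀ γ ∈ I, StageAt S γ d (d γ)) :
    WTree (nodes d I) baseTree :=
  tree_extend hlow hst Subset.rfl graftable_base.wTree baseTree_subset
    fun ε hε => Or.inr ⟨subset_union_left, fun _ => (hst ε hε).le_base⟩

theorem tree_D (hlow : IsLowerSet I) (hst : ∀ γ ∈ I, StageAt S γ d (d γ)) (hγ : γ ∈ I) :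
    WTree (nodes d I) (d γ).2.2 := by
  have h := hst γ hγ
  have hD := h.treeD
  have hs := h.subD
  rw [nodes_Iic] at hD hs
  refine tree_extend hlow hst subset_union_left hD hs fun ε hε => ?_
  rcases le_or_gt ε γ with h1 | h1
  · exact Or.inl (nodes_mono (Iic_subset_Iic.2 h1))
  · exact Or.inr ⟨nodes_mono fun x hx => (mem_Iic.1 hx).trans_lt h1,
      fun _ => (hst ε hε).le_of_lt h h1⟩

theorem tree_C (hlow : IsLowerSet I) (hst : ∀ γ ∈ I, StageAt S γ d (d γ)) (hγ : γ ∈ I) :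
    WTree (nodes d I) (d γ).2.1 := by
  have h := hst γ hγ
  refine tree_extend hlow hst subset_union_left h.treeC h.subC fun ε hε => ?_
  rcases lt_or_ge ε γ with h1 | h1
  · exact Or.inl (nodes_mono fun x hx => (mem_Iic.1 hx).trans_lt h1)
  · refine Or.inr ⟨nodes_mono fun x hx => (mem_Iio.1 hx).trans_le h1, fun _ => ?_⟩
    rcases h1.eq_or_lt with rfl | h1
    · exact h.le
    · exact h.le.trans (h.treeC.mono (empty_subset _)) (h.treeD.mono (empty_subset _))
        ((hst ε hε).treeD.mono (empty_subset _)) h.leastD (hst ε hε).leastD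
        ((hst ε hε).le_of_lt h h1)

theorem exists_tree_of_ne_bot (hlow : IsLowerSet I) (hst : ∀ γ ∈ I, StageAt S γ d (d γ)) {η : Node}
    (hη : η ∈ nodes d I) (hne : η ≠ ⊥) :
    ∃ T ⊆ nodes d I, WTree (nodes d I) T ∧ IsLeast T η ∧ T ≠ {η} := by
  rcases hη with ⟨s, rfl⟩ | ⟨γ, hγ, k, rfl⟩
  · have hG := graftable_cone s
    have hb : ⊥ ∉ graft (cone s) (fun n => {cone (s ++ [n])}) := fun h =>
      hne (le_bot_iff.1 (hG.isLeast.2 h))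
    have hsub : graft (cone s) (fun n => {cone (s ++ [n])}) ⊆ range cone := by
      rintro b (rfl | ⟨n, rfl⟩) <;> exact ⟨_, rfl⟩
    refine ⟨_, hsub.trans subset_union_left, tree_extend hlow hst Subset.rfl hG.wTree hsub
      fun ε hε => Or.inr ⟨subset_union_left, fun h => absurd h hb⟩, hG.isLeast, fun h => ?_⟩
    have := hG.root_not_mem_maxs
    rw [h] at this
    exact this ⟨rfl, by rintro _ rfl; exact lt_irrefl _⟩
  · obtain ⟨T, hT, hW, hl, hn⟩ := (hst γ hγ).node k
    rw [nodes_Iic] at hT hW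
    refine ⟨T, hT.trans (nodes_mono fun ε hε => hlow (mem_Iic.1 hε) hγ), tree_extend hlow hst
      subset_union_left hW hT fun ε hε => ?_, hl, hn⟩
    rcases le_or_gt ε γ with h1 | h1
    · exact Or.inl (nodes_mono (Iic_subset_Iic.2 h1))
    · exact Or.inr ⟨nodes_mono fun x hx => (mem_Iic.1 hx).trans_lt h1,
        fun h => absurd (le_bot_iff.1 (hl.2 h)) hne⟩

omit [WellFoundedLT Ω] in
theorem up_of_mem_nodes (hst : ∀ γ ∈ I, StageAt S γ d (d γ)) {a : Node} (ha : a ∈ nodes d I) :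
    Up a := by
  rcases ha with ⟨s, rfl⟩ | ⟨γ, hγ, k, rfl⟩
  · exact up_cone s
  · exact (hst γ hγ).up k

omit [LinearOrder Ω] [WellFoundedLT Ω] in
theorem countable_nodes (hI : I.Countable) : (nodes d I).Countable := by
  have : nodes d I = range cone ∪ ⋃ γ ∈ I, range (d γ).1 := by
    ext x
    simp [nodes]
  rw [this]
  exact (countable_range _).union (hI.biUnion fun γ _ => countable_range _)

omit [LinearOrder Ω] [WellFoundedLT Ω] in
theorem bot_mem_nodes : ⊥ ∈ nodes d I := Or.inl ⟨[], cone_nil⟩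

theorem exists_stages (hcount : ∀ δ : Ω, (Iio δ).Countable) (S : Ω → Set (Name Ω × Name Ω)) :
    ∃ d : Ω → Data, ∀ δ, StageAt S δ d (d δ) := by
  refine exists_of_forall_lt (StageAt S) (fun δ d d' x h hx => stageAt_congr h hx) ?_
  intro δ d hst
  have hlow : IsLowerSet (Iio δ) := isLowerSet_Iio δ
  have hst' : ∀ γ ∈ Iio δ, StageAt S γ d (d γ) := hst
  obtain ⟨N, C, D, h⟩ := exists_stage (countable_nodes (d := d) (hcount δ)) bot_mem_nodes
    (fun a ha => up_of_mem_nodes hst' ha) (𝓢 := prevTrees d δ) (by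
      refine ((countable_singleton baseTree).union ((hcount δ).image fun γ => (d γ).2.2)).mono ?_
      rintro B (rfl | ⟨γ, hγ, rfl⟩)
      · exact Or.inl rfl
      · exact Or.inr ⟨γ, hγ, rfl⟩) ⟨baseTree, Or.inl rfl⟩ (by
      rintro B (rfl | ⟨γ, hγ, rfl⟩)
      · exact tree_base hlow hst'
      · exact tree_D hlow hst' hγ) (by
      rintro B (rfl | ⟨γ, hγ, rfl⟩)
      · exact graftable_base.isLeast
      · exact (hst γ hγ).leastD) (by
      rintro B (rfl | ⟨γ, hγ, rfl⟩)
      · exact baseTree_ne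
      · exact (hst γ hγ).neD) (by
      rintro B (rfl | ⟨γ, hγ, rfl⟩)
      · exact baseTree_subset.trans subset_union_left
      · have := (hst γ hγ).subD
        rw [nodes_Iic] at this
        exact this.trans (nodes_mono fun x hx => (mem_Iic.1 hx).trans_lt hγ)) (by
      rintro B (rfl | ⟨γ, hγ, rfl⟩) B' (rfl | ⟨γ', hγ', rfl⟩)
      · exact Or.inl (Le'.refl ⟨⊥, graftable_base.isLeast.1⟩)
      · exact Or.inl (hst γ' hγ').le_base
      · exact Or.inr (hst γ hγ).le_base
      · rcases lt_trichotomy γ γ' with h | rfl | h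
        · exact Or.inl ((hst γ' hγ').le_of_lt (hst γ hγ) h)
        · exact Or.inl (Le'.refl ⟨⊥, (hst γ hγ).leastD.1⟩)
        · exact Or.inr ((hst γ hγ).le_of_lt (hst γ' hγ') h)) _ _ _
  exact ⟨(N, C, D), h⟩

end Extend

end Recursion

end CWT

/-! ### Transfer along an embedding that respects incompatibility -/

namespace CWT

section Embedding

variable {M P : Type*} [PartialOrder M] [PartialOrder P] (f : M ↪o P) {A B B' B₁ B₂ X Y : Set M}
  {ν r : M}

theorem suc_image : suc (f '' B) (f ν) = f '' suc B ν := by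
  ext x
  constructor
  · rintro ⟨⟨τ, hτ, rfl⟩, h2, h3⟩
    exact ⟨τ, ⟨hτ, f.lt_iff_lt.1 h2, fun ⟨ρ, h4, h5, h6⟩ =>
      h3 ⟨f ρ, ⟨ρ, h4, rfl⟩, f.lt_iff_lt.2 h5, f.lt_iff_lt.2 h6⟩⟩, rfl⟩
  · rintro ⟨τ, ⟨h1, h2, h3⟩, rfl⟩
    refine ⟨⟨τ, h1, rfl⟩, f.lt_iff_lt.2 h2, ?_⟩
    rintro ⟨_, ⟨ρ, h4, rfl⟩, h5, h6⟩
    exact h3 ⟨ρ, h4, f.lt_iff_lt.1 h5, f.lt_iff_lt.1 h6⟩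

theorem mem_image_emb {a : M} : f a ∈ f '' B ↔ a ∈ B := f.injective.mem_set_image

theorem maxs_image : maxs (f '' B) = f '' maxs B := by
  ext x
  constructor
  · rintro ⟨⟨m, hm, rfl⟩, h⟩
    exact ⟨m, ⟨hm, fun a ha hlt => h (f a) ⟨a, ha, rfl⟩ (f.lt_iff_lt.2 hlt)⟩, rfl⟩
  · rintro ⟨m, ⟨hm, h⟩, rfl⟩
    refine ⟨⟨m, hm, rfl⟩, ?_⟩
    rintro _ ⟨a, ha, rfl⟩ hlt
    exact h a ha (f.lt_iff_lt.1 hlt)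

theorem above_image : above (f '' B) (f ν) = f '' above B ν := by
  ext x
  constructor
  · rintro ⟨⟨m, hm, rfl⟩, h⟩
    exact ⟨m, ⟨hm, f.le_iff_le.1 h⟩, rfl⟩
  · rintro ⟨m, ⟨hm, h⟩, rfl⟩
    exact ⟨⟨m, hm, rfl⟩, f.le_iff_le.2 h⟩

theorem isLeast_image : IsLeast (f '' B) (f r) ↔ IsLeast B r := by
  simp only [IsLeast, mem_image_emb, lowerBounds, mem_ofPred_eq, forall_mem_image, f.le_iff_le]

theorem isChain_image : IsChain (· ≤ ·) (f '' B) ↔ IsChain (· ≤ ·) B := by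
  simp only [IsChain, Set.Pairwise, forall_mem_image, f.le_iff_le, ne_eq, f.injective.eq_iff]

theorem isAntichain_image : IsAntichain (· ≤ ·) (f '' B) ↔ IsAntichain (· ≤ ·) B := by
  simp only [IsAntichain, Set.Pairwise, forall_mem_image, ne_eq, f.injective.eq_iff, Pi.compl_apply,
    compl_iff_not, f.le_iff_le]

theorem sb_image : Sb (f '' B) (f '' B') ↔ Sb B B' := by
  have h1 : ∀ ν, (suc (f '' B) (f ν) \ f '' B').Finite ↔ (suc B ν \ B').Finite := fun ν => by
    rw [suc_image, ← image_sdiff f.injective, finite_image_iff f.injective.injOn]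
  constructor
  · rintro ⟨h2, h3, h4, h5⟩
    refine ⟨(image_subset_image_iff f.injective).1 h2, fun a ha b hb hab => ?_, h4.of_image,
      fun ν hν => (h1 ν).1 (h5 _ ⟨ν, hν, rfl⟩)⟩
    exact (mem_image_emb f).1 (h3 _ ⟨a, ha, rfl⟩ _ ⟨b, hb, rfl⟩ (f.le_iff_le.2 hab))
  · rintro ⟨h2, h3, h4, h5⟩
    refine ⟨image_mono h2, ?_, h4.image f, ?_⟩
    · rintro _ ⟨a, ha, rfl⟩ _ ⟨b, hb, rfl⟩ hab
      exact ⟨a, h3 a ha b hb (f.le_iff_le.1 hab), rfl⟩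
    · rintro _ ⟨ν, hν, rfl⟩
      exact (h1 ν).2 (h5 ν hν)

theorem ext_image : Ext (f '' B₁) (f '' B₂) ↔ Ext B₁ B₂ := by
  constructor
  · rintro ⟨h1, h2⟩
    refine ⟨fun a ha b hb hb2 hab => ?_, fun m hm => ?_⟩
    · exact (mem_image_emb f).1 (h1 _ ⟨a, ha, rfl⟩ _ ⟨b, hb, rfl⟩ ⟨b, hb2, rfl⟩ (f.le_iff_le.2 hab))
    · obtain ⟨_, h3, h4, h5⟩ := h2 (f m) (by rw [maxs_image]; exact ⟨m, hm, rfl⟩)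
      rw [maxs_image] at h3
      obtain ⟨y, hy, rfl⟩ := h3
      exact ⟨y, hy, (mem_image_emb f).1 h4, f.le_iff_le.1 h5⟩
  · rintro ⟨h1, h2⟩
    refine ⟨?_, fun m hm => ?_⟩
    · rintro _ ⟨a, ha, rfl⟩ _ ⟨b, hb, rfl⟩ hb2 hab
      exact ⟨a, h1 a ha b hb ((mem_image_emb f).1 hb2) (f.le_iff_le.1 hab), rfl⟩
    · rw [maxs_image] at hm ⊢
      obtain ⟨m, hm, rfl⟩ := hm
      obtain ⟨y, h3, h4, h5⟩ := h2 m hm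
      exact ⟨f y, ⟨y, h3, rfl⟩, ⟨y, h4, rfl⟩, f.le_iff_le.2 h5⟩

theorem le'_image : Le' (f '' B₁) (f '' B₂) ↔ Le' B₁ B₂ := by
  constructor
  · rintro ⟨C, hs, he⟩
    obtain ⟨C, -, rfl⟩ := subset_image_iff.1 hs.subset
    exact ⟨C, (sb_image f).1 hs, (ext_image f).1 he⟩
  · rintro ⟨C, hs, he⟩
    exact ⟨f '' C, (sb_image f).2 hs, (ext_image f).2 he⟩

theorem covers_image : Covers (f '' B) (f '' X) ↔ Covers B X := by
  simp only [Covers, maxs_image, forall_mem_image, exists_mem_image, mem_image_emb, f.le_iff_le]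

theorem alm_image : Alm (f '' B) (f '' Y) ↔ Alm B Y := by
  refine and_congr (isAntichain_image f) ⟨?_, ?_⟩
  · rintro ⟨C, hs, he⟩
    obtain ⟨C, -, rfl⟩ := subset_image_iff.1 hs.subset
    exact ⟨C, (sb_image f).1 hs, (covers_image f).1 he⟩
  · rintro ⟨C, hs, he⟩
    exact ⟨f '' C, (sb_image f).2 hs, (covers_image f).2 he⟩

variable (hf : ∀ a b, Incompat (f a) (f b) ↔ Incompat a b)
include hf

theorem pos_image : Pos (range f) (f ν) (f '' A) ↔ Pos univ ν A := by
  have key : ∀ F : Set M, {σ ∈ f '' A | ∀ ρ ∈ f '' F, Incompat ρ σ} =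
      f '' {σ ∈ A | ∀ ρ ∈ F, Incompat ρ σ} := fun F => by
    ext x
    constructor
    · rintro ⟨⟨a, ha, rfl⟩, h⟩
      exact ⟨a, ⟨ha, fun ρ hρ => (hf _ _).1 (h _ ⟨ρ, hρ, rfl⟩)⟩, rfl⟩
    · rintro ⟨a, ⟨ha, h⟩, rfl⟩
      refine ⟨⟨a, ha, rfl⟩, ?_⟩
      rintro _ ⟨ρ, hρ, rfl⟩
      exact (hf _ _).2 (h ρ hρ)
  constructor
  · intro h F _ hfin hF
    have := h (f '' F) (image_subset_range f F) (hfin.image f) (by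
      rintro _ ⟨ρ, hρ, rfl⟩
      rw [f.le_iff_le]
      exact hF ρ hρ)
    rw [key] at this
    exact this.of_image f
  · intro h F hFr hfin hF
    obtain ⟨F, rfl⟩ := subset_range_iff_exists_image_eq.1 hFr
    rw [key]
    refine (h F (subset_univ _) (hfin.of_finite_image f.injective.injOn) fun ρ hρ => ?_).image
      f.injective.injOn
    have := hF _ ⟨ρ, hρ, rfl⟩
    rwa [f.le_iff_le] at this

theorem wTree_image : WTree (range f) (f '' B) ↔ WTree univ B := by
  constructor
  · intro h
    refine ⟨countable_of_injective_of_countable_image f.injective.injOn h.countable, ?_, fun a ha b hb h1 h2 => ?_,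
      fun C hC hch => ?_, fun ν hν hm => ?_⟩
    · obtain ⟨x, hx⟩ := h.exists_root
      obtain ⟨r, -, rfl⟩ := hx.1
      exact ⟨r, (isLeast_image f).1 hx⟩
    · refine (hf a b).1 (h.incompat _ ⟨a, ha, rfl⟩ _ ⟨b, hb, rfl⟩ ?_ ?_) <;> rwa [f.le_iff_le]
    · exact (h.chain_finite _ (image_mono hC) ((isChain_image f).2 hch)).of_finite_image
        f.injective.injOn
    · rw [← pos_image f hf, ← suc_image]
      exact h.pos _ ⟨ν, hν, rfl⟩ (by rwa [maxs_image, mem_image_emb])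
  · intro h
    refine ⟨h.countable.image f, ?_, ?_, fun C hC hch => ?_, ?_⟩
    · obtain ⟨r, hr⟩ := h.exists_root
      exact ⟨f r, (isLeast_image f).2 hr⟩
    · rintro _ ⟨a, ha, rfl⟩ _ ⟨b, hb, rfl⟩ h1 h2
      rw [f.le_iff_le] at h1 h2
      exact (hf a b).2 (h.incompat a ha b hb h1 h2)
    · obtain ⟨C, hC', rfl⟩ := subset_image_iff.1 hC
      exact (h.chain_finite C hC' ((isChain_image f).1 hch)).image f
    · rintro _ ⟨ν, hν, rfl⟩ hm
      rw [suc_image, pos_image f hf]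
      rw [maxs_image, mem_image_emb] at hm
      exact h.pos ν hν hm

end Embedding

/-- Two sequences of trees in `M`, `C δ ≤ D δ ≤ C ε` for `δ < ε`, that satisfy the genericity
conditions of the theorem. -/
structure IsFrame {Ω M : Type} [LinearOrder Ω] [PartialOrder M] [OrderBot M]
    (C D : Ω → Set M) : Prop where
  treeC : ∀ δ, WTree univ (C δ)
  leastC : ∀ δ, IsLeast (C δ) ⊥
  neC : ∀ δ, C δ ≠ {⊥}
  treeD : ∀ δ, WTree univ (D δ)
  leastD : ∀ δ, IsLeast (D δ) ⊥
  neD : ∀ δ, D δ ≠ {⊥}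
  bound : ∀ γ δ, γ < δ → Le' (D γ) (C δ)
  le : ∀ δ, Le' (C δ) (D δ)
  new : ∀ X : Set M, X.Countable → ∃ δ₀, ∀ δ > δ₀, X ∩ suc (D δ) ⊥ = ∅
  inf : ∀ δ, ∀ σ ∈ suc (D δ) ⊥, {ρ ∈ suc (C δ) ⊥ | σ ≤ ρ}.Infinite
  node : ∀ η : M, η ≠ ⊥ → ∃ T, WTree univ T ∧ IsLeast T η ∧ T ≠ {η}
  canon : ∀ Y : Set M, Y.Countable → ∀ γ, Alm (D γ) Y → ∀ (β : Type) (c : M → β), ∃ δ > γ,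
    Covers (D δ) Y ∧ ∃ Z ⊆ D δ, IsAntichain (· ≤ ·) Z ∧ Covers (D δ) Z ∧
      ∀ η ∈ Y ∩ D δ, ∀ μ ∈ Y ∩ D δ, (c η = c μ ↔ ∃ ρ ∈ Z, ρ ≤ η ∧ ρ ≤ μ)
  dense : ∀ W Z : Ω → Set M, (∀ γ, IsTask univ (D γ) (W γ) (Z γ)) → ∀ γ₀, ∃ δ > γ₀,
    ∀ ν ∈ suc (C δ) ⊥, ∃ γ, ν ∈ Z γ ∧ Sb (above (W γ) ν) (above (C δ) ν)

/-! ### From guesses to a frame -/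

open Node

variable {Ω : Type} [LinearOrder Ω] [WellFoundedLT Ω]

/-- A guessing sequence for sets of pairs of names. -/
def IsGuess (S : Ω → Set (Name Ω × Name Ω)) : Prop :=
  ∀ (A : Set (Name Ω × Name Ω)) (γ₀ : Ω) (g : Ω → Ω), ∃ δ > γ₀, (∀ γ < δ, g γ < δ) ∧
    ∀ p q : Name Ω, p.1 < δ → q.1 < δ → ((p, q) ∈ A ↔ (p, q) ∈ S δ)

theorem exists_frame [Nonempty Ω] (hcount : ∀ δ : Ω, (Iio δ).Countable)
    (hbdd : ∀ s : Set Ω, s.Countable → ∃ b, ∀ a ∈ s, a < b) {S : Ω → Set (Name Ω × Name Ω)}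
    (hS : IsGuess S) :
    ∃ (M : Type) (_ : PartialOrder M) (_ : OrderBot M) (C D : Ω → Set M), IsFrame C D := by
  obtain ⟨d, hd⟩ := exists_stages hcount S
  set 𝓜 : Set Node := nodes d univ with h𝓜
  have hlow : IsLowerSet (univ : Set Ω) := isLowerSet_univ
  have hst : ∀ γ ∈ (univ : Set Ω), StageAt S γ d (d γ) := fun γ _ => hd γ
  have hup : ∀ a ∈ 𝓜, Up a := fun a ha => up_of_mem_nodes hst ha
  let ob : OrderBot 𝓜 := { bot := ⟨⊥, bot_mem_nodes⟩, bot_le := fun a => (bot_le : (⊥ : Node) ≤ a.1) }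
  let f : 𝓜 ↪o Node := OrderEmbedding.subtype (· ∈ 𝓜)
  have hfb : f ⊥ = ⊥ := rfl
  have hrange : range f = 𝓜 := Subtype.range_coe
  have hinc : ∀ a b : 𝓜, Incompat (f a) (f b) ↔ Incompat a b := by
    intro a b
    rw [← not_iff_not]
    simp only [Incompat, not_not]
    constructor
    · rintro ⟨c, h1, h2⟩
      -- The bound `c` need not be in `𝓜`, but the cone of one of its sequences is, and it lies
      -- above both nodes because they are closed under end extension.
      obtain ⟨s, hs⟩ := c.2
      exact ⟨⟨cone s, Or.inl ⟨s, rfl⟩⟩, hup _ a.2 s (h1 hs), hup _ b.2 s (h2 hs)⟩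
    · rintro ⟨c, h1, h2⟩
      exact ⟨f c, f.le_iff_le.2 h1, f.le_iff_le.2 h2⟩
  have him : ∀ B ⊆ 𝓜, f '' (f ⁻¹' B) = B := fun B hB =>
    image_preimage_eq_of_subset (hrange.symm ▸ hB)
  have hCM : ∀ δ, (d δ).2.1 ⊆ 𝓜 := fun δ => (hd δ).subC.trans (nodes_mono (subset_univ _))
  have hDM : ∀ δ, (d δ).2.2 ⊆ 𝓜 := fun δ => by
    have := (hd δ).subD
    rw [nodes_Iic] at this
    exact this.trans (nodes_mono (subset_univ _))
  have hC : ∀ δ, (d δ).2.1 = f '' (f ⁻¹' (d δ).2.1) := fun δ => (him _ (hCM δ)).symm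
  have hD : ∀ δ, (d δ).2.2 = f '' (f ⁻¹' (d δ).2.2) := fun δ => (him _ (hDM δ)).symm
  -- every node of a countable set is named before some stage
  have hmem : ∀ a ∈ 𝓜, ∃ p : Name Ω, node d p = a := by
    rintro a (⟨s, rfl⟩ | ⟨γ, -, k, rfl⟩)
    · exact ⟨(Classical.arbitrary Ω, Sum.inr s), rfl⟩
    · exact ⟨(γ, Sum.inl k), rfl⟩
  have hnode : ∀ p : Name Ω, node d p ∈ 𝓜 := by
    rintro ⟨γ, k | s⟩
    · exact Or.inr ⟨γ, mem_univ _, k, rfl⟩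
    · exact Or.inl ⟨s, rfl⟩
  have hnodelt : ∀ δ, ∀ p : Name Ω, p.1 < δ → node d p ∈ nodes d (Iio δ) := by
    rintro δ ⟨γ, k | s⟩ h
    · exact Or.inr ⟨γ, h, k, rfl⟩
    · exact Or.inl ⟨s, rfl⟩
  choose! nm hnm using hmem
  have hearly : ∀ X : Set 𝓜, X.Countable → ∃ δ₀, ∀ a ∈ X, (nm (f a)).1 < δ₀ := by
    intro X hX
    obtain ⟨b, hb⟩ := hbdd ((fun a => (nm (f a)).1) '' X) (hX.image _)
    exact ⟨b, fun a ha => hb _ ⟨a, ha, rfl⟩⟩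
  have hfM : ∀ a, f a ∈ 𝓜 := fun a => a.2
  refine ⟨𝓜, inferInstance, ob, fun δ => f ⁻¹' (d δ).2.1, fun δ => f ⁻¹' (d δ).2.2, ?_⟩
  have tC : ∀ δ, WTree univ (f ⁻¹' (d δ).2.1) := fun δ => by
    rw [← wTree_image f hinc, ← hC, hrange]
    exact tree_C hlow hst (mem_univ δ)
  have tD : ∀ δ, WTree univ (f ⁻¹' (d δ).2.2) := fun δ => by
    rw [← wTree_image f hinc, ← hD, hrange]
    exact tree_D hlow hst (mem_univ δ)
  have lC : ∀ δ, IsLeast (f ⁻¹' (d δ).2.1) ⊥ := fun δ => by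
    rw [← isLeast_image f, ← hC]; exact (hd δ).leastC
  have lD : ∀ δ, IsLeast (f ⁻¹' (d δ).2.2) ⊥ := fun δ => by
    rw [← isLeast_image f, ← hD]; exact (hd δ).leastD
  refine ⟨tC, lC, fun δ h => (hd δ).neC ?_, tD, lD, fun δ h => (hd δ).neD ?_, fun γ δ h => ?_,
    fun δ => ?_, fun X hX => ?_, fun δ σ hσ => ?_, fun η hη => ?_, fun Y hY γ hYa β c => ?_,
    fun W Z hWZ γ₀ => ?_⟩
  · rw [hC, h, image_singleton, hfb]
  · rw [hD, h, image_singleton, hfb]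
  · rw [← le'_image f, ← hC, ← hD]
    exact (hd δ).bound _ (Or.inr ⟨γ, h, rfl⟩)
  · rw [← le'_image f, ← hC, ← hD]
    exact (hd δ).le
  · obtain ⟨δ₀, hδ₀⟩ := hearly X hX
    refine ⟨δ₀, fun δ hδ => ?_⟩
    rw [eq_empty_iff_forall_notMem]
    rintro a ⟨haX, ha⟩
    have h1 : f a ∈ suc (d δ).2.2 ⊥ := by
      rw [hD, ← hfb, suc_image]; exact ⟨a, ha, rfl⟩
    obtain ⟨k, hk⟩ := (hd δ).sucD h1
    refine (hd δ).new k ?_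
    rw [hk, ← hnm _ (hfM a)]
    exact hnodelt δ _ ((hδ₀ a haX).trans hδ)
  · have h1 : f σ ∈ suc (d δ).2.2 ⊥ := by
      rw [hD, ← hfb, suc_image]; exact ⟨σ, hσ, rfl⟩
    obtain ⟨k, hk⟩ := (hd δ).sucD h1
    have h2 := (hd δ).inf k
    rw [hk, hC, ← hfb, suc_image] at h2
    refine Infinite.of_image f (h2.mono ?_)
    rintro _ ⟨⟨ρ, hρ, rfl⟩, hle⟩
    exact ⟨ρ, ⟨hρ, f.le_iff_le.1 hle⟩, rfl⟩
  · obtain ⟨T, hT, hTW, hTl, hTn⟩ := exists_tree_of_ne_bot hlow hst (hfM η)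
      (fun h => hη (f.injective h))
    obtain ⟨T, rfl⟩ : ∃ T', T = f '' T' := ⟨_, (him T hT).symm⟩
    refine ⟨T, ?_, (isLeast_image f).1 hTl, fun h => hTn (by rw [h, image_singleton])⟩
    rw [← wTree_image f hinc, hrange]
    exact hTW
  · obtain ⟨δ₀, hδ₀⟩ := hearly Y hY
    -- The function is coded by its kernel on `Y`. A correct guess then sends each node of `Y` to
    -- its class and every other node to `∅`, so the guessed set is `Y`.
    obtain ⟨δ, hδ, -, hSδ⟩ := hS {x | node d x.1 ∈ f '' Y ∧ node d x.2 ∈ f '' Y ∧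
      c ⟨node d x.1, hnode _⟩ = c ⟨node d x.2, hnode _⟩} (max γ δ₀) id
    have hγδ : γ < δ := (le_max_left _ _).trans_lt hδ
    have hδ' : ∀ a ∈ Y, (nm (f a)).1 < δ := fun a ha =>
      (hδ₀ a ha).trans ((le_max_right _ _).trans_lt hδ)
    have hg : ∀ a ∈ Y, ∀ b ∈ Y, f b ∈ guessFun (S δ) d δ (f a) ↔ c a = c b := by
      intro a ha b hb
      constructor
      · rintro ⟨p, q, hp, hq, h1, h2, h3⟩
        have := ((hSδ p q hp hq).2 h3).2.2
        simp only [h1, h2] at this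
        exact this
      · intro h
        refine ⟨nm (f a), nm (f b), hδ' a ha, hδ' b hb, hnm _ (hfM a), hnm _ (hfM b), ?_⟩
        refine (hSδ _ _ (hδ' a ha) (hδ' b hb)).1 ?_
        simp only [mem_ofPred_eq, hnm _ (hfM a), hnm _ (hfM b)]
        exact ⟨⟨a, ha, rfl⟩, ⟨b, hb, rfl⟩, h⟩
    have hg2 : ∀ x y, y ∈ guessFun (S δ) d δ x → x ∈ f '' Y ∧ y ∈ f '' Y := by
      rintro x y ⟨p, q, hp, hq, rfl, rfl, h3⟩
      have := (hSδ p q hp hq).2 h3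
      exact ⟨this.1, this.2.1⟩
    have hYeq : {y | y ∈ guessFun (S δ) d δ y} = f '' Y := by
      ext y
      constructor
      · exact fun h => (hg2 y y h).1
      · rintro ⟨a, ha, rfl⟩
        exact (hg a ha a ha).2 rfl
    obtain ⟨h1, Z, hZ, hZa, hZc, hcan⟩ := (hd δ).canon ⟨_, Or.inr ⟨γ, hγδ, rfl⟩, by
      rw [hYeq, hD, alm_image]; exact hYa⟩
    rw [hYeq] at h1 hcan
    obtain ⟨Z, rfl⟩ : ∃ Z', Z = f '' Z' := ⟨_, (him Z (hZ.trans (hDM δ))).symm⟩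
    rw [hD, covers_image] at h1 hZc
    refine ⟨δ, hγδ, h1, Z, image_subset_iff.1 hZ, (isAntichain_image f).1 hZa, hZc,
      fun η hη μ hμ => ?_⟩
    have h3 := hcan (f η) ⟨⟨η, hη.1, rfl⟩, hη.2⟩ (f μ) ⟨⟨μ, hμ.1, rfl⟩, hμ.2⟩
    simp only [exists_mem_image, f.le_iff_le] at h3
    rw [← h3]
    constructor
    · intro h
      ext y
      constructor
      · intro hy
        obtain ⟨b, hb, rfl⟩ := (hg2 _ _ hy).2
        exact (hg μ hμ.1 b hb).2 (h ▸ (hg η hη.1 b hb).1 hy)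
      · intro hy
        obtain ⟨b, hb, rfl⟩ := (hg2 _ _ hy).2
        exact (hg η hη.1 b hb).2 (h ▸ (hg μ hμ.1 b hb).1 hy)
    · intro h
      exact (hg η hη.1 μ hμ.1).1 (h ▸ (hg μ hμ.1 μ hμ.1).2 rfl)
  · have hWc : ∀ γ, ∃ δ₀, ∀ a ∈ W γ, (nm (f a)).1 < δ₀ := fun γ => hearly _ (hWZ γ).tree.countable
    choose g hg using hWc
    -- The names `(γ, inl 0)` and `(γ, inl 1)` act as labels under which `W γ` and `Z γ` are listed.
    -- Closure under `g` places the names of all nodes of `W γ` before `δ` when `γ < δ`.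
    obtain ⟨δ, hδ, hgδ, hSδ⟩ := hS {x | (x.1.2 = Sum.inl 0 ∧ node d x.2 ∈ f '' W x.1.1) ∨
      (x.1.2 = Sum.inl 1 ∧ node d x.2 ∈ f '' Z x.1.1)} γ₀ g
    have hW : ∀ γ < δ, ∀ a ∈ W γ, (nm (f a)).1 < δ := fun γ h a ha => (hg γ a ha).trans (hgδ γ h)
    have hZW : ∀ γ, Z γ ⊆ W γ := fun γ => (hWZ γ).suc.trans suc_subset
    have hgW : ∀ γ < δ, guessSet (S δ) d δ γ 0 = f '' W γ := by
      intro γ hγ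
      ext y
      constructor
      · rintro ⟨q, hq, rfl, h3⟩
        rcases (hSδ _ q hγ hq).2 h3 with ⟨-, h⟩ | ⟨h, -⟩
        · exact h
        · cases h
      · rintro ⟨a, ha, rfl⟩
        refine ⟨nm (f a), hW γ hγ a ha, hnm _ (hfM a), (hSδ _ _ hγ (hW γ hγ a ha)).1 (Or.inl ⟨rfl, ?_⟩)⟩
        rw [hnm _ (hfM a)]; exact ⟨a, ha, rfl⟩
    have hgZ : ∀ γ < δ, guessSet (S δ) d δ γ 1 = f '' Z γ := by
      intro γ hγ
      ext y
      constructor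
      · rintro ⟨q, hq, rfl, h3⟩
        rcases (hSδ _ q hγ hq).2 h3 with ⟨h, -⟩ | ⟨-, h⟩
        · cases h
        · exact h
      · rintro ⟨a, ha, rfl⟩
        have ha' := hW γ hγ a (hZW γ ha)
        refine ⟨nm (f a), ha', hnm _ (hfM a), (hSδ _ _ hγ ha').1 (Or.inr ⟨rfl, ?_⟩)⟩
        rw [hnm _ (hfM a)]; exact ⟨a, ha, rfl⟩
    have hsub : nodes d (Iio δ) ⊆ range f := by
      rw [hrange]; exact nodes_mono (subset_univ _)
    have htask : ∀ γ < δ, ∀ B, Le' B (f '' W γ) →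
        IsTask (nodes d (Iio δ)) B (guessSet (S δ) d δ γ 0) (guessSet (S δ) d δ γ 1) := by
      intro γ hγ B hB
      rw [hgW γ hγ, hgZ γ hγ]
      have h := hWZ γ
      refine ⟨((wTree_image f hinc).2 h.tree).mono hsub, (isLeast_image f).2 h.least, ?_, hB, ?_, ?_⟩
      · rintro _ ⟨a, ha, rfl⟩
        rw [← hnm _ (hfM a)]
        exact hnodelt δ _ (hW γ hγ a ha)
      · rw [← hfb, suc_image]; exact image_mono h.suc
      · intro F hF hfin hFb
        obtain ⟨F, rfl⟩ := subset_range_iff_exists_image_eq.1 (hF.trans hsub)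
        obtain ⟨ν, hν, h1⟩ := h.pos F (subset_univ _) (hfin.of_finite_image f.injective.injOn)
          fun h => hFb ⟨⊥, h, hfb⟩
        refine ⟨f ν, ⟨ν, hν, rfl⟩, ?_⟩
        rintro _ ⟨ρ, hρ, rfl⟩
        exact (hinc _ _).2 (h1 ρ hρ)
    have hdense := (hd δ).dense (by
      have hle : ∀ γ, Le' (d γ).2.2 (f '' W γ) := fun γ => by
        rw [hD, le'_image]; exact (hWZ γ).le
      rintro B (rfl | ⟨γ, hγ, rfl⟩)
      · have hlt : γ₀ < δ := hδ
        refine ⟨_, ⟨γ₀, hlt, rfl⟩, htask γ₀ hlt _ ?_⟩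
        exact (hd γ₀).le_base.trans (graftable_base.wTree.mono (empty_subset _))
          ((hd γ₀).treeD.mono (empty_subset _))
          (((wTree_image f hinc).2 (hWZ γ₀).tree).mono (empty_subset _)) (hd γ₀).leastD
          ((isLeast_image f).2 (hWZ γ₀).least) (hle γ₀)
      · exact ⟨_, ⟨γ, hγ, rfl⟩, htask γ hγ _ (hle γ)⟩)
    refine ⟨δ, hδ, fun ν hν => ?_⟩
    obtain ⟨_, ⟨γ, hγ, rfl⟩, h1, h2⟩ := hdense (f ν) (by
      rw [hC, ← hfb, suc_image]; exact ⟨ν, hν, rfl⟩)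
    simp only [hgW γ hγ, hgZ γ hγ] at h1 h2
    rw [hC, above_image, above_image, sb_image] at h2
    exact ⟨γ, (mem_image_emb f).1 h1, h2⟩

end CWT

namespace CWT

/-! ### Infinitude of fronts, and constancy of canonical colourings -/

section FrontLemmas

variable {M : Type*} [PartialOrder M] {𝓜 B B' G Y Z T : Set M} {ν ρ η : M}

theorem PSub.isPsb (hB : WTree univ B) (h : PSub univ B B') (hr : SameRoot B' B) : IsPsb B B' where
  isCWT := isCWT_iff.2 (h.wTree hB)
  subset := h.subset
  sameRoot := hr
  suc_subset := fun ν hν => by rw [h.suc_eq hν.1]; exact inter_subset_left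
  suc_infinite := fun ν hν => by rw [h.suc_eq hν.1]; exact (h.pos ν hν.1 hν.2).infinite

theorem isAntichain_maxs : IsAntichain (· ≤ ·) (maxs B) := fun _ ha b hb hne hle =>
  ha.2 b hb.1 (lt_of_le_of_ne hle hne)

theorem alm_maxs (hB : B.Nonempty) : Alm B (maxs B) :=
  ⟨isAntichain_maxs, B, Sb.refl hB, covers_maxs B⟩

/-- Above each immediate successor of a node strictly below a front there are elements of the
front. -/
theorem Covers.exists_ge (hT : WTree 𝓜 T) (hY : IsAntichain (· ≤ ·) Y) (hc : Covers T Y)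
    (hρ : ρ ∈ T) (hη : η ∈ Y) (hlt : ρ < η) {τ : M} (hτ : τ ∈ suc T ρ) :
    ∃ y ∈ Y, y ∈ T ∧ τ ≤ y := by
  obtain ⟨y, hy, hyT, h | h, -⟩ := hc.comparable hT hτ.1
  · exact ⟨y, hy, hyT, h⟩
  · rcases hT.le_or_eq_of_mem_suc hρ hτ hyT h with h1 | h1
    · exact absurd (h1.trans hlt.le) (hY hy hη (h1.trans_lt hlt).ne)
    · exact ⟨y, hy, hyT, h1.ge⟩

theorem Covers.infinite_ge (hT : WTree 𝓜 T) (hY : IsAntichain (· ≤ ·) Y) (hc : Covers T Y)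
    (hρ : ρ ∈ T) (hη : η ∈ Y) (hηT : η ∈ T) (hlt : ρ < η) : {y ∈ Y ∩ T | ρ ≤ y}.Infinite := by
  choose! f hf hfT hle using fun τ (hτ : τ ∈ suc T ρ) => hc.exists_ge hT hY hρ hη hlt hτ
  have hinj : InjOn f (suc T ρ) := fun s hs t ht hst => by
    by_contra hne
    exact not_incompat_of_le (hle s hs) (hst ▸ hle t ht) (hT.suc_incompat hs ht hne)
  have hinf : (suc T ρ).Infinite := (hT.pos ρ hρ fun h => h.2 η hηT hlt).infinite
  refine (hinf.image hinj).mono ?_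
  rintro _ ⟨τ, hτ, rfl⟩
  exact ⟨⟨hf τ hτ, hfT τ hτ⟩, hτ.2.1.le.trans (hle τ hτ)⟩

/-- A canonical two-valued function is constant. -/
theorem exists_const_of_canonical [OrderBot M] (hT : WTree 𝓜 T) (hl : IsLeast T ⊥)
    (hY : IsAntichain (· ≤ ·) Y) (hc : Covers T Y) (hZ : Z ⊆ T) (c : M → Bool)
    (hcan : ∀ η ∈ Y ∩ T, ∀ μ ∈ Y ∩ T, (c η = c μ ↔ ∃ ρ ∈ Z, ρ ≤ η ∧ ρ ≤ μ)) :
    ∃ i, ∀ η ∈ Y ∩ T, c η = i := by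
  obtain ⟨y, hy, hyT, -⟩ := hc.comparable hT hl.1
  refine ⟨c y, fun η hη => ?_⟩
  by_cases hyb : y = ⊥
  · subst hyb
    rw [hY.eq hy hη.1 bot_le]
  by_cases hZb : ⊥ ∈ Z
  · exact (hcan η hη y ⟨hy, hyT⟩).2 ⟨⊥, hZb, bot_le, bot_le⟩
  exfalso
  have hlt : ⊥ < y := bot_lt_iff_ne_bot.2 hyb
  -- Now a node of `Z` below `f τ` lies above `τ`. So the colours at the `f τ` are pairwise
  -- distinct, which is impossible with two colours and infinitely many `τ`.
  choose! f hf hfT hle using fun τ (hτ : τ ∈ suc T ⊥) => hc.exists_ge hT hY hl.1 hy hlt hτ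
  have hinf : (suc T ⊥).Infinite := (hT.pos ⊥ hl.1 fun h => h.2 y hyT hlt).infinite
  have hinj : InjOn (fun τ => c (f τ)) (suc T ⊥) := by
    intro s hs t ht hst
    obtain ⟨ρ, hρ, h1, h2⟩ := (hcan _ ⟨hf s hs, hfT s hs⟩ _ ⟨hf t ht, hfT t ht⟩).1 hst
    have key : ∀ u ∈ suc T ⊥, ρ ≤ f u → u ≤ ρ := fun u hu h => by
      rcases hT.comparable hu.1 (hZ hρ) (hle u hu) h with h3 | h3
      · exact h3
      · rcases hT.le_or_eq_of_mem_suc hl.1 hu (hZ hρ) h3 with h4 | h4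
        · exact absurd (le_bot_iff.1 h4 ▸ hρ) hZb
        · exact h4.ge
    by_contra hne
    exact not_incompat_of_le (key s hs h1) (key t ht h2) (hT.suc_incompat hs ht hne)
  exact hinf.image hinj (toFinite _)

end FrontLemmas

/-! ### The system of a frame and its clauses -/

section FrameSystem

variable {Ω M : Type} [LinearOrder Ω] [Nonempty Ω] [PartialOrder M] [OrderBot M] {C D : Ω → Set M}

/-- The trees with root `η` that belong to the system; a nontrivial tree with root `⊥` has to be
below some `D α`. -/
def family (D : Ω → Set M) (η : M) : Set (Set M) :=
  {B | WTree univ B ∧ IsLeast B η ∧ (η = ⊥ → B = {⊥} ∨ ∃ α, Le' B (D α))}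

/-- The order of the system. -/
def famLE (D : Ω → Set M) (B B' : Set M) : Prop :=
  B ∈ family D ⊥ \ {{⊥}} ∧ B' ∈ family D ⊥ \ {{⊥}} ∧ Le' B B' ∧ (Le' B' B → B' ⊆ B)

omit [LinearOrder Ω] [Nonempty Ω] in
theorem mem_roots {B : Set M} : B ∈ family D ⊥ \ {{⊥}} ↔
    WTree univ B ∧ IsLeast B ⊥ ∧ B ≠ {⊥} ∧ ∃ α, Le' B (D α) := by
  constructor
  · rintro ⟨⟨h1, h2, h3⟩, h4⟩
    exact ⟨h1, h2, h4, (h3 rfl).resolve_left h4⟩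
  · rintro ⟨h1, h2, h3, h4⟩
    exact ⟨⟨h1, h2, fun _ => Or.inr h4⟩, h3⟩

namespace IsFrame

variable (hF : IsFrame C D)
include hF

omit [Nonempty Ω] in
theorem mem_roots_of_le {B B' : Set M} (hB : WTree univ B) (hl : IsLeast B ⊥) (hne : B ≠ {⊥})
    (hB' : B' ∈ family D ⊥ \ {{⊥}}) (h : Le' B B') : B ∈ family D ⊥ \ {{⊥}} := by
  obtain ⟨h1, h2, -, α, h4⟩ := mem_roots.1 hB'
  exact mem_roots.2 ⟨hB, hl, hne, α, h.trans hB h1 (hF.treeD α) h2 (hF.leastD α) h4⟩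

omit [Nonempty Ω] in
theorem D_mem (α : Ω) : D α ∈ family D ⊥ \ {{⊥}} :=
  mem_roots.2 ⟨hF.treeD α, hF.leastD α, hF.neD α, α, Le'.refl ⟨⊥, (hF.leastD α).1⟩⟩

omit [Nonempty Ω] in
theorem C_mem (α : Ω) : C α ∈ family D ⊥ \ {{⊥}} :=
  mem_roots.2 ⟨hF.treeC α, hF.leastC α, hF.neC α, α, hF.le α⟩

/-- The last clause of `famLE` holds vacuously: `Le' (D δ) B` would put a root successor of `D δ`
into `B`, but for large `δ` those are not in `B`. For `C δ` the same argument is applied to an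
earlier `D γ`. -/
theorem eventually (hbdd : ∀ s : Set Ω, s.Countable → ∃ b, ∀ a ∈ s, a < b) {B : Set M}
    (hB : B ∈ family D ⊥ \ {{⊥}}) : ∃ δ₀, ∀ δ > δ₀, famLE D B (C δ) ∧ famLE D B (D δ) ∧
      B ∩ suc (D δ) ⊥ = ∅ := by
  obtain ⟨h1, h2, h3, α, h4⟩ := mem_roots.1 hB
  obtain ⟨β, hβ⟩ := hF.new B h1.countable
  obtain ⟨γ, hγ⟩ := hbdd {α, β} (by simp)
  have hnle : ∀ δ, β < δ → ¬ Le' (D δ) B := fun δ hδ h => by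
    obtain ⟨x, hx, hxB⟩ := h.suc_inter_nonempty (hF.treeD δ) h1 (hF.leastD δ) (hF.neD δ)
    have := hβ δ hδ
    rw [eq_empty_iff_forall_notMem] at this
    exact this x ⟨hxB, hx⟩
  have hαγ := hγ α (by simp)
  have hβγ := hγ β (by simp)
  refine ⟨γ, fun δ hδ => ?_⟩
  have hC : Le' B (C δ) := h4.trans h1 (hF.treeD α) (hF.treeC δ) (hF.leastD α) (hF.leastC δ)
    (hF.bound α δ (hαγ.trans hδ))
  refine ⟨⟨hB, hF.C_mem δ, hC, fun h => ?_⟩, ⟨hB, hF.D_mem δ, ?_, fun h => ?_⟩,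
    hβ δ (hβγ.trans hδ)⟩
  · exact absurd ((hF.bound γ δ hδ).trans (hF.treeD γ) (hF.treeC δ) h1 (hF.leastC δ) h2 h)
      (hnle γ hβγ)
  · exact hC.trans h1 (hF.treeC δ) (hF.treeD δ) (hF.leastC δ) (hF.leastD δ) (hF.le δ)
  · exact absurd h (hnle δ (hβγ.trans hδ))

/-- The system of a frame. -/
def system (hbdd : ∀ s : Set Ω, s.Countable → ∃ b, ∀ a ∈ s, a < b) : System M where
  fam := family D
  isCWT := fun _ _ hB => isCWT_iff.2 hB.1
  isLeast := fun _ _ hB => hB.2.1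
  singleton_mem := fun η => ⟨wTree_singleton _ η, isLeast_singleton, fun h => Or.inl (h ▸ rfl)⟩
  above_mem := fun η B hB ν hν => by
    refine ⟨wTree_above hB.1 hν, isLeast_above hν, ?_⟩
    rintro rfl
    have hη : η = ⊥ := le_bot_iff.1 (hB.2.1.2 hν)
    rw [above_eq_self (hη ▸ hB.2.1)]
    exact hB.2.2 hη
  le := famLE D
  le_dom := fun _ _ h => ⟨h.1, h.2.1⟩
  le_refl := fun B hB => ⟨hB, hB, Le'.refl ⟨⊥, hB.1.2.1.1⟩, fun _ => Subset.rfl⟩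
  le_trans := by
    rintro B₁ B₂ B₃ ⟨h1, h2, h3, h4⟩ ⟨-, h5, h6, h7⟩
    obtain ⟨a1, b1, -⟩ := mem_roots.1 h1
    obtain ⟨a2, b2, -⟩ := mem_roots.1 h2
    obtain ⟨a3, b3, -⟩ := mem_roots.1 h5
    refine ⟨h1, h5, h3.trans a1 a2 a3 b2 b3 h6, fun h => ?_⟩
    exact (h7 (h.trans a3 a1 a2 b1 b2 h3)).trans (h4 (h6.trans a2 a3 a1 b3 b1 h))
  -- `Le'` is only a preorder; the last clause of `famLE` orders equivalent trees by reverse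
  -- inclusion.
  le_antisymm := fun B₁ B₂ h h' => Subset.antisymm (h'.2.2.2 h.2.2.1) (h.2.2.2 h'.2.2.1)
  le_directed := fun B hB B' hB' => by
    obtain ⟨α, hα⟩ := hF.eventually hbdd hB
    obtain ⟨β, hβ⟩ := hF.eventually hbdd hB'
    obtain ⟨γ, hγ⟩ := hbdd {α, β} (by simp)
    exact ⟨D γ, hF.D_mem γ, (hα γ (hγ α (by simp))).2.1, (hβ γ (hγ β (by simp))).2.1⟩
  le_leStar := fun B₁ B₂ h => h.2.2.1.leStar (isCWT_iff.2 h.1.1.1) (isCWT_iff.2 h.2.1.1.1)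
    h.1.1.2.1 h.2.1.1.2.1

variable (hbdd : ∀ s : Set Ω, s.Countable → ∃ b, ∀ a ∈ s, a < b)

theorem clauseA : (hF.system hbdd).ClauseA := by
  constructor
  · intro η h
    by_cases hη : η = ⊥
    · subst hη
      have h1 := hF.D_mem (Classical.arbitrary Ω)
      have h2 : D (Classical.arbitrary Ω) ∈ (hF.system hbdd).fam ⊥ := h1.1
      rw [h] at h2
      exact h1.2 h2
    · obtain ⟨T, h1, h2, h3⟩ := hF.node η hη
      have h4 : T ∈ (hF.system hbdd).fam η := ⟨h1, h2, fun h => absurd h hη⟩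
      rw [h] at h4
      exact h3 h4
  · intro S hS hc
    choose! g hg using fun B (hB : B ∈ S) => hF.eventually hbdd (hS hB)
    obtain ⟨b, hb⟩ := hbdd (g '' S) (hc.image g)
    exact ⟨D b, hF.D_mem b, fun B hB => (hg B hB b (hb _ ⟨B, hB, rfl⟩)).2.1⟩

theorem clauseC : (hF.system hbdd).ClauseC := by
  intro B hB
  obtain ⟨δ₀, hδ₀⟩ := hF.eventually hbdd hB
  obtain ⟨δ, hδ⟩ := hbdd {δ₀} (by simp)
  obtain ⟨hC, hD, hemp⟩ := hδ₀ δ (hδ δ₀ rfl)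
  refine ⟨D δ, hF.D_mem δ, hD, hemp, fun σ hσ => ?_⟩
  obtain ⟨h1, h2, h3, -⟩ := mem_roots.1 hB
  obtain ⟨V, hs, he⟩ := hC.2.2.1
  have hV := hs.wTree (hF.treeC δ)
  have hbV := hs.root_mem (hF.leastC δ)
  have hinf := (hF.inf δ σ hσ).sdiff (hs.fin ⊥ hbV)
  refine (he.infinite_suc h1 hV h2.1 (IsLeast.not_mem_maxs h2 h3) (fun ρ hρ => ?_) hinf).mono ?_
  · rw [hs.suc_eq hbV]
    exact ⟨hρ.1.1, by_contra fun h => hρ.2 ⟨hρ.1.1, h⟩⟩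
  · rintro ρ ⟨hρ, -, τ, hτ, hle⟩
    exact ⟨hρ, hτ.1.2.trans hle⟩

theorem clauseD : (hF.system hbdd).ClauseD := by
  intro η B hB Y hY
  obtain ⟨h1, h2, h3⟩ := (isFront_iff hB.1).1 hY
  have hT := wTree_below hB.1 h1 h2 h3
  obtain ⟨y, hy, hyB, -⟩ := h3.comparable hB.1 hB.2.1.1
  have hl : IsLeast (below B Y) η := ⟨⟨hB.2.1.1, y, hy, hB.2.1.2 hyB⟩, fun x hx => hB.2.1.2 hx.1⟩
  refine ⟨hT, hl, ?_⟩
  rintro rfl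
  rcases hB.2.2 rfl with h | ⟨α, h⟩
  · refine Or.inl (Subset.antisymm (h ▸ below_subset) ?_)
    rintro _ rfl
    exact hl.1
  · refine Or.inr ⟨α, ?_⟩
    exact (Le'.of_ext ⟨⊥, hB.2.1.1⟩ (ext_below hB.1 h1 h2 h3)).trans hT hB.1 (hF.treeD α) hB.2.1
      (hF.leastD α) h

theorem full : (hF.system hbdd).Full := by
  intro η hη B hB B' hB'
  refine ⟨isCWT_iff.1 hB'.isCWT, ?_, fun h => absurd h hη⟩
  obtain ⟨r, hr', hr⟩ := hB'.sameRoot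
  exact hr.unique hB.2.1 ▸ hr'

theorem fat : (hF.system hbdd).Fat := by
  intro B hB B' hB'
  obtain ⟨h1, h2, h3, -⟩ := mem_roots.1 hB
  have hs := hB'.sb (isCWT_iff.2 h1)
  have hne := hs.nonempty
  have hl := hs.isLeast h2
  have hB'' := hF.mem_roots_of_le (hs.wTree h1) hl
    ((hs.pSub h1).ne_singleton h2 hl.1 h3) hB ⟨B', hs, Ext.refl hne⟩
  exact ⟨B', (Sb.refl hne).isSb hB'.isCWT, hB'', hB, hB'',
    Le'.of_ext hne ((Ext.refl ⟨⊥, h2.1⟩).of_sb h1 hs), fun _ => hB'.subset⟩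

/-- At a suitable stage every root successor of `C δ` comes from a tree `W γ` provided by density,
where its cone is in `I`. The cone in `C δ` is an exhaustive subtree of that one, so openness puts
it into `I`, without exceptions. -/
theorem isGood : (hF.system hbdd).IsGood := by
  refine ⟨⟨hF.clauseA hbdd, hF.clauseC hbdd⟩, fun I hI hop B hB => ?_⟩
  choose W hW hle hpos using fun γ => hI.2 (D γ) (hF.D_mem γ)
  have htask : ∀ γ, IsTask univ (D γ) (W γ) {ν ∈ suc (W γ) ⊥ | above (W γ) ν ∈ I} := fun γ => by
    obtain ⟨h1, h2, -⟩ := mem_roots.1 (hW γ)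
    refine ⟨h1, h2, subset_univ _, (hle γ).2.2.1, sep_subset _ _, fun F _ hfin hb => ?_⟩
    obtain ⟨ν, h3, h4, h5⟩ := hpos γ F hfin hb
    exact ⟨ν, ⟨h3, h4⟩, h5⟩
  obtain ⟨δ₀, hδ₀⟩ := hF.eventually hbdd hB
  obtain ⟨δ, hδ, hd⟩ := hF.dense W _ htask δ₀
  refine ⟨C δ, hF.C_mem δ, (hδ₀ δ hδ).1, ?_⟩
  convert finite_empty
  rw [eq_empty_iff_forall_notMem]
  rintro ν ⟨hν, hνI⟩
  obtain ⟨γ, ⟨hνW, hI'⟩, hs⟩ := hd ν hν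
  have hWT := wTree_above (mem_roots.1 (hW γ)).1 hνW.1
  have hCT := wTree_above (hF.treeC δ) hν.1
  refine hνI (hop.2 _ hI' _ ⟨ν, hν.2.1.ne', hCT, isLeast_above hν.1,
    fun h => absurd h hν.2.1.ne'⟩ ?_)
  exact (Le'.of_ext hs.nonempty ((Ext.refl ⟨ν, (isLeast_above hνW.1).1⟩).of_sb hWT hs)).leStar
    (isCWT_iff.2 hWT) (isCWT_iff.2 hCT) (isLeast_above hνW.1) (isLeast_above hν.1)

section Fronts

include hbdd

variable {B Y : Set M}

/-- Functions on an almost front of a tree of the system are canonical on some `D δ`. -/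
theorem exists_canon (hB : B ∈ family D ⊥ \ {{⊥}}) (hY : Alm B Y) (hYc : Y.Countable) {β : Type}
    (c : M → β) : ∃ δ, famLE D B (D δ) ∧ B ∩ suc (D δ) ⊥ = ∅ ∧ Covers (D δ) Y ∧
      ∃ Z ⊆ D δ, IsAntichain (· ≤ ·) Z ∧ Covers (D δ) Z ∧
        ∀ η ∈ Y ∩ D δ, ∀ μ ∈ Y ∩ D δ, (c η = c μ ↔ ∃ ρ ∈ Z, ρ ≤ η ∧ ρ ≤ μ) := by
  obtain ⟨δ₀, hδ₀⟩ := hF.eventually hbdd hB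
  obtain ⟨γ, hγ⟩ := hbdd {δ₀} (by simp)
  have hγ' := hγ δ₀ rfl
  obtain ⟨h1, h2, -⟩ := mem_roots.1 hB
  have hYγ := (hδ₀ γ hγ').2.1.2.2.1.alm h1 (hF.treeD γ) h2 (hF.leastD γ) hY
  obtain ⟨δ, hδ, h⟩ := hF.canon Y hYc γ hYγ β c
  have := hδ₀ δ (hγ'.trans hδ)
  exact ⟨δ, this.2.1, this.2.2, h⟩

theorem exists_const (hB : B ∈ family D ⊥ \ {{⊥}}) (hY : Alm B Y) (hYc : Y.Countable)
    (c : M → Bool) : ∃ δ, famLE D B (D δ) ∧ Covers (D δ) Y ∧ ∃ i, ∀ η ∈ Y ∩ D δ, c η = i := by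
  obtain ⟨δ, h1, -, h2, Z, hZ, -, -, hcan⟩ := hF.exists_canon hbdd hB hY hYc c
  exact ⟨δ, h1, h2,
    exists_const_of_canonical (hF.treeD δ) (hF.leastD δ) hY.1 h2 hZ c hcan⟩

/-- The colouring is constant on the maximal nodes of `B` that lie in `D δ`, and the trace on `B` of
the witness for `Le' B (D δ)` is a positive subtree whose maximal nodes are among these. -/
theorem big : (hF.system hbdd).Big := by
  classical
  intro B hB c
  obtain ⟨h1, h2, h3, -⟩ := mem_roots.1 hB
  obtain ⟨δ, hle, -, i, hi⟩ := hF.exists_const hbdd hB (alm_maxs ⟨⊥, h2.1⟩)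
    (h1.countable.mono fun _ h => h.1) (fun m => if h : m ∈ maxs B then c ⟨m, h⟩ else true)
  obtain ⟨V, hs, he⟩ := hle.2.2.1
  have hV := hs.wTree (hF.treeD δ)
  have hVl := hs.isLeast (hF.leastD δ)
  have hP := he.pSub h1 hV h2 hVl
  have hl : IsLeast (V ∩ B) ⊥ := ⟨⟨hVl.1, h2.1⟩, fun _ _ => bot_le⟩
  have hmem := hF.mem_roots_of_le (hP.wTree h1) hl (hP.ne_singleton h2 hl.1 h3) (hF.D_mem δ)
    ⟨V, hs, he.inter h1 hV h2 hVl⟩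
  refine ⟨V ∩ B, hmem, hP.isPsb h1 ⟨⊥, hl, h2⟩, ⟨hB, hmem,
    Le'.of_ext ⟨⊥, hl.1⟩ (hP.ext h2 hl.1), fun _ => inter_subset_right⟩, i, fun η hη => ?_⟩
  rw [hP.maxs_eq] at hη
  have := hi η.1 ⟨η.2, hs.subset hη.2.1⟩
  simpa only [η.2, dite_true] using this

/-- The required tree is `D δ` cut off at the maximal nodes of `B` that it contains; the canonical
front lies below the cut. -/
theorem large : (hF.system hbdd).Large := by
  classical
  intro B hB β c
  obtain ⟨h1, h2, h3, -⟩ := mem_roots.1 hB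
  obtain ⟨δ, hle, hemp, hcov, Z, hZ, hZa, hZc, hcan⟩ := hF.exists_canon hbdd hB
    (alm_maxs ⟨⊥, h2.1⟩) (h1.countable.mono fun _ h => h.1)
    (fun m => if h : m ∈ maxs B then some (c ⟨m, h⟩) else none)
  have hD := hF.treeD δ
  have hDl := hF.leastD δ
  set Y : Set M := maxs B ∩ D δ with hY
  have hYa : IsAntichain (· ≤ ·) Y := isAntichain_maxs.subset inter_subset_left
  have hYD : Y ⊆ D δ := inter_subset_right
  have hYc : Covers (D δ) Y := fun m hm => by
    obtain ⟨y, hy, hyD, hym⟩ := hcov m hm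
    exact ⟨y, ⟨hy, hyD⟩, hyD, hym⟩
  have hmax : maxs (below (D δ) Y) = Y := maxs_below hYa hYD
  have hT := wTree_below hD hYD hYa hYc
  have hl : IsLeast (below (D δ) Y) ⊥ := by
    obtain ⟨y, hy, -⟩ := hYc.comparable hD hDl.1
    exact ⟨⟨hDl.1, y, hy, bot_le⟩, fun _ _ => bot_le⟩
  have hne : below (D δ) Y ≠ {⊥} := fun h => by
    have h4 : (⊥ : M) ∈ maxs (below (D δ) Y) := by
      rw [h]
      exact ⟨rfl, by rintro _ rfl; exact lt_irrefl _⟩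
    rw [hmax] at h4
    exact IsLeast.not_mem_maxs h2 h3 h4.1
  have hmem := hF.mem_roots_of_le hT hl hne (hF.D_mem δ)
    (Le'.of_ext ⟨⊥, hDl.1⟩ (ext_below hD hYD hYa hYc))
  have hle' : Le' B (below (D δ) Y) := by
    obtain ⟨V, hs, he⟩ := hle.2.2.1
    have hV := hs.wTree hD
    refine ⟨below V Y, hs.below hDl (hYc.sb hD hs) hD, ?_, fun m hm => ?_⟩
    · rintro a ha b hb ⟨hbV, y, hy, hby⟩ hab
      exact ⟨he.lower a ha b hb hbV hab, y, hy, hab.trans hby⟩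
    · obtain ⟨m', hm', hmm⟩ := hV.exists_maxs hm.1.1
      obtain ⟨y, hy, hyV, hym⟩ := he.cover m' hm'
      have hyb : y ∈ below V Y := ⟨hyV, y, ⟨hy, hs.subset hyV⟩, le_rfl⟩
      refine ⟨y, hy, hyb, ?_⟩
      rcases hV.comparable hm.1.1 hyV hmm hym with h | h
      · exact (h.eq_or_lt.resolve_right (hm.2 y hyb)).ge
      · exact h
  have hrefl : ∀ η ∈ Y, ∃ ρ ∈ Z, ρ ≤ η := fun η hη => by
    obtain ⟨ρ, h4, h5, -⟩ := (hcan η hη η hη).1 rfl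
    exact ⟨ρ, h4, h5⟩
  refine ⟨below (D δ) Y, hmem, ⟨hB, hmem, hle', fun h => ?_⟩, hmax.le.trans inter_subset_left,
    Z, ?_, fun η ν hη hν => ?_⟩
  · obtain ⟨x, hx, hxB⟩ := h.suc_inter_nonempty hT h1 hl hne
    rw [suc_below hl.1] at hx
    exact absurd (show x ∈ B ∩ suc (D δ) ⊥ from ⟨hxB, hx.1⟩) (hemp ▸ notMem_empty x)
  · refine (isFront_iff hT).2 ⟨fun z hz => ⟨hZ hz, ?_⟩, hZa, fun m hm => ?_⟩
    · obtain ⟨m, hm, hzm⟩ := hD.exists_maxs (hZ hz)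
      obtain ⟨y, hy, -, hym⟩ := hYc m hm
      obtain ⟨ρ, hρ, hρy⟩ := hrefl y hy
      have : z = ρ := by
        rcases hD.comparable (hZ hz) (hZ hρ) hzm (hρy.trans hym) with h | h
        · exact hZa.eq hz hρ h
        · exact (hZa.eq hρ hz h).symm
      exact ⟨y, hy, this ▸ hρy⟩
    · rw [hmax] at hm
      obtain ⟨ρ, hρ, hρm⟩ := hrefl m hm
      exact ⟨ρ, hρ, ⟨hZ hρ, m, hm, hρm⟩, hρm⟩
  · rw [hmax] at hη hν
    have := hcan η.1 hη ν.1 hν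
    simpa only [η.2, ν.2, dite_true, Option.some.injEq] using this

/-- A witness in any tree moves to every late `D δ`, so finitely many members of `D_Y` can be
compared inside one tree. -/
theorem filt_eventually {Z : Set M} (hZ : Z ∈ (hF.system hbdd).filt Y) : ∃ δ₀, ∀ δ > δ₀,
    ∃ V, Sb (D δ) V ∧ Covers V Y ∧ V ∩ Y ⊆ Z := by
  obtain ⟨-, B, hB, B', hs, hY, hsub⟩ := hZ
  obtain ⟨h1, h2, -⟩ := mem_roots.1 hB
  have hBc := isCWT_iff.2 h1
  rw [isAlmFront_iff hBc] at hY
  have hs := hs.sb hBc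
  obtain ⟨hYa, B'', hs', hc⟩ := hY
  obtain ⟨δ₀, hδ₀⟩ := hF.eventually hbdd hB
  refine ⟨δ₀, fun δ hδ => ?_⟩
  have hr := h1.exists_root
  obtain ⟨V, hV, hVc, -⟩ := (hδ₀ δ hδ).2.1.2.2.1.exists_covers h1 (hF.treeD δ) h2 (hF.leastD δ)
    (hs'.inter hr hs) (hc.sb (hs'.wTree h1) (hs'.inter_left hr hs))
  refine ⟨V, hV, fun m hm => ?_, fun b hb => hsub ?_⟩
  · obtain ⟨y, hy, h3⟩ := hVc m hm
    exact ⟨y, hy.1, h3⟩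
  · obtain ⟨y, hy, hyV, hcomp, -⟩ := hVc.comparable (hV.wTree (hF.treeD δ)) hb.1
    have : b = y := by
      rcases hcomp with h | h
      · exact hYa.eq hb.2 hy.1 h
      · exact (hYa.eq hy.1 hb.2 h).symm
    exact ⟨this ▸ hy.2.2, hb.2⟩

theorem filt_of_D {Z : Set M} (hZ : Z ⊆ Y) (hYa : IsAntichain (· ≤ ·) Y) {δ : Ω} {V : Set M}
    (hV : Sb (D δ) V) (hc : Covers V Y) (h : V ∩ Y ⊆ Z) : Z ∈ (hF.system hbdd).filt Y := by
  have hD := isCWT_iff.2 (hF.treeD δ)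
  exact ⟨hZ, D δ, hF.D_mem δ, V, hV.isSb hD, (isAlmFront_iff hD).2 ⟨hYa, V, hV, hc⟩, h⟩

theorem exists_filt_inter {Z Z' : Set M} (hYa : IsAntichain (· ≤ ·) Y)
    (hZ : Z ∈ (hF.system hbdd).filt Y) (hZ' : Z' ∈ (hF.system hbdd).filt Y) :
    Z ∩ Z' ∈ (hF.system hbdd).filt Y := by
  obtain ⟨α, hα⟩ := hF.filt_eventually hbdd hZ
  obtain ⟨β, hβ⟩ := hF.filt_eventually hbdd hZ'
  obtain ⟨γ, hγ⟩ := hbdd {α, β} (by simp)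
  obtain ⟨V, hV, hc, hs⟩ := hα γ (hγ α (by simp))
  obtain ⟨V', hV', hc', hs'⟩ := hβ γ (hγ β (by simp))
  have hD := hF.treeD γ
  exact hF.filt_of_D hbdd (inter_subset_left.trans hZ.1) hYa (hV.inter hD.exists_root hV')
    (hc.sb (hV.wTree hD) (hV.inter_left hD.exists_root hV'))
    fun x hx => ⟨hs ⟨hx.1.1, hx.2⟩, hs' ⟨hx.1.2, hx.2⟩⟩

theorem filt_nonempty {Z : Set M} (hZ : Z ∈ (hF.system hbdd).filt Y) : Z.Nonempty := by
  obtain ⟨α, hα⟩ := hF.filt_eventually hbdd hZ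
  obtain ⟨γ, hγ⟩ := hbdd {α} (by simp)
  obtain ⟨V, hV, hc, hs⟩ := hα γ (hγ α rfl)
  obtain ⟨y, hy, hyV, -⟩ := hc.comparable (hV.wTree (hF.treeD γ)) (hV.root_mem (hF.leastD γ))
  exact ⟨y, hs ⟨hyV, hy⟩⟩

theorem exists_ultrafilter (hB : B ∈ family D ⊥ \ {{⊥}}) (hY : IsFront B Y) :
    ∃ U : Ultrafilter Y, (hF.system hbdd).FiltIs Y U := by
  classical
  obtain ⟨h1, h2, -⟩ := mem_roots.1 hB
  have hYa := hY.2.1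
  let f : Filter Y :=
    { sets := {Z | Subtype.val '' Z ∈ (hF.system hbdd).filt Y}
      univ_sets := by
        have hBc := isCWT_iff.2 h1
        refine ⟨by simp, B, hB, B, (Sb.refl ⟨⊥, h2.1⟩).isSb hBc,
          (isAlmFront_iff hBc).2 (hY.alm h1), ?_⟩
        simp
      sets_of_superset := by
        rintro Z Z' ⟨-, B', h3, B'', h4, h5, h6⟩ hle
        exact ⟨by simp, B', h3, B'', h4, h5, h6.trans (image_mono hle)⟩
      inter_sets := by
        intro Z Z' hZ hZ'
        change Subtype.val '' (Z ∩ Z') ∈ (hF.system hbdd).filt Y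
        rw [image_inter Subtype.val_injective]
        exact hF.exists_filt_inter hbdd hYa hZ hZ' }
  refine ⟨Ultrafilter.ofComplNotMemIff f fun Z => ⟨fun h => ?_, fun h h' => ?_⟩, fun Z => Iff.rfl⟩
  · by_contra hZ
    obtain ⟨δ, -, hc, i, hi⟩ := hF.exists_const hbdd hB (hY.alm h1) (h1.countable.mono hY.1)
      (fun m => decide (m ∈ Subtype.val '' Z))
    have hs : Sb (D δ) (D δ) := Sb.refl ⟨⊥, (hF.leastD δ).1⟩
    cases i with
    | true =>
      refine hZ (hF.filt_of_D hbdd (by simp) hYa hs hc fun x hx => ?_)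
      simpa using hi x ⟨hx.2, hx.1⟩
    | false =>
      refine h (hF.filt_of_D hbdd (by simp) hYa hs hc fun x hx => ?_)
      have := hi x ⟨hx.2, hx.1⟩
      refine ⟨⟨x, hx.2⟩, fun hxZ => ?_, rfl⟩
      simp only [decide_eq_false_iff_not] at this
      exact this ⟨_, hxZ, rfl⟩
  · obtain ⟨_, ⟨x, hx, rfl⟩, ⟨y, hy, hxy⟩⟩ :=
      hF.filt_nonempty hbdd (hF.exists_filt_inter hbdd hYa h h')
    rw [Subtype.val_injective hxy] at hy
    exact hy hx

theorem clauseB : (hF.system hbdd).ClauseB := by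
  intro B hB Y hY
  obtain ⟨U, hU⟩ := hF.exists_ultrafilter hbdd hB hY
  refine ⟨U, hU, ?_, ?_⟩
  · rintro h rfl
    obtain ⟨y, hy⟩ := Ultrafilter.eq_pure_of_finite U
    exact h y hy
  · rintro hne y rfl
    have hy : Subtype.val '' {y} ∈ (hF.system hbdd).filt Y := (hU _).1 rfl
    obtain ⟨α, hα⟩ := hF.filt_eventually hbdd hy
    obtain ⟨γ, hγ⟩ := hbdd {α} (by simp)
    obtain ⟨V, hV, hc, hs⟩ := hα γ (hγ α rfl)
    have hVT := hV.wTree (hF.treeD γ)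
    have hVl := hV.isLeast (hF.leastD γ)
    obtain ⟨z, hz, hzV, -⟩ := hc.comparable hVT hVl.1
    have hzb : z ≠ ⊥ := by
      rintro rfl
      refine hne (Subset.antisymm (fun x hx => ?_) (singleton_subset_iff.2 hz))
      exact (hY.2.1.eq hz hx bot_le).symm
    refine hc.infinite_ge hVT hY.2.1 hVl.1 hz hzV (bot_lt_iff_ne_bot.2 hzb)
      ((finite_singleton y.1).subset fun x hx => ?_)
    simpa using hs ⟨hx.1.2, hx.1.1⟩

theorem clauseE : (hF.system hbdd).ClauseE := by
  classical
  intro B hB Y hY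
  obtain ⟨h1, -⟩ := mem_roots.1 hB
  obtain ⟨U, hU⟩ := hF.exists_ultrafilter hbdd hB hY
  have hYc := h1.countable.mono hY.1
  refine ⟨U, hU, hYc.to_subtype, fun β g hg => ?_⟩
  obtain ⟨δ, -, -, hcov, Z, hZ, hZa, hZc, hcan⟩ := hF.exists_canon hbdd hB (hY.alm h1) hYc
    (fun m => if h : m ∈ Y then some (g ⟨m, h⟩) else none)
  have hcan' : ∀ η μ : Y, η.1 ∈ D δ → μ.1 ∈ D δ →
      (g η = g μ ↔ ∃ ρ ∈ Z, ρ ≤ η.1 ∧ ρ ≤ μ.1) := fun η μ hη hμ => by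
    have := hcan η.1 ⟨η.2, hη⟩ μ.1 ⟨μ.2, hμ⟩
    simpa only [η.2, μ.2, dite_true, Option.some.injEq] using this
  refine ⟨{y | y.1 ∈ D δ}, (hU _).2 ?_, fun η hη μ hμ heq => ?_⟩
  · refine hF.filt_of_D hbdd (by simp) hY.2.1 (Sb.refl ⟨⊥, (hF.leastD δ).1⟩) hcov fun x hx => ?_
    exact ⟨⟨x, hx.2⟩, hx.1, rfl⟩
  · obtain ⟨ρ, hρ, hρη, hρμ⟩ := (hcan' η μ hη hμ).1 heq
    -- If `ρ` were strictly below `η`, infinitely many elements of `Y` above `ρ` would share the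
    -- value of `η`, against finite-to-one.
    rcases hρη.eq_or_lt with rfl | hlt
    · exact Subtype.ext (hY.2.1.eq η.2 μ.2 hρμ)
    · have hinf := hcov.infinite_ge (hF.treeD δ) hY.2.1 (hZ hρ) η.2 hη hlt
      refine absurd (((hg (g η)).image Subtype.val).subset ?_) hinf
      rintro x ⟨⟨hxY, hxD⟩, hρx⟩
      exact ⟨⟨x, hxY⟩, (hcan' ⟨x, hxY⟩ η hxD hη).2 ⟨ρ, hρ, hρx, hρη⟩, rfl⟩

end Fronts

theorem isNice : (hF.system hbdd).IsNice :=
  ⟨hF.clauseA hbdd, hF.clauseB hbdd, hF.clauseC hbdd, hF.clauseD hbdd, hF.clauseE hbdd,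
    hF.fat hbdd, hF.big hbdd, hF.large hbdd, hF.full hbdd⟩

end IsFrame

end FrameSystem

end CWT

namespace CWT

/-! ### Countable ordinals and the guesses supplied by diamond -/

section Omega

/-- The set of countable ordinals. -/
abbrev OmegaOne : Type := (Ordinal.omega.{0} 1).ToType

theorem countable_Iio_toType {o : Ordinal.{0}} (h : o = (Cardinal.aleph 1).ord) (δ : o.ToType) :
    (Iio δ).Countable := by
  subst h
  have h1 : Cardinal.mk (Iio δ) < Cardinal.aleph 1 := by
    simpa using Cardinal.mk_Iio_lt δ
  rwa [← Cardinal.le_aleph0_iff_set_countable, ← Order.lt_succ_iff, Cardinal.succ_aleph0]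

theorem OmegaOne.countable_Iio (δ : OmegaOne) : (Iio δ).Countable :=
  countable_Iio_toType (Cardinal.ord_aleph 1).symm δ

theorem OmegaOne.mk_eq : Cardinal.mk OmegaOne = Cardinal.aleph 1 := by
  rw [Cardinal.mk_toType, Ordinal.card_omega]

instance OmegaOne.uncountable : Uncountable OmegaOne := by
  rw [← Cardinal.aleph0_lt_mk_iff, OmegaOne.mk_eq]
  exact Cardinal.aleph0_lt_aleph_one

theorem OmegaOne.exists_gt_of_countable {s : Set OmegaOne} (hs : s.Countable) :
    ∃ b, ∀ a ∈ s, a < b := by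
  by_contra! h
  refine not_countable_univ (α := OmegaOne)
    ((hs.biUnion fun a _ => (OmegaOne.countable_Iio a).insert a).mono fun b _ => ?_)
  obtain ⟨a, ha, hb⟩ := h b
  exact mem_biUnion ha (hb.eq_or_lt.imp id id)

theorem OmegaOne.exists_embedding_name :
    ∃ e : Name OmegaOne × Name OmegaOne → OmegaOne, Function.Injective e := by
  have h : Cardinal.mk (Name OmegaOne) ≤ Cardinal.aleph 1 := by
    simp only [Name, Cardinal.mk_prod, Cardinal.lift_id, OmegaOne.mk_eq]
    refine (Cardinal.mul_le_max_of_aleph0_le_left (Cardinal.aleph0_le_aleph 1)).trans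
      (max_le le_rfl ?_)
    exact (Cardinal.mk_le_aleph0).trans (Cardinal.aleph0_le_aleph 1)
  have h' : Cardinal.mk (Name OmegaOne × Name OmegaOne) ≤ Cardinal.mk OmegaOne := by
    rw [Cardinal.mk_prod, Cardinal.lift_id, OmegaOne.mk_eq]
    exact (mul_le_mul' h h).trans_eq (Cardinal.mul_eq_self (Cardinal.aleph0_le_aleph 1))
  obtain ⟨e⟩ := h'
  exact ⟨e, e.injective⟩

/-- The closure points of a monotone function form a club. -/
theorem OmegaOne.isClub_closure_points (γ₀ : OmegaOne) (h : OmegaOne → OmegaOne)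
    (hmono : Monotone h) :
    IsClub {δ : OmegaOne | γ₀ < δ ∧ ∀ γ < δ, h γ < δ} := by
  refine ⟨?_, fun a => ?_⟩
  · intro t ht hne _ x hx
    obtain ⟨y, hy⟩ := hne
    refine ⟨(ht hy).1.trans_le (hx.1 hy), fun γ hγ => ?_⟩
    obtain ⟨z, hz, hγz⟩ := (lt_isLUB_iff hx).1 hγ
    exact ((ht hz).2 γ hγz).trans_le (hx.1 hz)
  · set f : ℕ → OmegaOne := fun n => h^[n] (max a γ₀) with hf
    have hstep : ∀ n, f (n + 1) = h (f n) := fun n => Function.iterate_succ_apply' h n _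
    obtain ⟨b, hb⟩ := OmegaOne.exists_gt_of_countable (countable_range f)
    obtain ⟨δ, hδ, hmin⟩ := WellFounded.has_min (wellFounded_lt (α := OmegaOne))
      {b | ∀ c ∈ range f, c < b} ⟨b, hb⟩
    have h0 : max a γ₀ < δ := hδ (f 0) ⟨0, rfl⟩
    refine ⟨δ, ⟨(le_max_right _ _).trans_lt h0, fun γ hγ => ?_⟩, (le_max_left _ _).trans h0.le⟩
    have h1 : ¬ ∀ c ∈ range f, c < γ := fun h1 => hmin γ h1 hγ
    push Not at h1
    obtain ⟨_, ⟨n, rfl⟩, hn⟩ := h1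
    exact (hmono hn).trans_lt (hstep n ▸ hδ (f (n + 1)) ⟨n + 1, rfl⟩)

theorem exists_isGuess (hD : DiamondAlephOne) :
    ∃ S : OmegaOne → Set (Name OmegaOne × Name OmegaOne), IsGuess S := by
  obtain ⟨S, -, hS⟩ := hD
  obtain ⟨e, he⟩ := OmegaOne.exists_embedding_name
  refine ⟨fun δ => {x | e x ∈ S δ}, fun A γ₀ g => ?_⟩
  -- Everything that must lie below `δ` as soon as `γ < δ`. Taking least strict bounds of the
  -- increasing sets `T γ` makes `h` monotone.
  let T : OmegaOne → Set OmegaOne := fun γ =>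
    g '' Iic γ ∪ e '' ({p : Name OmegaOne | p.1 ≤ γ} ×ˢ {p : Name OmegaOne | p.1 ≤ γ})
  have hT : ∀ γ, (T γ).Countable := by
    intro γ
    have h1 : (Iic γ).Countable :=
      ((OmegaOne.countable_Iio γ).insert γ).mono fun b hb => (le_iff_eq_or_lt.1 hb).imp id id
    have h2 : {p : Name OmegaOne | p.1 ≤ γ}.Countable :=
      Countable.mono (fun p hp => mk_mem_prod hp (mem_univ p.2)) (h1.prod countable_univ)
    exact (h1.image g).union ((h2.prod h2).image e)
  have hTmono : ∀ γ γ', γ ≤ γ' → T γ ⊆ T γ' := by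
    rintro γ γ' hle _ (⟨b, hb, rfl⟩ | ⟨⟨p, q⟩, ⟨hp, hq⟩, rfl⟩)
    · exact .inl ⟨b, le_trans hb hle, rfl⟩
    · exact .inr ⟨(p, q), ⟨le_trans hp hle, le_trans hq hle⟩, rfl⟩
  have hmin : ∀ γ, ∃ b, (∀ a ∈ T γ, a < b) ∧ ∀ c, (∀ a ∈ T γ, a < c) → b ≤ c := by
    intro γ
    obtain ⟨b, hb, h1⟩ := WellFounded.has_min (wellFounded_lt (α := OmegaOne))
      {b | ∀ a ∈ T γ, a < b} (OmegaOne.exists_gt_of_countable (hT γ))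
    exact ⟨b, hb, fun c hc => not_lt.1 (h1 c hc)⟩
  choose h hh hleast using hmin
  obtain ⟨δ, hδ, hδ₀, hcl⟩ := hS (e '' A) (OmegaOne.isClub_closure_points γ₀ (h := h)
    fun γ γ' hle => hleast γ _ fun a ha => hh γ' a (hTmono γ γ' hle ha))
  refine ⟨δ, hδ₀, fun γ hγ => (hh γ _ (.inl ⟨γ, self_mem_Iic, rfl⟩)).trans (hcl γ hγ),
    fun p q hp hq => ?_⟩
  have hlt : e (p, q) < δ := (hh (max p.1 q.1) _ (.inr ⟨(p, q),
    ⟨le_max_left p.1 q.1, le_max_right p.1 q.1⟩, rfl⟩)).trans (hcl _ (max_lt hp hq))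
  change _ ↔ e (p, q) ∈ S δ
  rw [← show e '' A ∩ Iio δ = S δ from hδ]
  exact ⟨fun hA => ⟨⟨_, hA, rfl⟩, hlt⟩, fun hA => he.mem_set_image.1 hA.1⟩

end Omega

end CWT

open CWT in
theorem mainTheorem3 (hD : DiamondAlephOne) :
    ∃ (M : Type) (_ : PartialOrder M) (_ : OrderBot M) (x : CWT.System M),
      x.IsNice ∧ x.IsGood := by
  obtain ⟨S, hS⟩ := exists_isGuess hD
  obtain ⟨M, i, j, C, D, hF⟩ := exists_frame OmegaOne.countable_Iio
    (fun s hs => OmegaOne.exists_gt_of_countable hs) hS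
  have hbdd := fun (s : Set OmegaOne) hs => OmegaOne.exists_gt_of_countable (s := s) hs
  exact ⟨M, i, j, hF.system hbdd, hF.isNice hbdd, hF.isGood hbdd⟩
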